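/- Let $\{X_{i,j} : i,j\in\{1,2,\dots\},\ i\ge j\}$ be i.i.d. complex-valued random variables with variance $1$, i.e. $\mathbb E|X_{i,j}-\mathbb E X_{i,j}|^2=1$ (the mean need not be $0$). For each integer $n\ge 1$ let $X(n)$ be the lower triangular $n\times n$ matrix whose $(i,j)$ entry is $X_{i,j}$ for $1\le j\le i\le n$ and $0$ for $i<j$. Let $\lambda^{(n)}_1\ge\dots\ge\lambda^{(n)}_n\ge 0$ be the eigenvalues, with multiplicity, of $\frac1n X(n)X(n)^*$, and let $L_n=\frac1n\sum_{i=1}^n\delta_{\lambda^{(n)}_i}$ be their empirical distribution. Then there is a deterministic probability measure $\mu_0$ on $\mathbb R$, the same for all laws of the entries, with finite moments $$\int_{\mathbb R}x^k\,d\mu_0(x)=\frac{k^k}{(k+1)!}\qquad\text{for all integers }k\ge 0\quad(\text{where }0^0=1),$$ such that, with probability $1$, $L_n$ converges weakly to $\mu_0$ as $n\to\infty$. -/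

import Mathlib

open MeasureTheory ProbabilityTheory Filter Topology
open scoped Matrix ENNReal

/-- The index set of the entries on and below the diagonal of an infinite matrix: pairs `(i, j)`
(row, column) with `j ≤ i`. Rows and columns are numbered from `0`. -/
abbrev LowerIndex : Type := {p : ℕ × ℕ // p.2 ≤ p.1}

/-- The lower triangular `n × n` matrix with entries `x (i, j)` for `j ≤ i` and `0` above the
diagonal. -/
def lowerTriangular (x : LowerIndex → ℂ) (n : ℕ) : Matrix (Fin n) (Fin n) ℂ :=
  Matrix.of fun i j =>
    if h : (j : ℕ) ≤ (i : ℕ) then x ⟨((i : ℕ), (j : ℕ)), h⟩ else 0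

/-- The matrix `S_n = (1 / n) X(n) X(n)^*`. -/
noncomputable def scaledGram (x : LowerIndex → ℂ) (n : ℕ) : Matrix (Fin n) (Fin n) ℂ :=
  (1 / (n : ℂ)) • (lowerTriangular x n * (lowerTriangular x n)ᴴ)

theorem scaledGram_isHermitian (x : LowerIndex → ℂ) (n : ℕ) :
    (scaledGram x n).IsHermitian := by
  have h := Matrix.isHermitian_mul_conjTranspose_self (lowerTriangular x n)
  unfold scaledGram Matrix.IsHermitian
  rw [Matrix.conjTranspose_smul, h.eq]
  simp

/-- The empirical distribution `(1 / n) ∑ δ_{λ_i}` of the eigenvalues, counted with multiplicity,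
of a Hermitian `n × n` matrix, `n ≥ 1`. -/
noncomputable def empiricalSpectralDistribution {n : ℕ} [NeZero n]
    (A : Matrix (Fin n) (Fin n) ℂ) (hA : A.IsHermitian) : ProbabilityMeasure ℝ :=
  ⟨(n : ℝ≥0∞)⁻¹ • ∑ i : Fin n, Measure.dirac (hA.eigenvalues i), ⟨by
    simp [Measure.finsetSum_apply, ENNReal.inv_mul_cancel, NeZero.ne n]⟩⟩

/-- The random measure `L_n`, `n ≥ 1`. -/
noncomputable def triangularESD (x : LowerIndex → ℂ) (n : ℕ) [NeZero n] :
    ProbabilityMeasure ℝ :=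
  empiricalSpectralDistribution (scaledGram x n) (scaledGram_isHermitian x n)

/-- The variables `X_{i,j}`, `i ≥ j`, are i.i.d. complex random variables with variance
`E|X - E X|² = 1`. No assumption is made on the mean. -/
structure IsIIDVarianceOne {Ω : Type*} [MeasurableSpace Ω] (P : Measure Ω)
    (X : LowerIndex → Ω → ℂ) : Prop where
  measurable : ∀ p, Measurable (X p)
  indep : iIndepFun X P
  identDistrib : ∀ p q, IdentDistrib (X p) (X q) P P
  memLp_two : ∀ p, MemLp (X p) 2 P
  variance_eq_one : ∀ p, ∫ ω, ‖X p ω - ∫ ω', X p ω' ∂P‖ ^ 2 ∂P = 1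

/-!
The proof determines the Stieltjes transform of the limit and does not compute moments of traces.
Write `A = X(n)`, `y = n x` with `x > 0`, `G = (A A^* + y)⁻¹` and `G' = (A^* A + y)⁻¹`; then
`tr G = tr G'` is the integral of `1 / (x + l)` against the empirical spectral distribution.

*The self-consistent equation.* Let the entries be centered. Row `i` of `A` occupies the columns
`j ≤ i`. A Schur complement gives `y G_ii = 1 / (1 + q)`, where `q` is the quadratic form in row `i`
of a companion resolvent that does not depend on that row. A quadratic form in independent entries
of unit variance concentrates around the trace, and partial traces of resolvents concentrate around
their means by bounded differences, so `q` is close to the sum over `j ≤ i` of `E G'_jj`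
(`abs_integral_gramResolvent_diag_sub_le`). Reflection in the antidiagonal preserves the law of `A`
and exchanges `G` with `G'`. Hence `a_k = 1 + ∑_{j < k} E G'_jj` satisfies
`a_{k+1} - a_k ≈ 1 / (y a_{n-k})`, a discrete form of `a'(t) = 1 / (x a(1 - t))`, `a(0) = 1`. Its
solutions have `a(t) a(1 - t) = c` constant, so `a(t) = e ^ (t / (x c))` with `c = a(1)`. In the
parametrization `x = 1 / (w e ^ w)` this is `c = e ^ w`, so that `E tr G → e ^ w - 1`
(`abs_log_sub_le_of_reflected_equation`, `tendsto_integral_partialTrace_univ`).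

*Almost sure convergence for all laws.* Bounded differences with respect to the rows and the
Borel–Cantelli lemma give almost sure convergence of the trace. A nonzero mean adds a multiple of
the triangular matrix of ones, which is the sum of a matrix of rank `O(√n)` and one whose Frobenius
norm is `O(n ^ (3/4))`; neither changes the limit of the trace (`ae_tendsto_trace`).

*Weak convergence.* The span of the constants and the functions `l ↦ 1 / (x + l)` on `ℝ≥0` has as
its closure an algebra that separates points, and convergence of the Stieltjes transforms forces
tightness, so it implies weak convergence to any law with the limiting transform
(`tendsto_of_tendsto_stieltjes`). Such a law exists by Prokhorov's theorem, applied to a realization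
of an array with Gaussian entries (`exists_stieltjes_eq`).

*Moments.* Put `t = w e ^ w = 1 / x`. Abel's identity yields the expansion of `e ^ w` in powers of
`t`, with coefficients `(1 - k) ^ (k - 1) / k!` (`exp_sub_abel_isBigO`). Thus
`(e ^ w - 1) / t`, the integral of `1 / (1 + t l)` against the limit, has the asymptotic expansion
`∑ (-t) ^ k k ^ k / (k + 1)!`, and monotone convergence as `t` decreases to `0` identifies the
moments one after the other (`moments_of_stieltjes`).
-/


/-! ### Resolvents of Gram matrices -/

section GramResolvent

variable {n : Type*} [Fintype n]

theorem star_dotProduct_self_eq (v : n → ℂ) :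
    star v ⬝ᵥ v = ((∑ i, ‖v i‖ ^ 2 : ℝ) : ℂ) := by
  simp [dotProduct, Complex.conj_mul']

theorem norm_star_dotProduct_le (b v : n → ℂ) :
    ‖star b ⬝ᵥ v‖ ≤ √(∑ i, ‖b i‖ ^ 2) * √(∑ i, ‖v i‖ ^ 2) := by
  refine (norm_sum_le _ _).trans ?_
  simp only [Pi.star_apply, norm_mul, norm_star]
  exact Real.sum_mul_le_sqrt_mul_sqrt _ _ _

variable [DecidableEq n]

/-- The resolvent `(A Aᴴ + y)⁻¹` of the Gram matrix of `A` at the point `-y`; it is the junk inverse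
unless `A Aᴴ + y` is invertible, which holds for `y > 0`. The companion resolvent `(Aᴴ A + y)⁻¹` is
`gramResolvent Aᴴ y`. -/
noncomputable def gramResolvent (A : Matrix n n ℂ) (y : ℝ) : Matrix n n ℂ :=
  (A * Aᴴ + (y : ℂ) • 1)⁻¹

open scoped ComplexOrder in
theorem isUnit_det_gram_add (A : Matrix n n ℂ) {y : ℝ} (hy : 0 < y) :
    IsUnit (A * Aᴴ + (y : ℂ) • (1 : Matrix n n ℂ)).det := by
  have h1 : (A * Aᴴ).PosSemidef := Matrix.posSemidef_self_mul_conjTranspose A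
  have h2 : ((y : ℂ) • (1 : Matrix n n ℂ)).PosDef :=
    Matrix.PosDef.one.smul (by exact_mod_cast hy)
  exact (Matrix.isUnit_iff_isUnit_det _).1 (Matrix.PosDef.posSemidef_add h1 h2).isUnit

theorem gram_add_mul_gramResolvent (A : Matrix n n ℂ) {y : ℝ} (hy : 0 < y) :
    (A * Aᴴ + (y : ℂ) • 1) * gramResolvent A y = 1 :=
  Matrix.mul_nonsing_inv _ (isUnit_det_gram_add A hy)

theorem gramResolvent_mul_gram_add (A : Matrix n n ℂ) {y : ℝ} (hy : 0 < y) :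
    gramResolvent A y * (A * Aᴴ + (y : ℂ) • 1) = 1 :=
  Matrix.nonsing_inv_mul _ (isUnit_det_gram_add A hy)

theorem gramResolvent_eq_of_mul_eq_one {A : Matrix n n ℂ} {y : ℝ} {M : Matrix n n ℂ}
    (h : (A * Aᴴ + (y : ℂ) • 1) * M = 1) : gramResolvent A y = M :=
  Matrix.inv_eq_right_inv h

theorem conjTranspose_gramResolvent (A : Matrix n n ℂ) (y : ℝ) :
    (gramResolvent A y)ᴴ = gramResolvent A y := by
  rw [gramResolvent, Matrix.conjTranspose_nonsing_inv]
  simp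

/-- The quadratic form of the resolvent at `b` is `‖Aᴴ v‖² + y ‖v‖²` for `v = (A Aᴴ + y)⁻¹ b`. -/
theorem star_dotProduct_gramResolvent_mulVec (A : Matrix n n ℂ) {y : ℝ} (hy : 0 < y) (b : n → ℂ) :
    star b ⬝ᵥ (gramResolvent A y *ᵥ b) =
      ((∑ j, ‖(Aᴴ *ᵥ (gramResolvent A y *ᵥ b)) j‖ ^ 2 +
        y * ∑ i, ‖(gramResolvent A y *ᵥ b) i‖ ^ 2 : ℝ) : ℂ) := by
  set v := gramResolvent A y *ᵥ b with hv
  have hb : b = (A * Aᴴ + (y : ℂ) • 1) *ᵥ v := by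
    rw [hv, Matrix.mulVec_mulVec, gram_add_mul_gramResolvent A hy, Matrix.one_mulVec]
  have h1 : star b ⬝ᵥ v = star (star v ⬝ᵥ b) := by
    simp [dotProduct, mul_comm]
  have h2 : star v ⬝ᵥ b = star (Aᴴ *ᵥ v) ⬝ᵥ (Aᴴ *ᵥ v) + (y : ℂ) * (star v ⬝ᵥ v) := by
    clear_value v
    rw [hb, Matrix.add_mulVec, dotProduct_add, Matrix.smul_mulVec, Matrix.one_mulVec,
      dotProduct_smul, smul_eq_mul, ← Matrix.mulVec_mulVec, Matrix.star_mulVec,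
      Matrix.conjTranspose_conjTranspose, Matrix.dotProduct_mulVec (star v)]
  rw [h1, h2, star_dotProduct_self_eq, star_dotProduct_self_eq]
  simp

theorem sum_norm_sq_gramResolvent_mulVec_le (A : Matrix n n ℂ) {y : ℝ} (hy : 0 < y) (b : n → ℂ) :
    ∑ i, ‖(gramResolvent A y *ᵥ b) i‖ ^ 2 ≤ (∑ i, ‖b i‖ ^ 2) / y ^ 2 := by
  have h := star_dotProduct_gramResolvent_mulVec A hy b
  have h2 := norm_star_dotProduct_le b (gramResolvent A y *ᵥ b)
  set V := ∑ i, ‖(gramResolvent A y *ᵥ b) i‖ ^ 2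
  set B := ∑ i, ‖b i‖ ^ 2
  set W := ∑ j, ‖(Aᴴ *ᵥ (gramResolvent A y *ᵥ b)) j‖ ^ 2
  have hV : 0 ≤ V := by positivity
  have hW : 0 ≤ W := by positivity
  have hB : 0 ≤ B := by positivity
  rw [h, Complex.norm_real, Real.norm_of_nonneg (by positivity)] at h2
  have h3 : y * √V ≤ √B := by
    by_contra! hc
    have hV0 : 0 < √V := by
      by_contra! h0
      have := Real.sqrt_nonneg V
      have h0' : √V = 0 := le_antisymm h0 this
      rw [h0'] at hc
      simp only [mul_zero] at hc
      exact absurd hc (not_lt.2 (Real.sqrt_nonneg B))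
    nlinarith [Real.mul_self_sqrt hV]
  rw [le_div_iff₀ (by positivity)]
  have h4 : (y * √V) ^ 2 ≤ √B ^ 2 := by gcongr
  rw [mul_pow, Real.sq_sqrt hV, Real.sq_sqrt hB] at h4
  linarith

theorem sum_norm_sq_conjTranspose_mulVec_gramResolvent_le (A : Matrix n n ℂ) {y : ℝ} (hy : 0 < y)
    (b : n → ℂ) :
    ∑ j, ‖(Aᴴ *ᵥ (gramResolvent A y *ᵥ b)) j‖ ^ 2 ≤ (∑ i, ‖b i‖ ^ 2) / y := by
  have h := star_dotProduct_gramResolvent_mulVec A hy b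
  have h2 := norm_star_dotProduct_le b (gramResolvent A y *ᵥ b)
  have h3 := sum_norm_sq_gramResolvent_mulVec_le A hy b
  set V := ∑ i, ‖(gramResolvent A y *ᵥ b) i‖ ^ 2
  set B := ∑ i, ‖b i‖ ^ 2
  set W := ∑ j, ‖(Aᴴ *ᵥ (gramResolvent A y *ᵥ b)) j‖ ^ 2
  have hV : 0 ≤ V := by positivity
  have hW : 0 ≤ W := by positivity
  have hB : 0 ≤ B := by positivity
  rw [h, Complex.norm_real, Real.norm_of_nonneg (by positivity)] at h2
  calc W ≤ √B * √V := by nlinarith [mul_nonneg hy.le hV]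
    _ ≤ √B * √(B / y ^ 2) := by gcongr
    _ = B / y := by
      rw [Real.sqrt_div hB, Real.sqrt_sq hy.le, ← mul_div_assoc, Real.mul_self_sqrt hB]

theorem gramResolvent_quadForm_re_nonneg (A : Matrix n n ℂ) {y : ℝ} (hy : 0 < y) (b : n → ℂ) :
    0 ≤ (star b ⬝ᵥ (gramResolvent A y *ᵥ b)).re := by
  rw [star_dotProduct_gramResolvent_mulVec A hy, Complex.ofReal_re]
  positivity

theorem gramResolvent_quadForm_im (A : Matrix n n ℂ) {y : ℝ} (hy : 0 < y) (b : n → ℂ) :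
    (star b ⬝ᵥ (gramResolvent A y *ᵥ b)).im = 0 := by
  rw [star_dotProduct_gramResolvent_mulVec A hy, Complex.ofReal_im]

theorem star_single_dotProduct_mulVec_single (M : Matrix n n ℂ) (j : n) :
    star (Pi.single j (1 : ℂ)) ⬝ᵥ (M *ᵥ Pi.single j 1) = M j j := by
  have : star (Pi.single j (1 : ℂ) : n → ℂ) = Pi.single j 1 := by
    ext i; by_cases h : i = j <;> simp [h]
  rw [this]; simp

theorem gramResolvent_diag_re_nonneg (A : Matrix n n ℂ) {y : ℝ} (hy : 0 < y) (j : n) :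
    0 ≤ (gramResolvent A y j j).re := by
  have := gramResolvent_quadForm_re_nonneg A hy (Pi.single j 1)
  rwa [star_single_dotProduct_mulVec_single] at this

theorem sum_norm_sq_single_one (j : n) : ∑ i, ‖(Pi.single j (1 : ℂ) : n → ℂ) i‖ ^ 2 = 1 := by
  rw [Finset.sum_eq_single j] <;> simp +contextual

theorem sum_norm_sq_gramResolvent_col_le (A : Matrix n n ℂ) {y : ℝ} (hy : 0 < y) (j : n) :
    ∑ i, ‖gramResolvent A y i j‖ ^ 2 ≤ 1 / y ^ 2 := by
  have := sum_norm_sq_gramResolvent_mulVec_le A hy (Pi.single j 1)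
  rw [sum_norm_sq_single_one] at this
  simpa using this

theorem norm_gramResolvent_apply_le (A : Matrix n n ℂ) {y : ℝ} (hy : 0 < y) (i j : n) :
    ‖gramResolvent A y i j‖ ≤ 1 / y := by
  have h := sum_norm_sq_gramResolvent_col_le A hy j
  have h1 : ‖gramResolvent A y i j‖ ^ 2 ≤ ∑ i, ‖gramResolvent A y i j‖ ^ 2 :=
    Finset.single_le_sum (f := fun i => ‖gramResolvent A y i j‖ ^ 2)
      (fun _ _ => by positivity) (Finset.mem_univ i)
  refine le_of_sq_le_sq (α := ℝ) ?_ (by positivity)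
  rw [div_pow, one_pow]; exact h1.trans h

theorem gramResolvent_diag_re_le (A : Matrix n n ℂ) {y : ℝ} (hy : 0 < y) (j : n) :
    (gramResolvent A y j j).re ≤ 1 / y :=
  (Complex.re_le_norm _).trans (norm_gramResolvent_apply_le A hy j j)

/-- The push-through identity `y (A Aᴴ + y)⁻¹ = 1 - A (Aᴴ A + y)⁻¹ Aᴴ`. -/
theorem smul_gramResolvent_eq (A : Matrix n n ℂ) {y : ℝ} (hy : 0 < y) :
    (y : ℂ) • gramResolvent A y = 1 - A * gramResolvent Aᴴ y * Aᴴ := by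
  have hA := gramResolvent_mul_gram_add A hy
  have hB := gram_add_mul_gramResolvent Aᴴ hy
  rw [Matrix.conjTranspose_conjTranspose] at hB
  have hpush : gramResolvent A y * A = A * gramResolvent Aᴴ y := by
    calc gramResolvent A y * A
        = gramResolvent A y * (A * ((Aᴴ * A + (y : ℂ) • 1) * gramResolvent Aᴴ y)) := by
          rw [hB, Matrix.mul_one]
      _ = gramResolvent A y * (A * Aᴴ + (y : ℂ) • 1) * (A * gramResolvent Aᴴ y) := by
          simp only [Matrix.mul_add, Matrix.add_mul, Matrix.mul_assoc, Matrix.smul_mul,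
            Matrix.mul_smul, Matrix.one_mul]
      _ = A * gramResolvent Aᴴ y := by rw [hA, Matrix.one_mul]
  rw [← hpush, Matrix.mul_assoc, eq_sub_iff_add_eq, ← hA, Matrix.mul_add, Matrix.mul_smul,
    Matrix.mul_one, add_comm]

theorem trace_gramResolvent_conjTranspose (A : Matrix n n ℂ) {y : ℝ} (hy : 0 < y) :
    (gramResolvent Aᴴ y).trace = (gramResolvent A y).trace := by
  have hy' : (y : ℂ) ≠ 0 := by exact_mod_cast hy.ne'
  have h1 := congrArg Matrix.trace (smul_gramResolvent_eq A hy)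
  have h2 := congrArg Matrix.trace (gram_add_mul_gramResolvent Aᴴ hy)
  rw [Matrix.conjTranspose_conjTranspose, Matrix.add_mul, Matrix.smul_mul, Matrix.one_mul,
    Matrix.trace_add, Matrix.trace_smul] at h2
  rw [Matrix.trace_smul, Matrix.trace_sub, ← h2, Matrix.mul_assoc A, Matrix.trace_mul_comm A,
    Matrix.trace_mul_comm (Aᴴ * A), Matrix.mul_assoc, add_sub_cancel_left] at h1
  exact (mul_left_cancel₀ hy' h1).symm

end GramResolvent

/-! ### Changing one row -/

section Row

variable {n : Type*} [Fintype n] [DecidableEq n]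

theorem conjTranspose_mul_self_eq_updateRow (A : Matrix n n ℂ) (i : n) :
    Aᴴ * A = (A.updateRow i 0)ᴴ * A.updateRow i 0 + Matrix.vecMulVec (star (A i)) (A i) := by
  ext j k
  simp only [Matrix.mul_apply, Matrix.conjTranspose_apply, Matrix.add_apply, Matrix.vecMulVec_apply,
    Pi.star_apply]
  rw [← Finset.add_sum_erase _ _ (Finset.mem_univ i), ← Finset.add_sum_erase _ _ (Finset.mem_univ i)]
  simp only [Matrix.updateRow_self, Pi.zero_apply, star_zero, zero_mul, zero_add]
  rw [add_comm]
  congr 1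
  refine Finset.sum_congr rfl fun l hl => ?_
  rw [Matrix.updateRow_ne (Finset.ne_of_mem_erase hl)]

/-- The Sherman-Morrison formula for `Aᴴ A + y`: the effect of row `i` of `A`. -/
theorem gramResolvent_conjTranspose_eq_updateRow (A : Matrix n n ℂ) (i : n) {y : ℝ} (hy : 0 < y) :
    gramResolvent Aᴴ y = gramResolvent (A.updateRow i 0)ᴴ y -
      (1 + A i ⬝ᵥ (gramResolvent (A.updateRow i 0)ᴴ y *ᵥ star (A i)))⁻¹ •
        Matrix.vecMulVec (gramResolvent (A.updateRow i 0)ᴴ y *ᵥ star (A i))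
          (star (gramResolvent (A.updateRow i 0)ᴴ y *ᵥ star (A i))) := by
  set B := A.updateRow i 0
  set R := gramResolvent Bᴴ y with hR
  set r := A i
  set u := R *ᵥ star r with hu
  set q := r ⬝ᵥ u with hq
  have hq0 : 1 + q ≠ 0 := by
    have h := gramResolvent_quadForm_re_nonneg Bᴴ hy (star r)
    rw [star_star] at h
    intro h0
    have := congrArg Complex.re h0
    simp only [Complex.add_re, Complex.one_re, Complex.zero_re] at this
    change 0 ≤ q.re at h
    linarith
  have hBR : (Bᴴ * B + (y : ℂ) • 1) * R = 1 := by
    have := gram_add_mul_gramResolvent Bᴴ hy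
    rwa [Matrix.conjTranspose_conjTranspose] at this
  have hBu : (Bᴴ * B + (y : ℂ) • 1) *ᵥ u = star r := by
    rw [hu, Matrix.mulVec_mulVec, hBR, Matrix.one_mulVec]
  have hrR : r ᵥ* R = star u := by
    rw [hu, Matrix.star_mulVec, star_star, hR, conjTranspose_gramResolvent]
  apply gramResolvent_eq_of_mul_eq_one
  rw [Matrix.conjTranspose_conjTranspose, conjTranspose_mul_self_eq_updateRow A i,
    add_right_comm, Matrix.add_mul, Matrix.mul_sub, Matrix.mul_sub, hBR, Matrix.mul_smul,
    Matrix.mul_smul, Matrix.mul_vecMulVec, hBu, Matrix.vecMulVec_mul, hrR,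
    Matrix.vecMulVec_mul_vecMulVec, ← hq]
  simp only [Matrix.vecMulVec_smul, smul_smul]
  set V := Matrix.vecMulVec (star r) (star u)
  have : (1 + q)⁻¹ * q = 1 - (1 + q)⁻¹ := by field_simp; ring
  rw [this, sub_smul, one_smul]
  abel

/-- The quadratic form `r (Bᴴ B + y)⁻¹ r*` of row `r` of `A`, where `B` is `A` with row `i` replaced by
zero. It is real, so only its real part is recorded. -/
noncomputable def rowForm (A : Matrix n n ℂ) (i : n) (y : ℝ) : ℝ :=
  (A i ⬝ᵥ (gramResolvent (A.updateRow i 0)ᴴ y *ᵥ star (A i))).re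

theorem ofReal_rowForm (A : Matrix n n ℂ) (i : n) {y : ℝ} (hy : 0 < y) :
    (rowForm A i y : ℂ) = A i ⬝ᵥ (gramResolvent (A.updateRow i 0)ᴴ y *ᵥ star (A i)) := by
  have h := gramResolvent_quadForm_im (A.updateRow i 0)ᴴ hy (star (A i))
  rw [star_star] at h
  exact Complex.ext rfl h.symm

theorem rowForm_nonneg (A : Matrix n n ℂ) (i : n) {y : ℝ} (hy : 0 < y) : 0 ≤ rowForm A i y := by
  have h := gramResolvent_quadForm_re_nonneg (A.updateRow i 0)ᴴ hy (star (A i))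
  rwa [star_star] at h

theorem gramResolvent_diag_eq_rowForm (A : Matrix n n ℂ) (i : n) {y : ℝ} (hy : 0 < y) :
    y * (gramResolvent A y i i).re = 1 / (1 + rowForm A i y) := by
  have h1 := congrFun (congrFun (smul_gramResolvent_eq A hy) i) i
  have h2 : (A * gramResolvent Aᴴ y * Aᴴ) i i = A i ⬝ᵥ (gramResolvent Aᴴ y *ᵥ star (A i)) := by
    rw [Matrix.mul_assoc, Matrix.mul_apply]
    rfl
  have hq := rowForm_nonneg A i hy
  have h3 : star (gramResolvent (A.updateRow i 0)ᴴ y *ᵥ star (A i)) ⬝ᵥ star (A i) =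
      (rowForm A i y : ℂ) := by
    rw [Matrix.star_dotProduct_star, ← ofReal_rowForm A i hy]
    simp
  rw [Matrix.sub_apply, h2, gramResolvent_conjTranspose_eq_updateRow A i hy, Matrix.sub_mulVec,
    dotProduct_sub, Matrix.smul_mulVec, dotProduct_smul, Matrix.vecMulVec_mulVec, h3,
    ← ofReal_rowForm A i hy] at h1
  simp only [Matrix.smul_apply, smul_eq_mul, Matrix.one_apply_eq, dotProduct_smul,
    MulOpposite.smul_eq_mul_unop, MulOpposite.unop_op, ← ofReal_rowForm A i hy] at h1
  generalize rowForm A i y = q at h1 hq ⊢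
  have h5 : (y : ℂ) * gramResolvent A y i i = ((1 - (q - (1 + q)⁻¹ * (q * q)) : ℝ) : ℂ) := by
    rw [h1]; push_cast; ring
  have h4 := congrArg Complex.re h5
  rw [Complex.re_ofReal_mul, Complex.ofReal_re] at h4
  rw [h4]
  field_simp
  ring

/-- Replacing a row by zero increases every partial trace of `(Aᴴ A + y)⁻¹`, by at most `1 / y`,
whatever the row is. -/
theorem sum_gramResolvent_updateRow_sub_mem_Icc (A : Matrix n n ℂ) (i : n) {y : ℝ} (hy : 0 < y)
    (S : Finset n) :
    ∑ j ∈ S, (gramResolvent (A.updateRow i 0)ᴴ y j j).re - ∑ j ∈ S, (gramResolvent Aᴴ y j j).re ∈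
      Set.Icc 0 (1 / y) := by
  have hq := rowForm_nonneg A i hy
  have hE := star_dotProduct_gramResolvent_mulVec (A.updateRow i 0)ᴴ hy (star (A i))
  rw [star_star, ← ofReal_rowForm A i hy, Complex.ofReal_inj] at hE
  set u := gramResolvent (A.updateRow i 0)ᴴ y *ᵥ star (A i) with hu
  have hterm : ∀ j, (gramResolvent (A.updateRow i 0)ᴴ y j j).re - (gramResolvent Aᴴ y j j).re =
      (1 + rowForm A i y)⁻¹ * ‖u j‖ ^ 2 := by
    intro j
    rw [gramResolvent_conjTranspose_eq_updateRow A i hy, ← ofReal_rowForm A i hy, ← hu]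
    have : (1 + (rowForm A i y : ℂ))⁻¹ * (u j * star (u j)) =
        (((1 + rowForm A i y)⁻¹ * ‖u j‖ ^ 2 : ℝ) : ℂ) := by
      rw [Complex.star_def, Complex.mul_conj']
      push_cast; rfl
    simp only [Matrix.sub_apply, Matrix.smul_apply, Matrix.vecMulVec_apply, smul_eq_mul,
      Pi.star_apply, this, Complex.sub_re, Complex.ofReal_re]
    ring
  rw [← Finset.sum_sub_distrib, Finset.sum_congr rfl fun j _ => hterm j, ← Finset.mul_sum]
  refine ⟨by positivity, ?_⟩
  have h1 : ∑ j ∈ S, ‖u j‖ ^ 2 ≤ ∑ j, ‖u j‖ ^ 2 :=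
    Finset.sum_le_sum_of_subset_of_nonneg (Finset.subset_univ S) fun _ _ _ => by positivity
  have h2 : y * ∑ j, ‖u j‖ ^ 2 ≤ rowForm A i y := by
    rw [hE]
    exact le_add_of_nonneg_left (by positivity)
  rw [inv_mul_le_iff₀ (by positivity), mul_one_div, le_div_iff₀ hy]
  nlinarith

end Row

/-! ### Perturbation of the trace of the resolvent -/

section Perturbation

variable {n : Type*} [Fintype n]

theorem Matrix.rank_add_le_rank_add_rank (A B : Matrix n n ℂ) : (A + B).rank ≤ A.rank + B.rank := by
  unfold Matrix.rank
  rw [Matrix.mulVecLin_add]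
  refine (Submodule.finrank_mono (LinearMap.range_add_le _ _)).trans ?_
  exact Submodule.finrank_add_le_finrank_add_finrank _ _

theorem norm_trace_mul_le (D M : Matrix n n ℂ) :
    ‖(D * M).trace‖ ≤ √(∑ i, ∑ j, ‖D i j‖ ^ 2) * √(∑ j, ∑ i, ‖M i j‖ ^ 2) := by
  simp only [Matrix.trace, Matrix.diag, Matrix.mul_apply]
  have h1 : ∑ j, ∑ i, ‖M i j‖ ^ 2 = ∑ p : n × n, ‖M p.2 p.1‖ ^ 2 :=
    (Fintype.sum_prod_type (fun p : n × n => ‖M p.2 p.1‖ ^ 2)).symm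
  have h2 : ∑ i, ∑ j, ‖D i j‖ ^ 2 = ∑ p : n × n, ‖D p.1 p.2‖ ^ 2 :=
    (Fintype.sum_prod_type (fun p : n × n => ‖D p.1 p.2‖ ^ 2)).symm
  rw [h1, h2, ← Fintype.sum_prod_type (fun p : n × n => D p.1 p.2 * M p.2 p.1)]
  refine (norm_sum_le _ _).trans ?_
  simp only [norm_mul]
  exact Real.sum_mul_le_sqrt_mul_sqrt _ _ _

variable [DecidableEq n]

theorem gramResolvent_sub (A B : Matrix n n ℂ) {y : ℝ} (hy : 0 < y) :
    gramResolvent A y - gramResolvent B y =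
      gramResolvent A y * (B * Bᴴ - A * Aᴴ) * gramResolvent B y := by
  have h : B * Bᴴ - A * Aᴴ = (B * Bᴴ + (y : ℂ) • 1) - (A * Aᴴ + (y : ℂ) • 1) := by abel
  rw [h, Matrix.mul_sub, Matrix.sub_mul, Matrix.mul_assoc, gram_add_mul_gramResolvent B hy,
    gramResolvent_mul_gram_add A hy, Matrix.mul_one, Matrix.one_mul]

theorem gram_sub_gram (A B : Matrix n n ℂ) : B * Bᴴ - A * Aᴴ = (B - A) * Bᴴ + A * (B - A)ᴴ := by
  rw [Matrix.conjTranspose_sub]; noncomm_ring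

open scoped ComplexOrder in
theorem rank_gramResolvent_sub_le (A B : Matrix n n ℂ) {y : ℝ} (hy : 0 < y) :
    (gramResolvent A y - gramResolvent B y).rank ≤ 2 * (B - A).rank := by
  rw [gramResolvent_sub A B hy, gram_sub_gram]
  refine (Matrix.rank_mul_le_left _ _).trans ((Matrix.rank_mul_le_right _ _).trans ?_)
  refine (Matrix.rank_add_le_rank_add_rank _ _).trans ?_
  rw [two_mul]
  refine add_le_add (Matrix.rank_mul_le_left _ _) ?_
  exact (Matrix.rank_mul_le_right _ _).trans_eq (Matrix.rank_conjTranspose _)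

/-- The rank inequality: a Hermitian matrix whose quadratic form is bounded by `c` has trace at most
`c` times its rank. -/
theorem abs_re_trace_le_rank_mul {M : Matrix n n ℂ} (hM : M.IsHermitian) {c : ℝ}
    (h : ∀ b : n → ℂ, |(star b ⬝ᵥ (M *ᵥ b)).re| ≤ c * ∑ i, ‖b i‖ ^ 2) :
    |M.trace.re| ≤ c * M.rank := by
  have hev : ∀ i, |hM.eigenvalues i| ≤ c := by
    intro i
    have h1 := h (hM.eigenvectorBasis i)
    have h2 : ∑ j, ‖(hM.eigenvectorBasis i) j‖ ^ 2 = 1 := by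
      rw [← EuclideanSpace.norm_sq_eq, hM.eigenvectorBasis.orthonormal.1 i, one_pow]
    rw [h2, mul_one, hM.mulVec_eigenvectorBasis] at h1
    have h3 := star_dotProduct_self_eq (hM.eigenvectorBasis i).ofLp
    rw [h2] at h3
    rw [dotProduct_smul, h3] at h1
    simpa using h1
  have htr : M.trace.re = ∑ i, hM.eigenvalues i := by
    rw [hM.trace_eq_sum_eigenvalues]; simp
  rw [htr, hM.rank_eq_card_non_zero_eigs]
  have hs : ∑ i, hM.eigenvalues i =
      ∑ i ∈ Finset.univ.filter (fun i => hM.eigenvalues i ≠ 0), hM.eigenvalues i := by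
    rw [Finset.sum_filter_ne_zero]
  rw [hs]
  refine (Finset.abs_sum_le_sum_abs _ _).trans ((Finset.sum_le_card_nsmul _ _ c
    fun i _ => hev i).trans ?_)
  rw [nsmul_eq_mul, mul_comm, Fintype.card_subtype]

theorem abs_re_trace_gramResolvent_sub_le_rank (A B : Matrix n n ℂ) {y : ℝ} (hy : 0 < y) :
    |(gramResolvent A y).trace.re - (gramResolvent B y).trace.re| ≤ 2 * (B - A).rank / y := by
  have hH : (gramResolvent A y - gramResolvent B y).IsHermitian := by
    rw [Matrix.IsHermitian, Matrix.conjTranspose_sub, conjTranspose_gramResolvent,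
      conjTranspose_gramResolvent]
  have hb : ∀ (C : Matrix n n ℂ) (b : n → ℂ),
      (star b ⬝ᵥ (gramResolvent C y *ᵥ b)).re ≤ 1 / y * ∑ i, ‖b i‖ ^ 2 := by
    intro C b
    have h1 := norm_star_dotProduct_le b (gramResolvent C y *ᵥ b)
    have h2 := sum_norm_sq_gramResolvent_mulVec_le C hy b
    calc (star b ⬝ᵥ (gramResolvent C y *ᵥ b)).re
        ≤ √(∑ i, ‖b i‖ ^ 2) * √(∑ i, ‖(gramResolvent C y *ᵥ b) i‖ ^ 2) :=
          (Complex.re_le_norm _).trans h1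
      _ ≤ √(∑ i, ‖b i‖ ^ 2) * √((∑ i, ‖b i‖ ^ 2) / y ^ 2) := by gcongr
      _ = 1 / y * ∑ i, ‖b i‖ ^ 2 := by
        rw [Real.sqrt_div (by positivity), Real.sqrt_sq hy.le, ← mul_div_assoc,
          Real.mul_self_sqrt (by positivity)]
        ring
  have h := abs_re_trace_le_rank_mul hH (c := 1 / y) fun b => by
    have h1 := hb A b
    have h2 := hb B b
    have h3 := gramResolvent_quadForm_re_nonneg A hy b
    have h4 := gramResolvent_quadForm_re_nonneg B hy b
    rw [Matrix.sub_mulVec, dotProduct_sub, Complex.sub_re, abs_le]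
    constructor <;> linarith
  rw [Matrix.trace_sub, Complex.sub_re] at h
  refine h.trans ?_
  have := rank_gramResolvent_sub_le A B hy
  rw [one_div, inv_mul_eq_div]
  gcongr
  exact_mod_cast this

theorem sum_norm_sq_conjTranspose_mul_gramResolvent_mul_le (A B : Matrix n n ℂ) {y : ℝ}
    (hy : 0 < y) :
    ∑ j, ∑ i, ‖(Bᴴ * gramResolvent B y * gramResolvent A y) i j‖ ^ 2 ≤ Fintype.card n / y ^ 3 := by
  have h : ∀ j, ∑ i, ‖(Bᴴ * gramResolvent B y * gramResolvent A y) i j‖ ^ 2 ≤ 1 / y ^ 3 := by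
    intro j
    have h2 := sum_norm_sq_gramResolvent_col_le A hy j
    have h3 : Bᴴ *ᵥ (gramResolvent B y *ᵥ fun i => gramResolvent A y i j) =
        fun i => (Bᴴ * gramResolvent B y * gramResolvent A y) i j := by
      rw [Matrix.mulVec_mulVec]; rfl
    have h4 := sum_norm_sq_conjTranspose_mulVec_gramResolvent_le B hy
      (fun i => gramResolvent A y i j)
    rw [h3] at h4
    refine h4.trans ((div_le_div_of_nonneg_right h2 hy.le).trans_eq ?_)
    field_simp
  refine (Finset.sum_le_card_nsmul _ _ _ fun j _ => h j).trans_eq ?_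
  rw [nsmul_eq_mul, Finset.card_univ]; ring

/-- A Hoffman-Wielandt type bound. The factor `Bᴴ` next to the resolvent of `B`, and `A` next to
that of `A`, make the bound independent of the size of `A` and `B`. -/
theorem abs_re_trace_gramResolvent_sub_le_frobenius (A B : Matrix n n ℂ) {y : ℝ} (hy : 0 < y) :
    |(gramResolvent A y).trace.re - (gramResolvent B y).trace.re| ≤
      2 * (√(∑ i, ∑ j, ‖(B - A) i j‖ ^ 2) * √(Fintype.card n / y ^ 3)) := by
  have h1 : (gramResolvent A y).trace - (gramResolvent B y).trace =
      ((B - A) * (Bᴴ * gramResolvent B y * gramResolvent A y)).trace +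
        star ((B - A) * (Aᴴ * gramResolvent A y * gramResolvent B y)).trace := by
    rw [← Matrix.trace_sub, gramResolvent_sub A B hy, gram_sub_gram, ← Matrix.trace_conjTranspose,
      Matrix.mul_add, Matrix.add_mul, Matrix.trace_add]
    congr 1
    · rw [Matrix.mul_assoc, Matrix.trace_mul_comm]
      simp only [Matrix.mul_assoc]
    · simp only [Matrix.conjTranspose_mul, conjTranspose_gramResolvent,
        Matrix.conjTranspose_conjTranspose]
      rw [Matrix.trace_mul_comm]
      simp only [Matrix.mul_assoc]
  have h2 := fun C => (norm_trace_mul_le (B - A) C)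
  have h3 := sum_norm_sq_conjTranspose_mul_gramResolvent_mul_le A B hy
  have h4 := sum_norm_sq_conjTranspose_mul_gramResolvent_mul_le B A hy
  rw [← Complex.sub_re, h1, two_mul]
  refine (Complex.abs_re_le_norm _).trans ((norm_add_le _ _).trans (add_le_add ?_ ?_))
  · exact (h2 _).trans (by gcongr)
  · rw [norm_star]
    exact (h2 _).trans (by gcongr)

end Perturbation

/-! ### Functions of independent coordinates -/

section Resampling

variable {ι : Type*} [Fintype ι] [DecidableEq ι] {E : ι → Type*} [∀ i, MeasurableSpace (E i)]
  (ρ : ∀ i, Measure (E i)) [∀ i, IsProbabilityMeasure (ρ i)]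

/-- Replacing one coordinate of a product measure by an independent copy preserves the measure. -/
theorem measurePreserving_update (i : ι) :
    MeasurePreserving (fun p : (∀ j, E j) × E i => Function.update p.1 i p.2)
      ((Measure.pi ρ).prod (ρ i)) (Measure.pi ρ) := by
  have hm : Measurable fun p : (∀ j, E j) × E i => Function.update p.1 i p.2 := by
    refine measurable_pi_lambda _ fun j => ?_
    by_cases h : j = i
    · subst h; simpa using measurable_snd
    · simp only [Function.update_of_ne h]; fun_prop
  refine ⟨hm, (Measure.pi_eq fun s hs => ?_).symm⟩
  rw [Measure.map_apply hm (MeasurableSet.univ_pi hs)]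
  have : (fun p : (∀ j, E j) × E i => Function.update p.1 i p.2) ⁻¹' Set.univ.pi s =
      (Set.univ.pi (Function.update s i Set.univ)) ×ˢ s i := by
    ext p
    simp only [Set.mem_preimage, Set.mem_pi, Set.mem_univ, true_imp_iff, Set.mem_prod]
    constructor
    · intro h
      refine ⟨fun j => ?_, by simpa using h i⟩
      by_cases hj : j = i
      · subst hj; simp
      · simpa [hj] using h j
    · rintro ⟨h1, h2⟩ j
      by_cases hj : j = i
      · subst hj; simpa using h2
      · simpa [hj] using h1 j
  rw [this, Measure.prod_prod, Measure.pi_pi, ← Finset.prod_erase_mul _ _ (Finset.mem_univ i),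
    ← Finset.prod_erase_mul (a := i) _ (fun j => ρ j (s j)) (Finset.mem_univ i)]
  simp only [Function.update_self, measure_univ, mul_one]
  congr 1
  refine Finset.prod_congr rfl fun j hj => ?_
  rw [Function.update_of_ne (Finset.ne_of_mem_erase hj)]

theorem integral_pi_eq_integral_update {F : Type*} [NormedAddCommGroup F] [NormedSpace ℝ F]
    {f : (∀ j, E j) → F} (hf : Integrable f (Measure.pi ρ))
    (i : ι) :
    ∫ ω, f ω ∂Measure.pi ρ = ∫ ω, ∫ r, f (Function.update ω i r) ∂ρ i ∂Measure.pi ρ := by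
  have h := measurePreserving_update ρ i
  conv_lhs => rw [← h.map_eq]
  rw [integral_map h.measurable.aemeasurable (by rw [h.map_eq]; exact hf.1)]
  exact integral_prod (fun p : (∀ j, E j) × E i => f (Function.update p.1 i p.2))
    (h.integrable_comp_of_integrable hf)

end Resampling

section BoundedDifferences

variable {E : Type*} [MeasurableSpace E]

theorem integrable_of_abs_le {Ω : Type*} [MeasurableSpace Ω] {P : Measure Ω} [IsFiniteMeasure P]
    {f : Ω → ℝ} (hf : Measurable f) {C : ℝ} (hC : ∀ ω, |f ω| ≤ C) : Integrable f P :=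
  Integrable.of_bound hf.aestronglyMeasurable C (ae_of_all _ hC)

/-- The exponential moment bound behind the bounded differences inequality, by induction on the
number of coordinates: Hoeffding's lemma is applied to the first coordinate, the others being
fixed. -/
theorem integral_exp_le_of_bounded_differences (n : ℕ) (ρ : Fin n → Measure E)
    [∀ i, IsProbabilityMeasure (ρ i)] (f : (Fin n → E) → ℝ) (hf : Measurable f) {C c : ℝ}
    (hc : 0 ≤ c) (hC : ∀ ω, |f ω| ≤ C)
    (hd : ∀ ω i x, |f (Function.update ω i x) - f ω| ≤ c) (t : ℝ) :
    ∫ ω, Real.exp (t * (f ω - ∫ ω', f ω' ∂Measure.pi ρ)) ∂Measure.pi ρ ≤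
      Real.exp (n * c ^ 2 * t ^ 2 / 2) := by
  induction n with
  | zero =>
    have h : ∀ ω, f ω = f default := fun ω => by rw [Subsingleton.elim ω default]
    simp [h]
  | succ n ih =>
    set ρ' : Fin n → Measure E := fun j => ρ j.succ
    have hmp := (measurePreserving_piFinSuccAbove ρ 0).symm
    have hcons : ∀ p : E × (Fin n → E),
        (MeasurableEquiv.piFinSuccAbove (fun _ : Fin (n + 1) => E) 0).symm p =
          Fin.cons p.1 p.2 := fun p => by
      simp [MeasurableEquiv.piFinSuccAbove_symm_apply, Fin.insertNthEquiv]
    have hint : ∀ F : (Fin (n + 1) → E) → ℝ, ∫ ω, F ω ∂Measure.pi ρ =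
        ∫ p : E × (Fin n → E), F (Fin.cons p.1 p.2) ∂(ρ 0).prod (Measure.pi ρ') := fun F => by
      rw [← hmp.integral_comp']
      simp only [hcons]
      rfl
    have hmcons : Measurable fun p : E × (Fin n → E) => (Fin.cons p.1 p.2 : Fin (n + 1) → E) := by
      have := (MeasurableEquiv.piFinSuccAbove (fun _ : Fin (n + 1) => E) 0).symm.measurable
      simpa only [funext hcons] using this
    have hfm : Measurable fun p : E × (Fin n → E) => f (Fin.cons p.1 p.2) := hf.comp hmcons
    set g : (Fin n → E) → ℝ := fun r => ∫ x, f (Fin.cons x r) ∂ρ 0 with hg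
    have hgm : Measurable g := (hfm.stronglyMeasurable.integral_prod_left (μ := ρ 0)).measurable
    have hfx : ∀ r, Measurable fun x => f (Fin.cons x r) := fun r =>
      hfm.comp (measurable_id.prodMk measurable_const)
    have hfi : ∀ r, Integrable (fun x => f (Fin.cons x r)) (ρ 0) := fun r =>
      integrable_of_abs_le (hfx r) fun x => hC _
    have hgC : ∀ r, |g r| ≤ C := fun r => by
      simpa using norm_integral_le_of_norm_le_const (μ := ρ 0)
        (f := fun x => f (Fin.cons x r)) (ae_of_all _ fun x => hC _)
    have hgd : ∀ r i x, |g (Function.update r i x) - g r| ≤ c := fun r i x => by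
      rw [hg]
      simp only
      rw [← integral_sub (hfi _) (hfi _)]
      simpa using norm_integral_le_of_norm_le_const (μ := ρ 0)
        (f := fun z => f (Fin.cons z (Function.update r i x)) - f (Fin.cons z r))
        (ae_of_all _ fun z => by
          rw [Fin.cons_update]
          exact hd _ _ _)
    have hEg : ∫ ω, f ω ∂Measure.pi ρ = ∫ r, g r ∂Measure.pi ρ' := by
      rw [hint, integral_prod_symm _ (integrable_of_abs_le hfm fun p => hC _)]
    have hin : ∀ r, ∫ x, Real.exp (t * (f (Fin.cons x r) - g r)) ∂ρ 0 ≤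
        Real.exp (c ^ 2 * t ^ 2 / 2) := fun r => by
      obtain ⟨x₀⟩ : Nonempty E := nonempty_of_isProbabilityMeasure (ρ 0)
      have hmem : ∀ x, f (Fin.cons x r) ∈
          Set.Icc (f (Fin.cons x₀ r) - c) (f (Fin.cons x₀ r) + c) := fun x => by
        have := hd (Fin.cons x₀ r) 0 x
        rw [Fin.update_cons_zero, abs_le] at this
        constructor <;> linarith
      have h := (hasSubgaussianMGF_of_mem_Icc (hfx r).aemeasurable (ae_of_all (ρ 0) hmem)).mgf_le t
      rw [mgf] at h
      refine h.trans_eq ?_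
      congr 3
      have : f (Fin.cons x₀ r) + c - (f (Fin.cons x₀ r) - c) = 2 * c := by ring
      rw [this]
      simp [abs_of_nonneg hc]
    set m := ∫ r, g r ∂Measure.pi ρ' with hm
    have hexpb : ∀ {u K : ℝ}, |u| ≤ K → |Real.exp (t * u)| ≤ Real.exp (|t| * K) := fun h => by
      rw [Real.abs_exp]
      refine Real.exp_le_exp.2 ((le_abs_self _).trans ?_)
      rw [abs_mul]
      gcongr
    rw [hint, hEg, integral_prod_symm]
    · have hsplit : ∀ r, ∫ x, Real.exp (t * (f (Fin.cons x r) - m)) ∂ρ 0 =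
          Real.exp (t * (g r - m)) * ∫ x, Real.exp (t * (f (Fin.cons x r) - g r)) ∂ρ 0 :=
        fun r => by
          rw [← integral_const_mul]
          refine integral_congr_ae (ae_of_all _ fun x => ?_)
          simp only
          rw [← Real.exp_add]; ring_nf
      have hgi : Integrable (fun r => Real.exp (t * (g r - m))) (Measure.pi ρ') :=
        integrable_of_abs_le (by fun_prop) fun r => hexpb (K := C + |m|)
          ((abs_sub _ _).trans (add_le_add_left (hgC r) _))
      calc ∫ r, ∫ x, Real.exp (t * (f (Fin.cons x r) - m)) ∂ρ 0 ∂Measure.pi ρ'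
          ≤ ∫ r, Real.exp (t * (g r - m)) * Real.exp (c ^ 2 * t ^ 2 / 2) ∂Measure.pi ρ' := by
            refine integral_mono_of_nonneg (ae_of_all _ fun r => ?_) (hgi.mul_const _)
              (ae_of_all _ fun r => ?_)
            · exact integral_nonneg fun x => (Real.exp_pos _).le
            · simp only
              rw [hsplit]
              exact mul_le_mul_of_nonneg_left (hin r) (Real.exp_pos _).le
        _ ≤ Real.exp (n * c ^ 2 * t ^ 2 / 2) * Real.exp (c ^ 2 * t ^ 2 / 2) := by
            rw [integral_mul_const]
            exact mul_le_mul_of_nonneg_right (ih ρ' g hgm hgC hgd) (Real.exp_pos _).le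
        _ = _ := by
            rw [← Real.exp_add]; push_cast; ring_nf
    · exact integrable_of_abs_le (by fun_prop) fun p => hexpb (K := C + |m|)
          ((abs_sub _ _).trans (add_le_add_left (hC _) _))

/-- The bounded differences inequality: a function of `n` independent coordinates which changes by at
most `c` when one coordinate changes is sub-Gaussian around its mean. The variance proxy `n c²` is
four times the optimal one. -/
theorem hasSubgaussianMGF_of_bounded_differences {n : ℕ} (ρ : Fin n → Measure E)
    [∀ i, IsProbabilityMeasure (ρ i)] {f : (Fin n → E) → ℝ} (hf : Measurable f) {C : ℝ}
    {c : NNReal} (hC : ∀ ω, |f ω| ≤ C) (hd : ∀ ω i x, |f (Function.update ω i x) - f ω| ≤ c) :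
    HasSubgaussianMGF (fun ω => f ω - ∫ ω', f ω' ∂Measure.pi ρ) (n * c ^ 2) (Measure.pi ρ) where
  integrable_exp_mul t := by
    refine integrable_of_abs_le (C := Real.exp (|t| * (C + |∫ ω', f ω' ∂Measure.pi ρ|)))
      (by fun_prop) fun ω => ?_
    rw [Real.abs_exp]
    refine Real.exp_le_exp.2 ((le_abs_self _).trans ?_)
    rw [abs_mul]
    gcongr
    exact (abs_sub _ _).trans (add_le_add_left (hC ω) _)
  mgf_le t := by
    rw [mgf]
    exact_mod_cast integral_exp_le_of_bounded_differences n ρ f hf c.2 hC hd t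

theorem measureReal_abs_sub_integral_ge_le {n : ℕ} (ρ : Fin n → Measure E)
    [∀ i, IsProbabilityMeasure (ρ i)] {f : (Fin n → E) → ℝ} (hf : Measurable f) {C : ℝ}
    {c : NNReal} (hC : ∀ ω, |f ω| ≤ C) (hd : ∀ ω i x, |f (Function.update ω i x) - f ω| ≤ c)
    {ε : ℝ} (hε : 0 ≤ ε) :
    (Measure.pi ρ).real {ω | ε ≤ |f ω - ∫ ω', f ω' ∂Measure.pi ρ|} ≤
      2 * Real.exp (-ε ^ 2 / (2 * (n * c ^ 2))) := by
  have h := hasSubgaussianMGF_of_bounded_differences ρ hf hC hd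
  have h1 := h.measure_ge_le hε
  have h2 := h.neg.measure_ge_le hε
  have hsub : {ω | ε ≤ |f ω - ∫ ω', f ω' ∂Measure.pi ρ|} ⊆
      {ω | ε ≤ f ω - ∫ ω', f ω' ∂Measure.pi ρ} ∪
        {ω | ε ≤ (-fun ω => f ω - ∫ ω', f ω' ∂Measure.pi ρ) ω} := fun ω hω => by
    rcases le_abs.1 (Set.mem_ofPred_eq ▸ hω) with h | h
    · exact Or.inl h
    · exact Or.inr h
  refine (measureReal_mono hsub).trans ((measureReal_union_le _ _).trans ?_)
  push_cast at h1 h2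
  rw [two_mul]
  exact add_le_add h1 h2

/-- The mean absolute deviation in the bounded differences inequality. -/
theorem integral_abs_sub_integral_le {n : ℕ} (hn : 0 < n) (ρ : Fin n → Measure E)
    [∀ i, IsProbabilityMeasure (ρ i)] {f : (Fin n → E) → ℝ} (hf : Measurable f) {C c : ℝ}
    (hc : 0 < c) (hC : ∀ ω, |f ω| ≤ C)
    (hd : ∀ ω i x, |f (Function.update ω i x) - f ω| ≤ c) :
    ∫ ω, |f ω - ∫ ω', f ω' ∂Measure.pi ρ| ∂Measure.pi ρ ≤ 4 * c * √n := by
  have h := integral_exp_le_of_bounded_differences n ρ f hf hc.le hC hd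
  set m := ∫ ω', f ω' ∂Measure.pi ρ
  have hn' : 0 < √(n : ℝ) := Real.sqrt_pos.2 (by exact_mod_cast hn)
  -- the exponential moments of order `± t` with `t = 1 / (c √n)` are at most `exp (1 / 2)`
  set t : ℝ := 1 / (c * √n) with ht
  have ht0 : 0 < t := by positivity
  have hexp : n * c ^ 2 * t ^ 2 / 2 = 1 / 2 := by
    rw [ht, div_pow, mul_pow, Real.sq_sqrt (Nat.cast_nonneg n)]
    have : (n : ℝ) ≠ 0 := by positivity
    field_simp
  have h1 := h t
  have h2 := h (-t)
  rw [neg_sq, hexp] at h2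
  rw [hexp] at h1
  have hint : ∀ s : ℝ, Integrable (fun ω => Real.exp (s * (f ω - m))) (Measure.pi ρ) := fun s =>
    (hasSubgaussianMGF_of_bounded_differences ρ hf (c := ⟨c, hc.le⟩) hC hd).integrable_exp_mul s
  have hpt : ∀ ω, |f ω - m| ≤
      (Real.exp (t * (f ω - m)) + Real.exp (-t * (f ω - m))) / t := fun ω => by
    rw [le_div_iff₀ ht0]
    have e1 := Real.add_one_le_exp (t * (f ω - m))
    have e2 := Real.add_one_le_exp (-t * (f ω - m))
    have e3 := Real.exp_pos (t * (f ω - m))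
    have e4 := Real.exp_pos (-t * (f ω - m))
    rcases abs_cases (f ω - m) with ⟨h, _⟩ | ⟨h, _⟩ <;> rw [h] <;> nlinarith
  have hhalf : Real.exp (1 / 2) ≤ 2 := by
    have h1 : Real.exp (1 / 2) * Real.exp (1 / 2) = Real.exp 1 := by
      rw [← Real.exp_add]; norm_num
    have h2 := Real.exp_one_lt_d9
    nlinarith [Real.exp_pos (1 / 2)]
  calc ∫ ω, |f ω - m| ∂Measure.pi ρ
      ≤ ∫ ω, (Real.exp (t * (f ω - m)) + Real.exp (-t * (f ω - m))) / t ∂Measure.pi ρ :=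
        integral_mono_of_nonneg (ae_of_all _ fun _ => abs_nonneg _)
          (((hint t).add (hint (-t))).div_const t) (ae_of_all _ hpt)
    _ = (∫ ω, Real.exp (t * (f ω - m)) ∂Measure.pi ρ +
          ∫ ω, Real.exp (-t * (f ω - m)) ∂Measure.pi ρ) / t := by
        rw [integral_div, integral_add (hint t) (hint (-t))]
    _ ≤ (2 + 2) / t := by gcongr <;> linarith
    _ = 4 * c * √n := by rw [ht]; field_simp; ring

end BoundedDifferences

/-! ### Quadratic forms in a row of independent entries -/

section QuadraticForm

/-- A law on `ℂ` with mean `0` and variance `1`. -/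
structure IsCenteredUnitLaw (ν : Measure ℂ) : Prop where
  isProbabilityMeasure : IsProbabilityMeasure ν
  integrable_id : Integrable (fun z => z) ν
  integral_id : ∫ z, z ∂ν = 0
  integrable_sq : Integrable (fun z => ‖z‖ ^ 2) ν
  integral_sq : ∫ z, ‖z‖ ^ 2 ∂ν = 1

variable {ν : Measure ℂ}

section OffDiagonal

variable {ι : Type*} [Fintype ι]

theorem integrable_norm_mul_conj_sq (hν : IsCenteredUnitLaw ν) {j k : ι} (hjk : j ≠ k) :
    Integrable (fun r : ι → ℂ => ‖r j * star (r k)‖ ^ 2) (Measure.pi fun _ => ν) ∧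
      ∫ r : ι → ℂ, ‖r j * star (r k)‖ ^ 2 ∂(Measure.pi fun _ => ν) = 1 := by
  have := hν.isProbabilityMeasure
  have hind : iIndepFun (fun (i : ι) (r : ι → ℂ) => ‖r i‖ ^ 2) (Measure.pi fun _ : ι => ν) :=
    iIndepFun_pi (X := fun _ z => ‖z‖ ^ 2) (fun _ => by fun_prop)
  have hpair := hind.indepFun hjk
  have hI : ∀ i, Integrable (fun r : ι → ℂ => ‖r i‖ ^ 2) (Measure.pi fun _ => ν) := fun i =>
    (measurePreserving_eval (fun _ : ι => ν) i).integrable_comp_of_integrable hν.integrable_sq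
  have hE : ∀ i, ∫ r : ι → ℂ, ‖r i‖ ^ 2 ∂(Measure.pi fun _ => ν) = 1 := fun i => by
    have h := integral_map (μ := Measure.pi fun _ : ι => ν) (measurable_pi_apply i).aemeasurable
      (f := fun z : ℂ => ‖z‖ ^ 2) (by fun_prop)
    rw [(measurePreserving_eval (fun _ : ι => ν) i).map_eq] at h
    exact h.symm.trans hν.integral_sq
  have heq : (fun r : ι → ℂ => ‖r j * star (r k)‖ ^ 2) =
      (fun r : ι → ℂ => ‖r j‖ ^ 2) * fun r => ‖r k‖ ^ 2 := by
    ext r; simp [mul_pow]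
  rw [heq]
  refine ⟨hpair.integrable_mul (hI j) (hI k), ?_⟩
  rw [hpair.integral_mul_eq_mul_integral (hI j).1 (hI k).1, hE, hE, one_mul]

theorem integrable_conj_mul_mul (hν : IsCenteredUnitLaw ν) {p q : ι × ι} (hp : p.1 ≠ p.2)
    (hq : q.1 ≠ q.2) :
    Integrable (fun r : ι → ℂ => star (r p.1 * star (r p.2)) * (r q.1 * star (r q.2)))
      (Measure.pi fun _ => ν) := by
  have h1 := (integrable_norm_mul_conj_sq hν hp).1
  have h2 := (integrable_norm_mul_conj_sq hν hq).1
  refine (h1.add h2).mono' (by fun_prop) (ae_of_all _ fun r => ?_)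
  rw [norm_mul, norm_star]
  simp only [Pi.add_apply]
  nlinarith [sq_nonneg (‖r p.1 * star (r p.2)‖ - ‖r q.1 * star (r q.2)‖),
    sq_nonneg (‖r p.1 * star (r p.2)‖), sq_nonneg (‖r q.1 * star (r q.2)‖)]

theorem norm_integral_conj_mul_mul_le (hν : IsCenteredUnitLaw ν) {p q : ι × ι} (hp : p.1 ≠ p.2)
    (hq : q.1 ≠ q.2) :
    ‖∫ r : ι → ℂ, star (r p.1 * star (r p.2)) * (r q.1 * star (r q.2))
      ∂(Measure.pi fun _ => ν)‖ ≤ 1 := by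
  obtain ⟨h1, e1⟩ := integrable_norm_mul_conj_sq hν hp
  obtain ⟨h2, e2⟩ := integrable_norm_mul_conj_sq hν hq
  calc _ ≤ ∫ r : ι → ℂ, ((‖r p.1 * star (r p.2)‖ ^ 2 + ‖r q.1 * star (r q.2)‖ ^ 2) / 2)
      ∂(Measure.pi fun _ => ν) := by
        refine norm_integral_le_of_norm_le ((h1.add h2).div_const 2) (ae_of_all _ fun r => ?_)
        rw [norm_mul, norm_star]
        nlinarith [sq_nonneg (‖r p.1 * star (r p.2)‖ - ‖r q.1 * star (r q.2)‖)]
    _ = 1 := by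
        rw [integral_div, integral_add h1 h2, e1, e2]; norm_num

variable [DecidableEq ι]

/-- Off-diagonal monomials with different index sets are orthogonal: some index occurs exactly once,
and the corresponding entry has mean zero. -/
theorem integral_conj_mul_mul_eq_zero (hν : IsCenteredUnitLaw ν) {p q : ι × ι} (hp : p.1 ≠ p.2)
    (hq : q.1 ≠ q.2) (hpq : q ≠ p) (hpq' : q ≠ p.swap) :
    ∫ r : ι → ℂ, star (r p.1 * star (r p.2)) * (r q.1 * star (r q.2))
      ∂(Measure.pi fun _ => ν) = 0 := by
  have := hν.isProbabilityMeasure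
  have hint := integrable_conj_mul_mul hν hp hq
  have hc : ∫ z, star z ∂ν = 0 := by
    have := integral_conj (μ := ν) (f := fun z : ℂ => z)
    rw [hν.integral_id, map_zero] at this
    exact this
  obtain ⟨p1, p2⟩ := p
  obtain ⟨q1, q2⟩ := q
  simp only [Prod.swap_prod_mk, ne_eq, Prod.mk.injEq, not_and] at hp hq hpq hpq' hint ⊢
  have hcase : (p1 ≠ q1 ∧ p1 ≠ q2) ∨ (p2 ≠ q1 ∧ p2 ≠ q2) := by grind
  rcases hcase with ⟨h1, h2⟩ | ⟨h1, h2⟩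
  · rw [integral_pi_eq_integral_update _ hint p1]
    refine integral_eq_zero_of_ae (ae_of_all _ fun ω => ?_)
    simp only [Function.update_self, Function.update_of_ne (Ne.symm hp), Function.update_of_ne h1.symm,
      Function.update_of_ne h2.symm, star_mul, star_star, Pi.zero_apply]
    simp only [mul_assoc]
    rw [integral_const_mul, integral_mul_const, hc, zero_mul, mul_zero]
  · rw [integral_pi_eq_integral_update _ hint p2]
    refine integral_eq_zero_of_ae (ae_of_all _ fun ω => ?_)
    simp only [Function.update_self, Function.update_of_ne hp, Function.update_of_ne h1.symm,
      Function.update_of_ne h2.symm, star_mul, star_star, Pi.zero_apply]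
    simp only [mul_assoc]
    rw [integral_mul_const, hν.integral_id, zero_mul]

/-- The off-diagonal part of a quadratic form has second moment at most twice the squared Frobenius
norm of its matrix. -/
theorem integral_norm_sq_offDiag_le (hν : IsCenteredUnitLaw ν) (M : ι → ι → ℂ) (S : Finset ι) :
    Integrable (fun r : ι → ℂ => ‖∑ p ∈ S.offDiag, M p.1 p.2 * (r p.1 * star (r p.2))‖ ^ 2)
        (Measure.pi fun _ => ν) ∧
    ∫ r : ι → ℂ, ‖∑ p ∈ S.offDiag, M p.1 p.2 * (r p.1 * star (r p.2))‖ ^ 2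
      ∂(Measure.pi fun _ => ν) ≤ 2 * ∑ k, ∑ j, ‖M j k‖ ^ 2 := by
  have hexp : ∀ r : ι → ℂ,
      ((‖∑ p ∈ S.offDiag, M p.1 p.2 * (r p.1 * star (r p.2))‖ ^ 2 : ℝ) : ℂ) =
      ∑ p ∈ S.offDiag, ∑ q ∈ S.offDiag, (star (M p.1 p.2) * M q.1 q.2) *
        (star (r p.1 * star (r p.2)) * (r q.1 * star (r q.2))) := fun r => by
    push_cast
    rw [← Complex.conj_mul', map_sum, Finset.sum_mul_sum]
    refine Finset.sum_congr rfl fun p _ => Finset.sum_congr rfl fun q _ => ?_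
    simp only [map_mul, Complex.star_def]
    ring
  have hne : ∀ p ∈ S.offDiag, p.1 ≠ p.2 := fun p hp => (Finset.mem_offDiag.1 hp).2.2
  have hI : ∀ p ∈ S.offDiag, ∀ q ∈ S.offDiag,
      Integrable (fun r : ι → ℂ => (star (M p.1 p.2) * M q.1 q.2) *
        (star (r p.1 * star (r p.2)) * (r q.1 * star (r q.2)))) (Measure.pi fun _ => ν) :=
    fun p hp q hq => (integrable_conj_mul_mul hν (hne p hp) (hne q hq)).const_mul _
  have hIsum : Integrable (fun r : ι → ℂ =>
      ((‖∑ p ∈ S.offDiag, M p.1 p.2 * (r p.1 * star (r p.2))‖ ^ 2 : ℝ) : ℂ))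
      (Measure.pi fun _ => ν) := by
    simp_rw [hexp]
    exact integrable_finsetSum _ fun p hp => integrable_finsetSum _ fun q hq => hI p hp q hq
  refine ⟨hIsum.re, ?_⟩
  have hval : ((∫ r : ι → ℂ, ‖∑ p ∈ S.offDiag, M p.1 p.2 * (r p.1 * star (r p.2))‖ ^ 2
      ∂(Measure.pi fun _ => ν) : ℝ) : ℂ) =
      ∑ p ∈ S.offDiag, ∑ q ∈ S.offDiag, (star (M p.1 p.2) * M q.1 q.2) *
        ∫ r : ι → ℂ, (star (r p.1 * star (r p.2)) * (r q.1 * star (r q.2)))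
          ∂(Measure.pi fun _ => ν) := by
    rw [← integral_complex_ofReal]
    simp_rw [hexp]
    rw [integral_finsetSum _ fun p hp => integrable_finsetSum _ fun q hq => hI p hp q hq]
    refine Finset.sum_congr rfl fun p hp => ?_
    rw [integral_finsetSum _ fun q hq => hI p hp q hq]
    exact Finset.sum_congr rfl fun q _ => integral_const_mul _ _
  have hterm : ∀ p ∈ S.offDiag, ‖∑ q ∈ S.offDiag, (star (M p.1 p.2) * M q.1 q.2) *
        ∫ r : ι → ℂ, (star (r p.1 * star (r p.2)) * (r q.1 * star (r q.2)))
          ∂(Measure.pi fun _ => ν)‖ ≤ ‖M p.1 p.2‖ ^ 2 + ‖M p.1 p.2‖ * ‖M p.2 p.1‖ := by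
    intro p hp
    have hsub : ({p, p.swap} : Finset (ι × ι)) ⊆ S.offDiag := by
      intro q hq
      rw [Finset.mem_insert, Finset.mem_singleton] at hq
      rw [Finset.mem_offDiag] at hp ⊢
      rcases hq with rfl | rfl
      · exact hp
      · exact ⟨hp.2.1, hp.1, hp.2.2.symm⟩
    rw [← Finset.sum_subset hsub fun q hq hq' => by
      rw [Finset.mem_insert, Finset.mem_singleton, not_or] at hq'
      rw [integral_conj_mul_mul_eq_zero hν (hne p hp) (hne q hq) hq'.1 hq'.2, mul_zero]]
    have hps : p ≠ p.swap := fun h => hne p hp (congrArg Prod.fst h)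
    rw [Finset.sum_pair hps]
    refine (norm_add_le _ _).trans (add_le_add ?_ ?_)
    · rw [norm_mul, norm_mul, norm_star, ← sq]
      exact mul_le_of_le_one_right (by positivity)
        (norm_integral_conj_mul_mul_le hν (hne p hp) (hne p hp))
    · rw [norm_mul, norm_mul, norm_star]
      exact mul_le_of_le_one_right (by positivity)
        (norm_integral_conj_mul_mul_le hν (hne p hp) (hne p hp).symm)
  have hnn : 0 ≤ ∫ r : ι → ℂ, ‖∑ p ∈ S.offDiag, M p.1 p.2 * (r p.1 * star (r p.2))‖ ^ 2
      ∂(Measure.pi fun _ => ν) := integral_nonneg fun _ => by positivity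
  rw [← Real.norm_of_nonneg hnn, ← Complex.norm_real, hval]
  refine (norm_sum_le _ _).trans ((Finset.sum_le_sum hterm).trans ?_)
  have hF : ∑ k, ∑ j, ‖M j k‖ ^ 2 = ∑ p : ι × ι, ‖M p.2 p.1‖ ^ 2 :=
    (Fintype.sum_prod_type (fun p : ι × ι => ‖M p.2 p.1‖ ^ 2)).symm
  have hF' : ∑ p : ι × ι, ‖M p.1 p.2‖ ^ 2 = ∑ p : ι × ι, ‖M p.2 p.1‖ ^ 2 :=
    Fintype.sum_equiv (Equiv.prodComm ι ι) _ _ fun p => rfl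
  calc ∑ p ∈ S.offDiag, (‖M p.1 p.2‖ ^ 2 + ‖M p.1 p.2‖ * ‖M p.2 p.1‖)
      ≤ ∑ p : ι × ι, (‖M p.1 p.2‖ ^ 2 + ‖M p.1 p.2‖ * ‖M p.2 p.1‖) :=
        Finset.sum_le_sum_of_subset_of_nonneg (Finset.subset_univ _) fun _ _ _ => by positivity
    _ ≤ ∑ p : ι × ι, (3 / 2 * ‖M p.1 p.2‖ ^ 2 + 1 / 2 * ‖M p.2 p.1‖ ^ 2) := by
        refine Finset.sum_le_sum fun p _ => ?_
        nlinarith [sq_nonneg (‖M p.1 p.2‖ - ‖M p.2 p.1‖)]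
    _ = 2 * ∑ k, ∑ j, ‖M j k‖ ^ 2 := by
        rw [Finset.sum_add_distrib, ← Finset.mul_sum, ← Finset.mul_sum, hF, hF']; ring

theorem integral_norm_offDiag_le (hν : IsCenteredUnitLaw ν) (M : ι → ι → ℂ) (S : Finset ι) :
    Integrable (fun r : ι → ℂ => ‖∑ p ∈ S.offDiag, M p.1 p.2 * (r p.1 * star (r p.2))‖)
        (Measure.pi fun _ => ν) ∧
    ∫ r : ι → ℂ, ‖∑ p ∈ S.offDiag, M p.1 p.2 * (r p.1 * star (r p.2))‖
      ∂(Measure.pi fun _ => ν) ≤ √(2 * ∑ k, ∑ j, ‖M j k‖ ^ 2) := by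
  have := hν.isProbabilityMeasure
  obtain ⟨hI, hle⟩ := integral_norm_sq_offDiag_le hν M S
  set F := fun r : ι → ℂ => ‖∑ p ∈ S.offDiag, M p.1 p.2 * (r p.1 * star (r p.2))‖
  have hFm : Measurable F := by fun_prop
  have hL2 : MemLp F 2 (Measure.pi fun _ : ι => ν) :=
    (memLp_two_iff_integrable_sq hFm.aestronglyMeasurable).2 hI
  refine ⟨hL2.integrable one_le_two, ?_⟩
  refine Real.le_sqrt_of_sq_le (le_trans ?_ hle)
  have h := variance_nonneg F (Measure.pi fun _ : ι => ν)
  rw [variance_eq_sub hL2] at h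
  exact sub_nonneg.1 h

end OffDiagonal

section Diagonal

/-- Truncation of the squared modulus: `‖z‖² - 1` is within `δ` in `L¹` of a bounded centered
function. -/
theorem exists_bounded_centered_approx (hν : IsCenteredUnitLaw ν) {δ : ℝ} (hδ : 0 < δ) :
    ∃ K : ℝ, 0 < K ∧ ∃ φ : ℂ → ℝ, Measurable φ ∧ (∀ z, |φ z| ≤ K) ∧ ∫ z, φ z ∂ν = 0 ∧
      ∫ z, |‖z‖ ^ 2 - 1 - φ z| ∂ν ≤ δ := by
  have := hν.isProbabilityMeasure
  have hlim : Tendsto (fun n : ℕ => ∫ z, min (‖z‖ ^ 2) (n : ℝ) ∂ν) atTop (𝓝 1) := by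
    rw [← hν.integral_sq]
    refine tendsto_integral_of_dominated_convergence (fun z => ‖z‖ ^ 2)
      (fun n => by fun_prop) hν.integrable_sq (fun n => ae_of_all _ fun z => ?_)
      (ae_of_all _ fun z => ?_)
    · rw [Real.norm_of_nonneg (by positivity)]
      exact min_le_left _ _
    · refine tendsto_const_nhds.congr' ?_
      filter_upwards [(tendsto_natCast_atTop_atTop (R := ℝ)).eventually_ge_atTop (‖z‖ ^ 2)] with n hn
      exact (min_eq_left hn).symm
  obtain ⟨n, hn⟩ := (hlim.eventually (lt_mem_nhds (show 1 - δ / 2 < 1 by linarith))).exists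
  set φ₀ : ℂ → ℝ := fun z => min (‖z‖ ^ 2) (n : ℝ)
  have hφm : Measurable φ₀ := by fun_prop
  have hφ0 : ∀ z, 0 ≤ φ₀ z := fun z => by positivity
  have hφn : ∀ z, |φ₀ z| ≤ n := fun z => by
    rw [abs_of_nonneg (hφ0 z)]; exact min_le_right _ _
  have hφi : Integrable φ₀ ν := integrable_of_abs_le hφm hφn
  set m := ∫ z, φ₀ z ∂ν
  have hm1 : m ≤ 1 := by
    rw [← hν.integral_sq]
    exact integral_mono hφi hν.integrable_sq fun z => min_le_left _ _
  refine ⟨n + |m| + 1, by positivity, fun z => φ₀ z - m, by fun_prop, fun z => ?_, ?_, ?_⟩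
  · exact (abs_sub _ _).trans (by linarith [hφn z])
  · rw [integral_sub hφi (integrable_const _)]; simp [m]
  · calc ∫ z, |‖z‖ ^ 2 - 1 - (φ₀ z - m)| ∂ν
        ≤ ∫ z, ((‖z‖ ^ 2 - φ₀ z) + (1 - m)) ∂ν := by
          refine integral_mono_of_nonneg (ae_of_all _ fun _ => abs_nonneg _)
            ((hν.integrable_sq.sub hφi).add (integrable_const _)) (ae_of_all _ fun z => ?_)
          have h1 : φ₀ z ≤ ‖z‖ ^ 2 := min_le_left _ _
          simp only
          rw [abs_le]
          constructor <;> linarith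
      _ = (1 - m) + (1 - m) := by
          have hs : Integrable (fun z => ‖z‖ ^ 2 - φ₀ z) ν := hν.integrable_sq.sub hφi
          rw [integral_add hs (integrable_const _), integral_sub hν.integrable_sq hφi,
            hν.integral_sq]
          simp [m]
      _ ≤ δ := by linarith

/-- A weak law of large numbers with bounded weights. -/
theorem integral_abs_sum_sq_sub_one_le (hν : IsCenteredUnitLaw ν) {K δ : ℝ} (hK : 0 < K)
    {φ : ℂ → ℝ} (hφ : Measurable φ) (hφK : ∀ z, |φ z| ≤ K) (hφ0 : ∫ z, φ z ∂ν = 0)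
    (hφδ : ∫ z, |‖z‖ ^ 2 - 1 - φ z| ∂ν ≤ δ) {n : ℕ} (hn : 0 < n) (a : Fin n → ℝ) {b : ℝ}
    (hb : 0 < b) (ha : ∀ j, |a j| ≤ b) (S : Finset (Fin n)) :
    Integrable (fun r : Fin n → ℂ => |∑ j ∈ S, (‖r j‖ ^ 2 - 1) * a j|) (Measure.pi fun _ => ν) ∧
    ∫ r : Fin n → ℂ, |∑ j ∈ S, (‖r j‖ ^ 2 - 1) * a j| ∂(Measure.pi fun _ => ν) ≤
      (8 * K * √n + n * δ) * b := by
  have := hν.isProbabilityMeasure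
  have hmp := fun j => measurePreserving_eval (fun _ : Fin n => ν) j
  have hev : ∀ (ψ : ℂ → ℝ) (_ : Measurable ψ) (j : Fin n),
      ∫ r : Fin n → ℂ, ψ (r j) ∂(Measure.pi fun _ => ν) = ∫ z, ψ z ∂ν := fun ψ hψ j => by
    have h := integral_map (μ := Measure.pi fun _ : Fin n => ν)
      (measurable_pi_apply j).aemeasurable (f := ψ) hψ.aestronglyMeasurable
    rw [(hmp j).map_eq] at h
    exact h.symm
  have hcomp : ∀ (ψ : ℂ → ℝ) (_ : Integrable ψ ν) (j : Fin n),
      Integrable (fun r : Fin n → ℂ => ψ (r j)) (Measure.pi fun _ => ν) := fun ψ hψ j =>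
    (hmp j).integrable_comp_of_integrable hψ
  set f : (Fin n → ℂ) → ℝ := fun r => ∑ j ∈ S, φ (r j) * a j
  have hfm : Measurable f := by fun_prop
  have hfC : ∀ r, |f r| ≤ n * (K * b) := fun r => by
    refine (Finset.abs_sum_le_sum_abs _ _).trans ?_
    calc ∑ j ∈ S, |φ (r j) * a j| ≤ ∑ j ∈ S, K * b := Finset.sum_le_sum fun j _ => by
          rw [abs_mul]; exact mul_le_mul (hφK _) (ha j) (abs_nonneg _) hK.le
      _ ≤ n * (K * b) := by
          rw [Finset.sum_const, nsmul_eq_mul]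
          have : (S.card : ℝ) ≤ n := by exact_mod_cast (card_finset_fin_le S)
          gcongr
  have hφi : Integrable φ ν := integrable_of_abs_le hφ hφK
  have hfi := integrable_of_abs_le (P := Measure.pi fun _ : Fin n => ν) hfm hfC
  have hf0 : ∫ r, f r ∂(Measure.pi fun _ : Fin n => ν) = 0 := by
    simp only [f]
    rw [integral_finsetSum _ fun j _ => (hcomp φ hφi j).mul_const (a j)]
    refine Finset.sum_eq_zero fun j _ => ?_
    rw [integral_mul_const, hev φ hφ j, hφ0, zero_mul]
  have hfd : ∀ r i z, |f (Function.update r i z) - f r| ≤ 2 * K * b := fun r i z => by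
    simp only [f]
    rw [← Finset.sum_sub_distrib]
    have hz : ∀ j ∈ S, j ≠ i → φ (Function.update r i z j) * a j - φ (r j) * a j = 0 :=
      fun j _ hj => by rw [Function.update_of_ne hj, sub_self]
    by_cases hi : i ∈ S
    · rw [Finset.sum_eq_single_of_mem i hi hz, Function.update_self, ← sub_mul, abs_mul]
      refine mul_le_mul ((abs_sub _ _).trans ?_) (ha i) (abs_nonneg _) (by positivity)
      linarith [hφK z, hφK (r i)]
    · rw [Finset.sum_eq_zero fun j hj => hz j hj fun h => hi (h ▸ hj), abs_zero]
      positivity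
  have h1 := integral_abs_sub_integral_le hn (fun _ : Fin n => ν) hfm
    (show 0 < 2 * K * b by positivity) hfC hfd
  rw [hf0] at h1
  simp only [sub_zero] at h1
  have hψi : Integrable (fun z => |‖z‖ ^ 2 - 1 - φ z|) ν :=
    ((hν.integrable_sq.sub (integrable_const _)).sub hφi).abs
  have hgi : Integrable (fun r : Fin n → ℂ => ∑ j ∈ S, |‖r j‖ ^ 2 - 1 - φ (r j)| * b)
      (Measure.pi fun _ => ν) :=
    integrable_finsetSum _ fun j _ => (hcomp _ hψi j).mul_const b
  have hpt : ∀ r : Fin n → ℂ, |∑ j ∈ S, (‖r j‖ ^ 2 - 1) * a j| ≤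
      |f r| + ∑ j ∈ S, |‖r j‖ ^ 2 - 1 - φ (r j)| * b := fun r => by
    have : ∑ j ∈ S, (‖r j‖ ^ 2 - 1) * a j =
        f r + ∑ j ∈ S, (‖r j‖ ^ 2 - 1 - φ (r j)) * a j := by
      rw [← Finset.sum_add_distrib]
      exact Finset.sum_congr rfl fun j _ => by ring
    rw [this]
    refine (abs_add_le _ _).trans (add_le_add_right ((Finset.abs_sum_le_sum_abs _ _).trans
      (Finset.sum_le_sum fun j _ => ?_)) _)
    rw [abs_mul]
    exact mul_le_mul_of_nonneg_left (ha j) (abs_nonneg _)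
  have hm : Measurable fun r : Fin n → ℂ => ∑ j ∈ S, (‖r j‖ ^ 2 - 1) * a j := by fun_prop
  refine ⟨(hfi.abs.add hgi).mono' hm.abs.aestronglyMeasurable (ae_of_all _ fun r => ?_), ?_⟩
  · rw [Real.norm_eq_abs, abs_abs]
    exact hpt r
  calc ∫ r : Fin n → ℂ, |∑ j ∈ S, (‖r j‖ ^ 2 - 1) * a j| ∂(Measure.pi fun _ => ν)
      ≤ ∫ r : Fin n → ℂ, (|f r| + ∑ j ∈ S, |‖r j‖ ^ 2 - 1 - φ (r j)| * b)
          ∂(Measure.pi fun _ => ν) :=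
        integral_mono_of_nonneg (ae_of_all _ fun _ => abs_nonneg _) (hfi.abs.add hgi)
          (ae_of_all _ hpt)
    _ ≤ 4 * (2 * K * b) * √n + n * (δ * b) := by
        rw [integral_add hfi.abs hgi]
        refine add_le_add h1 ?_
        rw [integral_finsetSum _ fun j _ => (hcomp _ hψi j).mul_const b]
        have hδ0 : 0 ≤ δ := le_trans (integral_nonneg fun _ => abs_nonneg _) hφδ
        calc ∑ j ∈ S, ∫ r : Fin n → ℂ, |‖r j‖ ^ 2 - 1 - φ (r j)| * b ∂(Measure.pi fun _ => ν)
            ≤ ∑ j ∈ S, δ * b := Finset.sum_le_sum fun j _ => by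
              rw [integral_mul_const,
                hev (fun z => |‖z‖ ^ 2 - 1 - φ z|) (by fun_prop) j]
              gcongr
          _ ≤ n * (δ * b) := by
              rw [Finset.sum_const, nsmul_eq_mul]
              have : (S.card : ℝ) ≤ n := by exact_mod_cast (card_finset_fin_le S)
              gcongr
    _ = (8 * K * √n + n * δ) * b := by ring

end Diagonal

theorem masked_quadForm_eq {ι : Type*} [Fintype ι] [DecidableEq ι] (M : Matrix ι ι ℂ)
    (S : Finset ι) (r : ι → ℂ) :
    (fun j => if j ∈ S then r j else 0) ⬝ᵥ (M *ᵥ star fun j => if j ∈ S then r j else 0) =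
      ∑ j ∈ S, (‖r j‖ ^ 2 : ℝ) * M j j +
        ∑ p ∈ S.offDiag, M p.1 p.2 * (r p.1 * star (r p.2)) := by
  have h1 : (fun j => if j ∈ S then r j else 0) ⬝ᵥ (M *ᵥ star fun j => if j ∈ S then r j else 0) =
      ∑ p ∈ S ×ˢ S, M p.1 p.2 * (r p.1 * star (r p.2)) := by
    rw [Finset.sum_product]
    simp only [dotProduct, Matrix.mulVec, Pi.star_apply, apply_ite star, star_zero, ite_mul,
      zero_mul, mul_ite, mul_zero, Finset.sum_ite_mem, Finset.univ_inter]
    simp only [Finset.mul_sum]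
    exact Finset.sum_congr rfl fun j _ => Finset.sum_congr rfl fun k _ => by ring
  rw [h1, ← Finset.diag_union_offDiag, Finset.sum_union (Finset.disjoint_diag_offDiag S),
    Finset.sum_diag]
  congr 1
  refine Finset.sum_congr rfl fun j _ => ?_
  rw [Complex.star_def, Complex.mul_conj']
  push_cast; ring

/-- Concentration of the quadratic form of a row of independent entries restricted to the index set
`S`, under second moments only. -/
theorem integral_abs_masked_quadForm_sub_le (hν : IsCenteredUnitLaw ν) {K δ : ℝ} (hK : 0 < K)
    {φ : ℂ → ℝ} (hφ : Measurable φ) (hφK : ∀ z, |φ z| ≤ K) (hφ0 : ∫ z, φ z ∂ν = 0)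
    (hφδ : ∫ z, |‖z‖ ^ 2 - 1 - φ z| ∂ν ≤ δ) {n : ℕ} (hn : 0 < n)
    (M : Matrix (Fin n) (Fin n) ℂ) {b : ℝ} (hb : 0 < b) (hM : ∀ j, ‖M j j‖ ≤ b)
    (hF : ∀ k, ∑ j, ‖M j k‖ ^ 2 ≤ b ^ 2) (S : Finset (Fin n)) :
    Integrable (fun r : Fin n → ℂ => |((fun j => if j ∈ S then r j else 0) ⬝ᵥ
        (M *ᵥ star fun j => if j ∈ S then r j else 0)).re - ∑ j ∈ S, (M j j).re|)
          (Measure.pi fun _ => ν) ∧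
    ∫ r : Fin n → ℂ, |((fun j => if j ∈ S then r j else 0) ⬝ᵥ
        (M *ᵥ star fun j => if j ∈ S then r j else 0)).re - ∑ j ∈ S, (M j j).re|
          ∂(Measure.pi fun _ => ν) ≤
      (8 * K * √n + n * δ + 2 * √n) * b := by
  obtain ⟨i1, e1⟩ := integral_abs_sum_sq_sub_one_le hν hK hφ hφK hφ0 hφδ hn
    (fun j => (M j j).re) hb (fun j => (Complex.abs_re_le_norm _).trans (hM j)) S
  obtain ⟨i2, e2⟩ := integral_norm_offDiag_le hν M S
  have e3 : √(2 * ∑ k, ∑ j, ‖M j k‖ ^ 2) ≤ 2 * √n * b := by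
    refine Real.sqrt_le_iff.2 ⟨by positivity, ?_⟩
    have : ∑ k, ∑ j, ‖M j k‖ ^ 2 ≤ n * b ^ 2 := by
      refine (Finset.sum_le_card_nsmul _ _ _ fun k _ => hF k).trans_eq ?_
      simp
    rw [mul_pow, mul_pow, Real.sq_sqrt (Nat.cast_nonneg n)]
    nlinarith [mul_nonneg (Nat.cast_nonneg (α := ℝ) n) (sq_nonneg b)]
  have hpt : ∀ r : Fin n → ℂ, |((fun j => if j ∈ S then r j else 0) ⬝ᵥ
        (M *ᵥ star fun j => if j ∈ S then r j else 0)).re - ∑ j ∈ S, (M j j).re| ≤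
      |∑ j ∈ S, (‖r j‖ ^ 2 - 1) * (M j j).re| +
        ‖∑ p ∈ S.offDiag, M p.1 p.2 * (r p.1 * star (r p.2))‖ := fun r => by
    rw [masked_quadForm_eq, Complex.add_re, Complex.re_sum]
    have : ∑ j ∈ S, (((‖r j‖ ^ 2 : ℝ) : ℂ) * M j j).re - ∑ j ∈ S, (M j j).re =
        ∑ j ∈ S, (‖r j‖ ^ 2 - 1) * (M j j).re := by
      rw [← Finset.sum_sub_distrib]
      refine Finset.sum_congr rfl fun j _ => ?_
      rw [Complex.re_ofReal_mul]; ring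
    rw [add_sub_right_comm, this]
    exact (abs_add_le _ _).trans (add_le_add_right (Complex.abs_re_le_norm _) _)
  refine ⟨(i1.add i2).mono' ?_ (ae_of_all _ fun r => ?_), ?_⟩
  · simp_rw [masked_quadForm_eq]
    have hm : Measurable fun r : Fin n → ℂ => (∑ j ∈ S, ((‖r j‖ ^ 2 : ℝ) : ℂ) * M j j +
        ∑ p ∈ S.offDiag, M p.1 p.2 * (r p.1 * star (r p.2))).re - ∑ j ∈ S, (M j j).re := by
      fun_prop
    exact hm.abs.aestronglyMeasurable
  · rw [Real.norm_eq_abs, abs_abs]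
    exact hpt r
  calc _ ≤ ∫ r : Fin n → ℂ, (|∑ j ∈ S, (‖r j‖ ^ 2 - 1) * (M j j).re| +
        ‖∑ p ∈ S.offDiag, M p.1 p.2 * (r p.1 * star (r p.2))‖) ∂(Measure.pi fun _ => ν) :=
        integral_mono_of_nonneg (ae_of_all _ fun _ => abs_nonneg _) (i1.add i2)
          (ae_of_all _ hpt)
    _ ≤ (8 * K * √n + n * δ) * b + 2 * √n * b := by
        rw [integral_add i1 i2]
        exact add_le_add e1 (e2.trans e3)
    _ = _ := by ring

end QuadraticForm

/-! ### Triangular arrays of independent entries -/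

section Array

variable {n : ℕ}

/-- The lower triangular part, diagonal included, of a square array. -/
def lowerPart (ω : Fin n → Fin n → ℂ) : Matrix (Fin n) (Fin n) ℂ :=
  Matrix.of fun i j => if j ≤ i then ω i j else 0

/-- The law of an `n × n` array of independent entries with law `ν`, as a product over rows of
products over columns. -/
noncomputable def iidArray (ν : Measure ℂ) (n : ℕ) : Measure (Fin n → Fin n → ℂ) :=
  Measure.pi fun _ => Measure.pi fun _ => ν

instance iidArray_isProbabilityMeasure (ν : Measure ℂ) [IsProbabilityMeasure ν] :
    IsProbabilityMeasure (iidArray ν n) := by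
  unfold iidArray; infer_instance

/-- Reflection of an array in the antidiagonal. It preserves lower triangularity and exchanges the
roles of rows and columns. -/
def flipArray (ω : Fin n → Fin n → ℂ) : Fin n → Fin n → ℂ := fun i j => ω j.rev i.rev

theorem map_array_eq_iidArray {Ω : Type*} [MeasurableSpace Ω] {P : Measure Ω}
    [IsProbabilityMeasure P] {ν : Measure ℂ} [IsProbabilityMeasure ν]
    {Y : Fin n × Fin n → Ω → ℂ} (hm : ∀ p, Measurable (Y p)) (hi : iIndepFun Y P)
    (hl : ∀ p, P.map (Y p) = ν) :
    P.map (fun ω i j => Y (i, j) ω) = iidArray ν n := by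
  have h1 := (iIndepFun_iff_map_fun_eq_infinitePi_map hm).1 hi
  simp_rw [hl] at h1
  have h2 := Measure.infinitePi_map_curry (ι := Fin n) (κ := Fin n) fun _ _ => ν
  rw [← h1, Measure.map_map (MeasurableEquiv.measurable _) (measurable_pi_lambda _ hm),
    Measure.infinitePi_eq_pi] at h2
  simp_rw [Measure.infinitePi_eq_pi] at h2
  exact h2

theorem measurable_flipArray : Measurable (flipArray (n := n)) := by
  unfold flipArray; fun_prop

theorem measurePreserving_flipArray (ν : Measure ℂ) [IsProbabilityMeasure ν] :
    MeasurePreserving (flipArray (n := n)) (iidArray ν n) (iidArray ν n) := by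
  refine ⟨measurable_flipArray, ?_⟩
  set Q := Measure.pi fun _ : Fin n × Fin n => ν
  have hi : iIndepFun (fun (p : Fin n × Fin n) (ω : Fin n × Fin n → ℂ) => ω p) Q :=
    iIndepFun_pi (X := fun _ z => z) (fun _ => aemeasurable_id)
  have hl : ∀ p : Fin n × Fin n, Q.map (fun ω => ω p) = ν := fun p =>
    (measurePreserving_eval (fun _ : Fin n × Fin n => ν) p).map_eq
  have h1 := map_array_eq_iidArray (fun p => measurable_pi_apply p) hi hl
  have hinj : Function.Injective fun p : Fin n × Fin n => (p.2.rev, p.1.rev) := by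
    rintro ⟨a, b⟩ ⟨c, d⟩ h
    simp only [Prod.mk.injEq, Fin.rev_inj] at h
    rw [h.1, h.2]
  have h2 := map_array_eq_iidArray (fun p => measurable_pi_apply (p.2.rev, p.1.rev))
    (hi.precomp hinj) (fun p => hl (p.2.rev, p.1.rev))
  rw [← h1, Measure.map_map measurable_flipArray (by fun_prop)]
  conv_rhs => rw [h1, ← h2]
  rfl

theorem lowerPart_flipArray (ω : Fin n → Fin n → ℂ) :
    lowerPart (flipArray ω) = (lowerPart ω)ᵀ.submatrix Fin.revPerm Fin.revPerm := by
  ext i j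
  simp [lowerPart, flipArray, Fin.rev_le_rev]

theorem gramResolvent_transpose_submatrix (A : Matrix (Fin n) (Fin n) ℂ)
    (e : Equiv.Perm (Fin n)) (y : ℝ) :
    gramResolvent (Aᵀ.submatrix e e) y = (gramResolvent Aᴴ y)ᵀ.submatrix e e := by
  unfold gramResolvent
  rw [Matrix.conjTranspose_conjTranspose, Matrix.transpose_nonsing_inv, ← Matrix.inv_submatrix_equiv]
  congr 1
  rw [Matrix.transpose_add, Matrix.transpose_mul, Matrix.transpose_smul, Matrix.transpose_one,
    Matrix.conjTranspose_submatrix, Matrix.submatrix_mul_equiv, Matrix.submatrix_add,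
    Matrix.submatrix_smul]
  simp [Matrix.conjTranspose, Matrix.transpose_map]

theorem gramResolvent_lowerPart_flipArray (ω : Fin n → Fin n → ℂ) (y : ℝ) (i : Fin n) :
    gramResolvent (lowerPart (flipArray ω)) y i i =
      gramResolvent (lowerPart ω)ᴴ y i.rev i.rev := by
  rw [lowerPart_flipArray, gramResolvent_transpose_submatrix]
  rfl

theorem lowerPart_update_row (ω : Fin n → Fin n → ℂ) (i : Fin n) (r : Fin n → ℂ) :
    lowerPart (Function.update ω i r) i = fun j => if j ∈ Finset.Iic i then r j else 0 := by
  ext j; simp [lowerPart]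

theorem lowerPart_update_updateRow (ω : Fin n → Fin n → ℂ) (i : Fin n) (r : Fin n → ℂ) :
    (lowerPart (Function.update ω i r)).updateRow i 0 = (lowerPart ω).updateRow i 0 := by
  ext k j
  by_cases h : k = i
  · subst h; simp
  · simp [Matrix.updateRow_ne h, lowerPart, Function.update_of_ne h]

theorem continuous_lowerPart : Continuous (lowerPart (n := n)) := by
  refine continuous_matrix fun i j => ?_
  by_cases h : j ≤ i
  · simp only [lowerPart, Matrix.of_apply, h, if_true]; fun_prop
  · simp only [lowerPart, Matrix.of_apply, h, if_false]; fun_prop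

theorem continuous_gramResolvent {y : ℝ} (hy : 0 < y) :
    Continuous fun A : Matrix (Fin n) (Fin n) ℂ => gramResolvent A y := by
  have hc : Continuous fun A : Matrix (Fin n) (Fin n) ℂ =>
      A * Aᴴ + (y : ℂ) • (1 : Matrix (Fin n) (Fin n) ℂ) := by fun_prop
  have h : (fun A : Matrix (Fin n) (Fin n) ℂ => gramResolvent A y) = fun A =>
      (A * Aᴴ + (y : ℂ) • (1 : Matrix (Fin n) (Fin n) ℂ)).det⁻¹ •
        (A * Aᴴ + (y : ℂ) • (1 : Matrix (Fin n) (Fin n) ℂ)).adjugate := by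
    ext1 A
    rw [gramResolvent, Matrix.inv_def, Ring.inverse_eq_inv']
  rw [h]
  exact (hc.matrix_det.inv₀ fun A => (isUnit_det_gram_add A hy).ne_zero).smul hc.matrix_adjugate

/-- The partial trace over `S` of the companion resolvent `(Aᴴ A + y)⁻¹`. -/
noncomputable def partialTrace (y : ℝ) (S : Finset (Fin n)) (A : Matrix (Fin n) (Fin n) ℂ) : ℝ :=
  ∑ j ∈ S, (gramResolvent Aᴴ y j j).re

theorem continuous_partialTrace {y : ℝ} (hy : 0 < y) (S : Finset (Fin n)) :
    Continuous (partialTrace y S) := by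
  unfold partialTrace
  refine continuous_finsetSum _ fun j _ => Complex.continuous_re.comp ?_
  exact ((continuous_gramResolvent hy).comp (continuous_id.matrix_conjTranspose)).matrix_elem j j

theorem partialTrace_nonneg {y : ℝ} (hy : 0 < y) (S : Finset (Fin n))
    (A : Matrix (Fin n) (Fin n) ℂ) : 0 ≤ partialTrace y S A :=
  Finset.sum_nonneg fun j _ => gramResolvent_diag_re_nonneg _ hy j

theorem abs_partialTrace_le {y : ℝ} (hy : 0 < y) (S : Finset (Fin n))
    (A : Matrix (Fin n) (Fin n) ℂ) : |partialTrace y S A| ≤ n / y := by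
  rw [abs_of_nonneg (partialTrace_nonneg hy S A), partialTrace]
  refine (Finset.sum_le_card_nsmul _ _ (1 / y) fun j _ => gramResolvent_diag_re_le _ hy j).trans ?_
  rw [nsmul_eq_mul, mul_one_div]
  have : (S.card : ℝ) ≤ n := by exact_mod_cast card_finset_fin_le S
  gcongr

theorem abs_partialTrace_updateRow_sub_le {y : ℝ} (hy : 0 < y) (S : Finset (Fin n))
    (A : Matrix (Fin n) (Fin n) ℂ) (i : Fin n) :
    |partialTrace y S (A.updateRow i 0) - partialTrace y S A| ≤ 1 / y := by
  have h := sum_gramResolvent_updateRow_sub_mem_Icc A i hy S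
  unfold partialTrace
  rw [abs_of_nonneg h.1]
  exact h.2

theorem abs_partialTrace_update_sub_le {y : ℝ} (hy : 0 < y) (S : Finset (Fin n))
    (ω : Fin n → Fin n → ℂ) (i : Fin n) (r : Fin n → ℂ) :
    |partialTrace y S (lowerPart (Function.update ω i r)) - partialTrace y S (lowerPart ω)| ≤
      1 / y := by
  have h1 := sum_gramResolvent_updateRow_sub_mem_Icc (lowerPart (Function.update ω i r)) i hy S
  have h2 := sum_gramResolvent_updateRow_sub_mem_Icc (lowerPart ω) i hy S
  rw [lowerPart_update_updateRow] at h1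
  unfold partialTrace
  rw [abs_le]
  constructor <;> linarith [h1.1, h1.2, h2.1, h2.2]

theorem measurable_partialTrace_lowerPart {y : ℝ} (hy : 0 < y) (S : Finset (Fin n)) :
    Measurable fun ω : Fin n → Fin n → ℂ => partialTrace y S (lowerPart ω) :=
  ((continuous_partialTrace hy S).comp continuous_lowerPart).measurable

end Array

/-! ### The self-consistent equations -/

section SelfConsistent

variable {n : ℕ} {ν : Measure ℂ}

theorem abs_one_div_one_add_sub_le {a b : ℝ} (ha : 0 ≤ a) (hb : 0 ≤ b) :
    |1 / (1 + a) - 1 / (1 + b)| ≤ |a - b| := by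
  rw [div_sub_div _ _ (by positivity) (by positivity), abs_div,
    abs_of_pos (show 0 < (1 + a) * (1 + b) by positivity), div_le_iff₀ (by positivity)]
  have : 1 * (1 + b) - (1 + a) * 1 = -(a - b) := by ring
  rw [this, abs_neg]
  exact le_mul_of_one_le_right (abs_nonneg _) (by nlinarith)

/-- The diagonal entries of the resolvent are governed by the partial traces of the companion
resolvent over the entries of the same row. -/
theorem abs_integral_gramResolvent_diag_sub_le (hν : IsCenteredUnitLaw ν) {K δ : ℝ} (hK : 0 < K)
    {φ : ℂ → ℝ} (hφ : Measurable φ) (hφK : ∀ z, |φ z| ≤ K) (hφ0 : ∫ z, φ z ∂ν = 0)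
    (hφδ : ∫ z, |‖z‖ ^ 2 - 1 - φ z| ∂ν ≤ δ) {y : ℝ} (hy : 0 < y) (i : Fin n) :
    |y * ∫ ω, (gramResolvent (lowerPart ω) y i i).re ∂iidArray ν n -
      1 / (1 + ∫ ω, partialTrace y (Finset.Iic i) (lowerPart ω) ∂iidArray ν n)| ≤
      (8 * K * √n + n * δ + 2 * √n) * (1 / y) + (1 / y + 4 * (1 / y) * √n) := by
  have := hν.isProbabilityMeasure
  have hn : 0 < n := i.pos
  set S := Finset.Iic i
  set T : (Fin n → Fin n → ℂ) → ℝ := fun ω => partialTrace y S (lowerPart ω)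
  set B : (Fin n → Fin n → ℂ) → ℝ := fun ω => partialTrace y S ((lowerPart ω).updateRow i 0)
  set q : (Fin n → Fin n → ℂ) → ℝ := fun ω => rowForm (lowerPart ω) i y
  set m := ∫ ω, T ω ∂iidArray ν n with hm
  have hT0 : ∀ ω, 0 ≤ T ω := fun ω => partialTrace_nonneg hy S _
  have hB0 : ∀ ω, 0 ≤ B ω := fun ω => partialTrace_nonneg hy S _
  have hq0 : ∀ ω, 0 ≤ q ω := fun ω => rowForm_nonneg _ i hy
  have hm0 : 0 ≤ m := integral_nonneg hT0
  have hTm : Measurable T := measurable_partialTrace_lowerPart hy S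
  have hupd : Continuous fun A : Matrix (Fin n) (Fin n) ℂ => A.updateRow i 0 := by
    fun_prop
  have hBm : Measurable B :=
    ((continuous_partialTrace hy S).comp (hupd.comp continuous_lowerPart)).measurable
  have hgm : Measurable fun ω : Fin n → Fin n → ℂ => (gramResolvent (lowerPart ω) y i i).re :=
    (Complex.continuous_re.comp
      (((continuous_gramResolvent hy).comp continuous_lowerPart).matrix_elem i i)).measurable
  have hgq : ∀ ω, y * (gramResolvent (lowerPart ω) y i i).re = 1 / (1 + q ω) := fun ω =>
    gramResolvent_diag_eq_rowForm _ i hy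
  have hqm : Measurable fun ω => 1 / (1 + q ω) := by
    simp_rw [← hgq]; exact hgm.const_mul y
  have hinv : ∀ {a : ℝ}, 0 ≤ a → |1 / (1 + a)| ≤ 1 := fun {a} ha => by
    rw [abs_of_nonneg (by positivity), div_le_one (by positivity)]; linarith
  have iq : Integrable (fun ω => 1 / (1 + q ω)) (iidArray ν n) :=
    integrable_of_abs_le hqm fun ω => hinv (hq0 ω)
  have hBm' : Measurable fun ω => 1 / (1 + B ω) := by fun_prop
  have iB : Integrable (fun ω => 1 / (1 + B ω)) (iidArray ν n) :=
    integrable_of_abs_le hBm' fun ω => hinv (hB0 ω)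
  have iT : Integrable T (iidArray ν n) :=
    integrable_of_abs_le hTm fun ω => abs_partialTrace_le hy S _
  -- the row is independent of the resolvent of the matrix with that row removed
  have h1 : ∫ ω, |1 / (1 + q ω) - 1 / (1 + B ω)| ∂iidArray ν n ≤
      (8 * K * √n + n * δ + 2 * √n) * (1 / y) := by
    have hi : Integrable (fun ω => |1 / (1 + q ω) - 1 / (1 + B ω)|) (iidArray ν n) :=
      (iq.sub iB).abs
    have hres := integral_pi_eq_integral_update (fun _ : Fin n => Measure.pi fun _ : Fin n => ν)
      hi i
    rw [iidArray, hres]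
    have hinner : ∀ ω : Fin n → Fin n → ℂ,
        ∫ r, |1 / (1 + q (Function.update ω i r)) - 1 / (1 + B (Function.update ω i r))|
          ∂(Measure.pi fun _ : Fin n => ν) ≤ (8 * K * √n + n * δ + 2 * √n) * (1 / y) := by
      intro ω
      obtain ⟨j1, e1⟩ := integral_abs_masked_quadForm_sub_le hν hK hφ hφK hφ0 hφδ hn
        (gramResolvent ((lowerPart ω).updateRow i 0)ᴴ y) (b := 1 / y) (by positivity)
        (fun j => norm_gramResolvent_apply_le _ hy j j)
        (fun k => (sum_norm_sq_gramResolvent_col_le _ hy k).trans_eq (by rw [div_pow, one_pow])) S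
      refine le_trans (integral_mono_of_nonneg (ae_of_all _ fun _ => abs_nonneg _) j1
        (ae_of_all _ fun r => ?_)) e1
      refine (abs_one_div_one_add_sub_le (hq0 _) (hB0 _)).trans_eq ?_
      simp only [q, B, rowForm, partialTrace, lowerPart_update_updateRow, lowerPart_update_row, S]
    calc _ ≤ ∫ _, (8 * K * √n + n * δ + 2 * √n) * (1 / y)
          ∂(Measure.pi fun _ : Fin n => Measure.pi fun _ : Fin n => ν) :=
          integral_mono_of_nonneg (ae_of_all _ fun ω => integral_nonneg fun _ => abs_nonneg _)
            (integrable_const _) (ae_of_all _ hinner)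
      _ = _ := by simp
  have h2 : ∫ ω, |1 / (1 + B ω) - 1 / (1 + m)| ∂iidArray ν n ≤ 1 / y + 4 * (1 / y) * √n := by
    have h3 : ∫ ω, |T ω - m| ∂iidArray ν n ≤ 4 * (1 / y) * √n :=
      integral_abs_sub_integral_le hn _ hTm (by positivity)
        (fun ω => abs_partialTrace_le hy S _)
        (fun ω i r => abs_partialTrace_update_sub_le hy S ω i r)
    have iTm : Integrable (fun ω => |T ω - m|) (iidArray ν n) :=
      (iT.sub (integrable_const _)).abs
    calc _ ≤ ∫ ω, (1 / y + |T ω - m|) ∂iidArray ν n := by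
          refine integral_mono_of_nonneg (ae_of_all _ fun _ => abs_nonneg _)
            ((integrable_const _).add iTm) (ae_of_all _ fun ω => ?_)
          refine (abs_one_div_one_add_sub_le (hB0 ω) hm0).trans ?_
          refine (abs_sub_le _ (T ω) _).trans ?_
          exact add_le_add_left (abs_partialTrace_updateRow_sub_le hy S _ i) _
      _ ≤ _ := by
          rw [integral_add (integrable_const _) iTm]
          simpa using h3
  rw [← integral_const_mul]
  simp_rw [hgq]
  have h4 : ∫ ω, 1 / (1 + q ω) ∂iidArray ν n - 1 / (1 + m) =
      ∫ ω, ((1 / (1 + q ω) - 1 / (1 + B ω)) + (1 / (1 + B ω) - 1 / (1 + m)))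
        ∂iidArray ν n := by
    simp_rw [sub_add_sub_cancel]
    rw [integral_sub iq (integrable_const _)]
    simp
  have iqB : Integrable (fun ω => 1 / (1 + q ω) - 1 / (1 + B ω)) (iidArray ν n) := iq.sub iB
  have iBm : Integrable (fun ω => 1 / (1 + B ω) - 1 / (1 + m)) (iidArray ν n) :=
    iB.sub (integrable_const _)
  rw [h4, integral_add iqB iBm]
  exact (abs_add_le _ _).trans (add_le_add (abs_integral_le_integral_abs.trans h1)
    (abs_integral_le_integral_abs.trans h2))


/-- The expected diagonal entry `j` of the companion resolvent of a triangular array. -/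
noncomputable def meanDiag (ν : Measure ℂ) (n : ℕ) (y : ℝ) (j : Fin n) : ℝ :=
  ∫ ω, (gramResolvent (lowerPart ω)ᴴ y j j).re ∂iidArray ν n

theorem integral_gramResolvent_diag_eq_meanDiag [IsProbabilityMeasure ν] {y : ℝ} (hy : 0 < y)
    (i : Fin n) :
    ∫ ω, (gramResolvent (lowerPart ω) y i i).re ∂iidArray ν n = meanDiag ν n y i.rev := by
  have h := measurePreserving_flipArray (n := n) ν
  have hm : Continuous fun ω : Fin n → Fin n → ℂ => (gramResolvent (lowerPart ω) y i i).re :=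
    Complex.continuous_re.comp
      (((continuous_gramResolvent hy).comp continuous_lowerPart).matrix_elem i i)
  rw [meanDiag]
  conv_lhs => rw [← h.map_eq]
  rw [integral_map h.measurable.aemeasurable hm.aestronglyMeasurable]
  simp_rw [gramResolvent_lowerPart_flipArray]

theorem integrable_gramResolvent_conjTranspose_diag [IsProbabilityMeasure ν] {y : ℝ} (hy : 0 < y)
    (j : Fin n) :
    Integrable (fun ω : Fin n → Fin n → ℂ => (gramResolvent (lowerPart ω)ᴴ y j j).re)
      (iidArray ν n) := by
  have hm : Continuous fun ω : Fin n → Fin n → ℂ => (gramResolvent (lowerPart ω)ᴴ y j j).re :=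
    Complex.continuous_re.comp
      (((continuous_gramResolvent hy).comp
        continuous_lowerPart.matrix_conjTranspose).matrix_elem j j)
  refine integrable_of_abs_le (C := 1 / y) hm.measurable fun ω => ?_
  exact (Complex.abs_re_le_norm _).trans (norm_gramResolvent_apply_le _ hy j j)

theorem integral_partialTrace [IsProbabilityMeasure ν] {y : ℝ} (hy : 0 < y) (S : Finset (Fin n)) :
    ∫ ω, partialTrace y S (lowerPart ω) ∂iidArray ν n = ∑ j ∈ S, meanDiag ν n y j := by
  simp only [partialTrace]
  rw [integral_finsetSum _ fun j _ => integrable_gramResolvent_conjTranspose_diag hy j]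
  rfl

theorem meanDiag_mem_Icc [IsProbabilityMeasure ν] {y : ℝ} (hy : 0 < y) (j : Fin n) :
    meanDiag ν n y j ∈ Set.Icc 0 (1 / y) := by
  refine ⟨integral_nonneg fun ω => gramResolvent_diag_re_nonneg _ hy j, ?_⟩
  refine (integral_mono (integrable_gramResolvent_conjTranspose_diag hy j)
    (integrable_const (1 / y)) fun ω => gramResolvent_diag_re_le _ hy j).trans_eq ?_
  simp

/-- `1 + ∑_{j < k} E ((Aᴴ A + y)⁻¹)_{jj}`; the value at `k = n` carries the expected trace. -/
noncomputable def meanPartialTrace (ν : Measure ℂ) (n : ℕ) (y : ℝ) (k : ℕ) : ℝ :=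
  1 + ∑ j ∈ Finset.univ.filter (fun j : Fin n => (j : ℕ) < k), meanDiag ν n y j

theorem meanPartialTrace_succ {y : ℝ} (j : Fin n) :
    meanPartialTrace ν n y (j + 1) - meanPartialTrace ν n y j = meanDiag ν n y j := by
  have h : (Finset.univ.filter fun i : Fin n => (i : ℕ) < j + 1) =
      insert j (Finset.univ.filter fun i : Fin n => (i : ℕ) < j) := by
    ext i
    simp only [Finset.mem_filter, Finset.mem_univ, true_and, Finset.mem_insert, Fin.ext_iff]
    omega
  rw [meanPartialTrace, h, Finset.sum_insert (by simp), meanPartialTrace]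
  ring

theorem meanPartialTrace_self [IsProbabilityMeasure ν] {y : ℝ} (hy : 0 < y) :
    meanPartialTrace ν n y n =
      1 + ∫ ω, partialTrace y Finset.univ (lowerPart ω) ∂iidArray ν n := by
  rw [integral_partialTrace hy, meanPartialTrace]
  rw [Finset.filter_true_of_mem fun j _ => j.isLt]

/-- The discrete form of the equation `a' (t) = 1 / (x a (1 - t))`, `a 0 = 1`. The product
`a t * a (1 - t)` is constant along the solution, hence equal to `c = a 1`, so that
`a' = a / (x c)` and `log c = 1 / (x c)`. -/
theorem abs_log_sub_le_of_reflected_equation {n : ℕ} {y ε C : ℝ} (hy : 0 < y) (hε : 0 ≤ ε)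
    {α : ℕ → ℝ} (h0 : α 0 = 1) (hinc : ∀ k < n, α (k + 1) - α k ∈ Set.Icc 0 (1 / y))
    (hC : ∀ k ≤ n, α k ≤ C) (hrel : ∀ k < n, |y * (α (k + 1) - α k) - 1 / α (n - k)| ≤ ε) :
    |Real.log (α n) - n / (y * α n)| ≤
      n / y * (2 * C * ε * n / y + ε) + n / y ^ 2 := by
  have h1 : ∀ k ≤ n, 1 ≤ α k := by
    intro k
    induction k with
    | zero => intro _; rw [h0]
    | succ k ih => intro hk; linarith [ih (by omega), (hinc k (by omega)).1]
  have hC1 : 1 ≤ C := (h1 0 (by omega)).trans (hC 0 (by omega))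
  have hstep : ∀ k < n, |(α (k + 1) - α k) * α (n - k) - 1 / y| ≤ C * ε / y := by
    intro k hk
    have hp := h1 (n - k) (by omega)
    have hp0 : α (n - k) ≠ 0 := by positivity
    have e : (α (k + 1) - α k) * α (n - k) - 1 / y =
        (y * (α (k + 1) - α k) - 1 / α (n - k)) * (α (n - k) / y) := by
      field_simp
    rw [e, abs_mul, abs_of_pos (show 0 < α (n - k) / y by positivity), mul_comm C ε, mul_div_assoc]
    have := hC (n - k) (by omega)
    exact mul_le_mul (hrel k hk) (by gcongr) (by positivity) hε
  have hprod : ∀ k ≤ n, |α k * α (n - k) - α n| ≤ k * (2 * (C * ε / y)) := by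
    intro k
    induction k with
    | zero => intro _; simp [h0]
    | succ k ih =>
      intro hk
      have ih' := ih (by omega)
      have s1 := hstep k (by omega)
      have s2 := hstep (n - (k + 1)) (by omega)
      have e1 : n - (k + 1) + 1 = n - k := by omega
      have e2 : n - (n - (k + 1)) = k + 1 := by omega
      rw [e1, e2] at s2
      have e3 : α (k + 1) * α (n - (k + 1)) - α n = (α k * α (n - k) - α n) +
          (((α (k + 1) - α k) * α (n - k) - 1 / y) -
            ((α (n - k) - α (n - (k + 1))) * α (k + 1) - 1 / y)) := by ring
      rw [e3]
      push_cast
      refine (abs_add_le _ _).trans ?_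
      have := abs_sub (((α (k + 1) - α k) * α (n - k) - 1 / y))
            ((α (n - k) - α (n - (k + 1))) * α (k + 1) - 1 / y)
      linarith
  have hlog : ∀ k < n, |Real.log (α (k + 1)) - Real.log (α k) - 1 / (y * α n)| ≤
      1 / y * (2 * C * ε * n / y + ε) + 1 / y ^ 2 := by
    intro k hk
    have p1 := h1 k hk.le
    have p2 := h1 (n - k) (by omega)
    have p3 := h1 n le_rfl
    have p4 := h1 (k + 1) (by omega)
    obtain ⟨i1, i2⟩ := hinc k hk
    set u := (α (k + 1) - α k) / α k with hu
    have hu0 : 0 ≤ u := by positivity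
    have hu1 : u ≤ 1 / y := (div_le_self i1 p1).trans i2
    have e1 : Real.log (α (k + 1)) - Real.log (α k) = Real.log (1 + u) := by
      rw [← Real.log_div (by positivity) (by positivity), hu]
      congr 1
      field_simp
      ring
    have l1 : Real.log (1 + u) ≤ u := by
      have := Real.log_le_sub_one_of_pos (show 0 < 1 + u by positivity)
      linarith
    have l2 : u - u ^ 2 ≤ Real.log (1 + u) := by
      have h := Real.one_sub_inv_le_log_of_pos (show 0 < 1 + u by positivity)
      have h' : u - u ^ 2 ≤ 1 - (1 + u)⁻¹ := by
        have : 1 - (1 + u)⁻¹ = u / (1 + u) := by field_simp; ring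
        rw [this, le_div_iff₀ (by positivity)]
        nlinarith [pow_nonneg hu0 3]
      linarith
    have l3 : u ^ 2 ≤ 1 / y ^ 2 := by
      rw [← one_div_pow]; gcongr
    have d1 : |Real.log (1 + u) - u| ≤ 1 / y ^ 2 := by
      rw [abs_le]; constructor <;> linarith [sq_nonneg u]
    have d2 : |u - 1 / (y * (α k * α (n - k)))| ≤ 1 / y * ε := by
      have e : u - 1 / (y * (α k * α (n - k))) =
          (y * (α (k + 1) - α k) - 1 / α (n - k)) * (1 / (y * α k)) := by
        rw [hu]; field_simp
      rw [e, abs_mul, abs_of_pos (show 0 < 1 / (y * α k) by positivity), mul_comm]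
      refine mul_le_mul ?_ (hrel k hk) (abs_nonneg _) (by positivity)
      exact one_div_le_one_div_of_le hy (le_mul_of_one_le_right hy.le p1)
    have d3 : |1 / (y * (α k * α (n - k))) - 1 / (y * α n)| ≤
        1 / y * (2 * C * ε * n / y) := by
      have hP : 1 ≤ α k * α (n - k) := one_le_mul_of_one_le_of_one_le p1 p2
      have e : 1 / (y * (α k * α (n - k))) - 1 / (y * α n) =
          1 / y * ((α n - α k * α (n - k)) * (1 / (α k * α (n - k) * α n))) := by
        field_simp
      rw [e, abs_mul, abs_of_pos (show 0 < 1 / y by positivity)]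
      refine mul_le_mul_of_nonneg_left ?_ (by positivity)
      rw [abs_mul, abs_sub_comm]
      have b1 : |1 / (α k * α (n - k) * α n)| ≤ 1 := by
        rw [abs_of_pos (by positivity), div_le_one (by positivity)]
        exact one_le_mul_of_one_le_of_one_le hP p3
      calc _ ≤ |α k * α (n - k) - α n| * 1 := by gcongr
        _ ≤ k * (2 * (C * ε / y)) := by rw [mul_one]; exact hprod k hk.le
        _ ≤ n * (2 * (C * ε / y)) := by
          have : (k : ℝ) ≤ n := by exact_mod_cast hk.le
          gcongr
        _ = 2 * C * ε * n / y := by ring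
    rw [e1]
    have e4 : Real.log (1 + u) - 1 / (y * α n) = (Real.log (1 + u) - u) +
        ((u - 1 / (y * (α k * α (n - k)))) +
          (1 / (y * (α k * α (n - k))) - 1 / (y * α n))) := by ring
    rw [e4]
    refine (abs_add_le _ _).trans ?_
    have := abs_add_le (u - 1 / (y * (α k * α (n - k))))
      (1 / (y * (α k * α (n - k))) - 1 / (y * α n))
    linarith
  have hsum : ∀ k ≤ n, |Real.log (α k) - k * (1 / (y * α n))| ≤
      k * (1 / y * (2 * C * ε * n / y + ε) + 1 / y ^ 2) := by
    intro k
    induction k with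
    | zero => intro _; simp [h0]
    | succ k ih =>
      intro hk
      have s := hlog k (by omega)
      have ih' := ih (by omega)
      have e : Real.log (α (k + 1)) - (k + 1 : ℕ) * (1 / (y * α n)) =
          (Real.log (α k) - k * (1 / (y * α n))) +
            (Real.log (α (k + 1)) - Real.log (α k) - 1 / (y * α n)) := by push_cast; ring
      rw [e]
      refine (abs_add_le _ _).trans ?_
      push_cast
      linarith
  have h := hsum n le_rfl
  calc _ = |Real.log (α n) - n * (1 / (y * α n))| := by rw [mul_one_div]
    _ ≤ _ := h
    _ = _ := by ring

theorem meanPartialTrace_reflected_equation_le (hν : IsCenteredUnitLaw ν) {K δ : ℝ} (hK : 0 < K)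
    {φ : ℂ → ℝ} (hφ : Measurable φ) (hφK : ∀ z, |φ z| ≤ K) (hφ0 : ∫ z, φ z ∂ν = 0)
    (hφδ : ∫ z, |‖z‖ ^ 2 - 1 - φ z| ∂ν ≤ δ) {y : ℝ} (hy : 0 < y) {k : ℕ} (hk : k < n) :
    |y * (meanPartialTrace ν n y (k + 1) - meanPartialTrace ν n y k) -
      1 / meanPartialTrace ν n y (n - k)| ≤
      (8 * K * √n + n * δ + 2 * √n) * (1 / y) + (1 / y + 4 * (1 / y) * √n) := by
  have := hν.isProbabilityMeasure
  have h := abs_integral_gramResolvent_diag_sub_le hν hK hφ hφK hφ0 hφδ hy (Fin.rev ⟨k, hk⟩)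
  rw [integral_gramResolvent_diag_eq_meanDiag hy, Fin.rev_rev, integral_partialTrace hy,
    ← meanPartialTrace_succ] at h
  have hS : Finset.Iic (Fin.rev ⟨k, hk⟩) =
      Finset.univ.filter fun j : Fin n => (j : ℕ) < n - k := by
    ext j
    simp only [Finset.mem_Iic, Fin.le_def, Fin.val_rev, Finset.mem_filter, Finset.mem_univ,
      true_and]
    omega
  rw [hS] at h
  exact h

theorem tendsto_meanPartialTrace_equation (hν : IsCenteredUnitLaw ν) {x : ℝ} (hx : 0 < x) :
    Tendsto (fun n : ℕ => Real.log (meanPartialTrace ν n (n * x) n) -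
      1 / (x * meanPartialTrace ν n (n * x) n)) atTop (𝓝 0) := by
  have := hν.isProbabilityMeasure
  rw [Metric.tendsto_atTop']
  intro η hη
  set C : ℝ := 1 + 1 / x with hC
  have hC0 : 0 < C := by positivity
  set ε : ℝ := η / 2 / (1 / x * (2 * C / x + 1)) with hε
  have hε0 : 0 < ε := by positivity
  obtain ⟨K, hK, φ, hφ, hφK, hφ0, hφδ⟩ :=
    exists_bounded_centered_approx hν (show 0 < ε * x / 2 by positivity)
  -- the error in the self-consistent equations tends to `ε / 2`
  have hlim : Tendsto (fun n : ℕ => (8 * K + 6) / x * (1 / √(n : ℝ)) + ε / 2 +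
      1 / x * (1 / (n : ℝ))) atTop (𝓝 ((8 * K + 6) / x * 0 + ε / 2 + 1 / x * 0)) := by
    have h1 : Tendsto (fun n : ℕ => 1 / √(n : ℝ)) atTop (𝓝 0) := by
      simp_rw [one_div]
      exact tendsto_inv_atTop_zero.comp
        (Real.tendsto_sqrt_atTop.comp tendsto_natCast_atTop_atTop)
    exact ((h1.const_mul _).add_const _).add (tendsto_one_div_atTop_nhds_zero_nat.const_mul _)
  have hlim2 : Tendsto (fun n : ℕ => 1 / x ^ 2 * (1 / (n : ℝ))) atTop (𝓝 (1 / x ^ 2 * 0)) :=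
    tendsto_one_div_atTop_nhds_zero_nat.const_mul _
  have ev1 := hlim.eventually (gt_mem_nhds (show (8 * K + 6) / x * 0 + ε / 2 + 1 / x * 0 < ε by
    simp only [mul_zero, zero_add, add_zero]; linarith))
  have ev2 := hlim2.eventually (gt_mem_nhds (show 1 / x ^ 2 * 0 < η / 2 by
    rw [mul_zero]; positivity))
  obtain ⟨N, hN⟩ := eventually_atTop.1 ((ev1.and ev2).and (eventually_gt_atTop 0))
  refine ⟨N, fun n hnN => ?_⟩
  obtain ⟨⟨e1, e2⟩, hn⟩ := hN n hnN.le
  have hn' : (0 : ℝ) < n := by exact_mod_cast hn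
  have hy : 0 < n * x := by positivity
  have hinc : ∀ k < n, meanPartialTrace ν n (n * x) (k + 1) - meanPartialTrace ν n (n * x) k ∈
      Set.Icc 0 (1 / (n * x)) := fun k hk => by
    have := meanPartialTrace_succ (ν := ν) (y := n * x) (⟨k, hk⟩ : Fin n)
    simp only at this
    rw [this]
    exact meanDiag_mem_Icc hy _
  have hCk : ∀ k ≤ n, meanPartialTrace ν n (n * x) k ≤ C := fun k _ => by
    rw [meanPartialTrace, hC]
    gcongr
    refine (Finset.sum_le_card_nsmul _ _ (1 / (n * x)) fun j _ =>
      (meanDiag_mem_Icc hy j).2).trans ?_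
    rw [nsmul_eq_mul]
    have : ((Finset.univ.filter fun j : Fin n => (j : ℕ) < k).card : ℝ) ≤ n := by
      exact_mod_cast card_finset_fin_le _
    calc _ ≤ (n : ℝ) * (1 / (n * x)) := by gcongr
      _ = 1 / x := by field_simp
  have hrel : ∀ k < n, |n * x * (meanPartialTrace ν n (n * x) (k + 1) -
      meanPartialTrace ν n (n * x) k) - 1 / meanPartialTrace ν n (n * x) (n - k)| ≤ ε :=
    fun k hk => by
      refine (meanPartialTrace_reflected_equation_le hν hK hφ hφK hφ0 hφδ hy hk).trans
        (le_trans (le_of_eq ?_) e1.le)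
      have hs : √(n : ℝ) ≠ 0 := (Real.sqrt_pos.2 hn').ne'
      have hs2 : (n : ℝ) = √n * √n := (Real.mul_self_sqrt hn'.le).symm
      generalize √(n : ℝ) = s at hs hs2 ⊢
      rw [hs2]
      field_simp
      ring
  have h := abs_log_sub_le_of_reflected_equation hy hε0.le (by simp [meanPartialTrace]) hinc hCk
    hrel
  rw [dist_zero_right, Real.norm_eq_abs]
  have e3 : (n : ℝ) / (n * x * meanPartialTrace ν n (n * x) n) =
      1 / (x * meanPartialTrace ν n (n * x) n) := by
    rw [mul_assoc, div_mul_eq_div_div, div_self hn'.ne']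
  rw [e3] at h
  refine h.trans_lt ?_
  have e4 : (n : ℝ) / (n * x) * (2 * C * ε * n / (n * x) + ε) + n / (n * x) ^ 2 =
      η / 2 + 1 / x ^ 2 * (1 / (n : ℝ)) := by
    rw [hε]
    field_simp
  rw [e4]
  linarith

/-- The expected trace of the resolvent. The parametrization `x = 1 / (w e ^ w)` by `w > 0` solves
the limiting equation `log c = 1 / (x c)` by `c = e ^ w`. -/
theorem tendsto_integral_partialTrace_univ (hν : IsCenteredUnitLaw ν) {w : ℝ} (hw : 0 < w) :
    Tendsto (fun n : ℕ => ∫ ω, partialTrace (n * (1 / (w * Real.exp w))) Finset.univ (lowerPart ω)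
      ∂iidArray ν n) atTop (𝓝 (Real.exp w - 1)) := by
  have := hν.isProbabilityMeasure
  set x := 1 / (w * Real.exp w) with hx
  have hx0 : 0 < x := by positivity
  set c : ℕ → ℝ := fun n => meanPartialTrace ν n (n * x) n
  have hlim := tendsto_meanPartialTrace_equation hν hx0
  have hc1 : ∀ᶠ n in atTop, 1 ≤ c n := by
    filter_upwards [eventually_gt_atTop 0] with n hn
    have hn' : (0 : ℝ) < n := by exact_mod_cast hn
    have := Finset.sum_nonneg (s := Finset.univ.filter fun j : Fin n => (j : ℕ) < n)
      fun j _ => (meanDiag_mem_Icc (ν := ν) (y := n * x) (by positivity) j).1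
    simp only [c, meanPartialTrace]
    linarith
  -- both terms of the equation are increasing in `c`, so the error bounds `log c - w`
  have hlog : Tendsto (fun n => Real.log (c n)) atTop (𝓝 w) := by
    rw [tendsto_iff_norm_sub_tendsto_zero]
    refine squeeze_zero' (Eventually.of_forall fun _ => norm_nonneg _) ?_
      (tendsto_zero_iff_norm_tendsto_zero.1 hlim)
    filter_upwards [hc1] with n hn
    change |Real.log (c n) - w| ≤ |Real.log (c n) - 1 / (x * c n)|
    have hcn : 0 < c n := by linarith
    have e : 1 / (x * c n) = w * (Real.exp w / c n) := by
      rw [hx]; field_simp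
    rw [e]
    rcases le_total (Real.exp w) (c n) with h | h
    · have h1 : w ≤ Real.log (c n) := (Real.le_log_iff_exp_le hcn).2 h
      have h2 : Real.exp w / c n ≤ 1 := (div_le_one hcn).2 h
      rw [abs_of_nonneg (by linarith), abs_of_nonneg (by nlinarith)]
      nlinarith
    · have h1 : Real.log (c n) ≤ w := (Real.log_le_iff_le_exp hcn).2 h
      have h2 : 1 ≤ Real.exp w / c n := (one_le_div hcn).2 h
      rw [abs_of_nonpos (by linarith), abs_of_nonpos (by nlinarith)]
      nlinarith
  have hexp : Tendsto (fun n => Real.exp (Real.log (c n)) - 1) atTop (𝓝 (Real.exp w - 1)) :=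
    ((Real.continuous_exp.tendsto w).comp hlog).sub_const 1
  refine hexp.congr' ?_
  filter_upwards [hc1, eventually_gt_atTop 0] with n hn hn0
  have hn' : (0 : ℝ) < n := by exact_mod_cast hn0
  rw [Real.exp_log (by linarith)]
  simp only [c]
  rw [meanPartialTrace_self (by positivity)]
  ring

end SelfConsistent

/-! ### Almost sure convergence of the trace -/

section AlmostSure

theorem partialTrace_univ {n : ℕ} {y : ℝ} (hy : 0 < y) (A : Matrix (Fin n) (Fin n) ℂ) :
    partialTrace y Finset.univ A = (gramResolvent A y).trace.re := by
  rw [← trace_gramResolvent_conjTranspose A hy, Matrix.trace, Complex.re_sum]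
  rfl

theorem ae_tendsto_zero_of_summable {Ω : Type*} [MeasurableSpace Ω] {P : Measure Ω}
    [IsFiniteMeasure P] {F : ℕ → Ω → ℝ} {g : ℝ → ℕ → ℝ} (hg : ∀ ε > 0, Summable (g ε))
    (h : ∀ ε > 0, ∀ n, P.real {ω | ε ≤ |F n ω|} ≤ g ε n) :
    ∀ᵐ ω ∂P, Tendsto (fun n => F n ω) atTop (𝓝 0) := by
  have h1 : ∀ k : ℕ, ∀ᵐ ω ∂P, ∀ᶠ n in atTop, ω ∉ {ω | 1 / ((k : ℝ) + 1) ≤ |F n ω|} := by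
    intro k
    have hk : (0 : ℝ) < 1 / (k + 1) := by positivity
    refine ae_eventually_notMem ?_
    have h2 : ∀ n, P {ω | 1 / ((k : ℝ) + 1) ≤ |F n ω|} ≤ ENNReal.ofReal (g (1 / (k + 1)) n) :=
      fun n => by
        rw [← ofReal_measureReal]
        exact ENNReal.ofReal_le_ofReal (h _ hk n)
    have h3 : ∀ n, 0 ≤ g (1 / ((k : ℝ) + 1)) n := fun n => measureReal_nonneg.trans (h _ hk n)
    refine ne_top_of_le_ne_top ?_ (ENNReal.tsum_le_tsum h2)
    rw [← ENNReal.ofReal_tsum_of_nonneg h3 (hg _ hk)]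
    exact ENNReal.ofReal_ne_top
  filter_upwards [ae_all_iff.2 h1] with ω hω
  rw [Metric.tendsto_atTop']
  intro ε hε
  obtain ⟨k, hk⟩ := exists_nat_one_div_lt hε
  obtain ⟨N, hN⟩ := eventually_atTop.1 (hω k)
  refine ⟨N, fun n hn => ?_⟩
  have := hN n hn.le
  rw [not_le] at this
  rw [dist_zero_right, Real.norm_eq_abs]
  exact this.trans hk

/-- An injection of all positions of an `n × n` array into `LowerIndex` which is the identity on and
below the diagonal. -/
def extendIndex (n : ℕ) (p : Fin n × Fin n) : LowerIndex :=
  if h : p.2 ≤ p.1 then ⟨(p.1, p.2), h⟩ else ⟨(n + p.2, p.1), by have := p.1.isLt; simp; omega⟩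

theorem extendIndex_injective (n : ℕ) : Function.Injective (extendIndex n) := by
  rintro ⟨a, b⟩ ⟨c, d⟩ h
  unfold extendIndex at h
  have ha := a.isLt
  have hb := b.isLt
  have hc := c.isLt
  have hd := d.isLt
  simp only at h
  split_ifs at h <;> simp only [Subtype.mk.injEq, Prod.mk.injEq] at h <;>
    simp only [Prod.mk.injEq, Fin.ext_iff] <;> omega

theorem lowerPart_extendIndex (x : LowerIndex → ℂ) (n : ℕ) :
    lowerPart (fun i j => x (extendIndex n (i, j))) = lowerTriangular x n := by
  ext i j
  by_cases h : j ≤ i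
  · simp [lowerPart, lowerTriangular, extendIndex, h]
  · simp [lowerPart, lowerTriangular, h]

variable {Ω : Type*} [MeasurableSpace Ω] {P : Measure Ω} [IsProbabilityMeasure P]
  {X : LowerIndex → Ω → ℂ} {ν : Measure ℂ}

/-- Almost sure convergence for centered entries: the bounded differences inequality with one
coordinate per row gives exponentially small deviation probabilities. -/
theorem ae_tendsto_trace_of_centered (hν : IsCenteredUnitLaw ν) (hm : ∀ p, Measurable (X p))
    (hi : iIndepFun X P) (hl : ∀ p, P.map (X p) = ν) {w : ℝ} (hw : 0 < w) :
    ∀ᵐ ω ∂P, Tendsto (fun n : ℕ => (gramResolvent (lowerTriangular (fun p => X p ω) n)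
      (n * (1 / (w * Real.exp w)))).trace.re) atTop (𝓝 (Real.exp w - 1)) := by
  have := hν.isProbabilityMeasure
  set x := 1 / (w * Real.exp w) with hx
  have hx0 : 0 < x := by positivity
  set T : (n : ℕ) → (Fin n → Fin n → ℂ) → ℝ :=
    fun n η => partialTrace (n * x) Finset.univ (lowerPart η) with hT
  set Y : (n : ℕ) → Ω → Fin n → Fin n → ℂ := fun n ω i j => X (extendIndex n (i, j)) ω with hY
  have hYm : ∀ n, Measurable (Y n) := fun n => by
    refine measurable_pi_lambda _ fun i => measurable_pi_lambda _ fun j => hm _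
  have hlaw : ∀ n, P.map (Y n) = iidArray ν n := fun n =>
    map_array_eq_iidArray (fun p => hm _) (hi.precomp (extendIndex_injective n)) fun p => hl _
  have hdev : ∀ ε > 0, ∀ n, P.real {ω | ε ≤ |T n (Y n ω) - ∫ η, T n η ∂iidArray ν n|} ≤
      2 * Real.exp (n * -(ε ^ 2 * x ^ 2 / 2)) := by
    intro ε hε n
    rcases Nat.eq_zero_or_pos n with rfl | hn
    · simp only [Nat.cast_zero, zero_mul, Real.exp_zero, mul_one]
      exact measureReal_le_one.trans one_le_two
    · have hn' : (0 : ℝ) < n := by exact_mod_cast hn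
      have hy : 0 < n * x := by positivity
      have hTm : Measurable (T n) := measurable_partialTrace_lowerPart hy _
      have h := measureReal_abs_sub_integral_ge_le (fun _ : Fin n => Measure.pi fun _ : Fin n => ν)
        hTm (c := ⟨1 / (n * x), by positivity⟩) (fun η => abs_partialTrace_le hy _ _)
        (fun η i r => abs_partialTrace_update_sub_le hy _ η i r) hε.le
      have hs : MeasurableSet {η | ε ≤ |T n η - ∫ η', T n η' ∂iidArray ν n|} :=
        measurableSet_le measurable_const (hTm.sub_const _).abs
      have e : P.real {ω | ε ≤ |T n (Y n ω) - ∫ η, T n η ∂iidArray ν n|} =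
          (iidArray ν n).real {η | ε ≤ |T n η - ∫ η', T n η' ∂iidArray ν n|} := by
        rw [← hlaw n, map_measureReal_apply (hYm n) (by rw [hlaw n]; exact hs)]
        rfl
      rw [e]
      refine h.trans_eq ?_
      congr 2
      change -ε ^ 2 / (2 * (n * (1 / (n * x)) ^ 2)) = _
      field_simp
  have hsum : ∀ ε > 0, Summable fun n : ℕ => 2 * Real.exp (n * -(ε ^ 2 * x ^ 2 / 2)) :=
    fun ε hε => (Real.summable_exp_nat_mul_iff.2 (by
      rw [neg_lt_zero]; positivity)).mul_left 2
  filter_upwards [ae_tendsto_zero_of_summable hsum hdev] with ω hω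
  have h := hω.add (tendsto_integral_partialTrace_univ hν hw)
  simp only [zero_add] at h
  refine h.congr' ?_
  filter_upwards [eventually_gt_atTop 0] with n hn
  have hn' : (0 : ℝ) < n := by exact_mod_cast hn
  rw [sub_add_cancel, ← lowerPart_extendIndex, ← partialTrace_univ (by positivity)]

end AlmostSure

/-! ### Removing the mean -/

section Mean

theorem lowerTriangular_add_const (x : LowerIndex → ℂ) (m : ℂ) (n : ℕ) :
    lowerTriangular (fun p => x p + m) n - lowerTriangular x n =
      Matrix.of fun i j : Fin n => if j ≤ i then m else 0 := by
  ext i j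
  by_cases h : j ≤ i <;> simp [lowerTriangular, h]

/-- The strictly block lower triangular matrix with constant entries and blocks of size `L` has rank
at most the number of blocks. -/
theorem rank_blockLower_le (n L : ℕ) (m : ℂ) :
    (Matrix.of fun i j : Fin n => if (j : ℕ) / L < (i : ℕ) / L then m else 0).rank ≤ n / L + 1 := by
  have h : (Matrix.of fun i j : Fin n => if (j : ℕ) / L < (i : ℕ) / L then m else 0) =
      (Matrix.of fun (i : Fin n) (k : Fin (n / L + 1)) => if (i : ℕ) / L = k then (1 : ℂ) else 0) *
        Matrix.of fun (k : Fin (n / L + 1)) (j : Fin n) => if (j : ℕ) / L < k then m else 0 := by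
    ext i j
    rw [Matrix.mul_apply, Finset.sum_eq_single
      (⟨(i : ℕ) / L, Nat.lt_succ_of_le (Nat.div_le_div_right i.isLt.le)⟩ : Fin (n / L + 1))]
    · simp
    · intro k _ hk
      have : (i : ℕ) / L ≠ k := fun h => hk (Fin.ext h.symm)
      simp [this]
    · simp
  rw [h]
  exact (Matrix.rank_mul_le_left _ _).trans ((Matrix.rank_le_width _).trans_eq (by simp))

theorem card_same_block_le {n L : ℕ} (hL : 0 < L) (i : Fin n) :
    (Finset.univ.filter fun j : Fin n => (j : ℕ) / L = (i : ℕ) / L).card ≤ L := by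
  have h : ((Finset.univ.filter fun j : Fin n => (j : ℕ) / L = (i : ℕ) / L).map
      Fin.valEmbedding) ⊆ Finset.Ico (L * ((i : ℕ) / L)) (L * ((i : ℕ) / L) + L) := by
    intro k hk
    simp only [Finset.mem_map, Finset.mem_filter, Finset.mem_univ, true_and,
      Fin.valEmbedding_apply] at hk
    obtain ⟨j, hj, rfl⟩ := hk
    rw [Finset.mem_Ico, ← hj]
    have h1 := Nat.div_add_mod (j : ℕ) L
    have h2 := Nat.mod_lt (j : ℕ) hL
    constructor <;> omega
  have := Finset.card_le_card h
  rw [Finset.card_map, Nat.card_Ico] at this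
  omega

/-- Adding a constant to all entries is a perturbation of rank at most `n / L + 1` plus one of
squared Frobenius norm at most `n L |m|²`, for every block size `L`. -/
theorem abs_trace_add_const_sub_le (x : LowerIndex → ℂ) (m : ℂ) {n L : ℕ} (hL : 0 < L) {y : ℝ}
    (hy : 0 < y) :
    |(gramResolvent (lowerTriangular x n) y).trace.re -
      (gramResolvent (lowerTriangular (fun p => x p + m) n) y).trace.re| ≤
      2 * ((n / L : ℕ) + 1) / y + 2 * (√(n * (L * ‖m‖ ^ 2)) * √(n / y ^ 3)) := by
  set A := lowerTriangular x n
  set B := lowerTriangular (fun p => x p + m) n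
  set D := Matrix.of fun i j : Fin n => if (j : ℕ) / L < (i : ℕ) / L then m else 0 with hD
  have h1 := abs_re_trace_gramResolvent_sub_le_rank A (A + D) hy
  have h2 := abs_re_trace_gramResolvent_sub_le_frobenius (A + D) B hy
  have hBA : B - (A + D) =
      Matrix.of fun i j : Fin n => if j ≤ i ∧ (j : ℕ) / L = (i : ℕ) / L then m else 0 := by
    rw [← sub_sub, lowerTriangular_add_const]
    ext i j
    simp only [hD, Matrix.sub_apply, Matrix.of_apply]
    by_cases h : j ≤ i
    · have hle : (j : ℕ) / L ≤ (i : ℕ) / L := Nat.div_le_div_right h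
      rcases hle.lt_or_eq with h' | h'
      · simp [h, h', h'.ne]
      · simp [h, h']
    · have hle : ¬ (j : ℕ) / L < (i : ℕ) / L :=
        not_lt.2 (Nat.div_le_div_right (not_le.1 h).le)
      simp [h, hle]
  have hF : ∑ i, ∑ j, ‖(B - (A + D)) i j‖ ^ 2 ≤ n * (L * ‖m‖ ^ 2) := by
    have hrow : ∀ i, ∑ j, ‖(B - (A + D)) i j‖ ^ 2 ≤ L * ‖m‖ ^ 2 := by
      intro i
      rw [hBA]
      have hle : ∀ j : Fin n, ‖(Matrix.of fun i j : Fin n =>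
          if j ≤ i ∧ (j : ℕ) / L = (i : ℕ) / L then m else 0) i j‖ ^ 2 ≤
          if (j : ℕ) / L = (i : ℕ) / L then ‖m‖ ^ 2 else 0 := by
        intro j
        rw [Matrix.of_apply]
        split_ifs with c1 c2 c2
        · exact le_rfl
        · exact absurd c1.2 c2
        · simp
        · simp
      refine (Finset.sum_le_sum fun j _ => hle j).trans ?_
      rw [← Finset.sum_filter, Finset.sum_const, nsmul_eq_mul]
      have : ((Finset.univ.filter fun j : Fin n => (j : ℕ) / L = (i : ℕ) / L).card : ℝ) ≤ L := by
        exact_mod_cast card_same_block_le hL i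
      gcongr
    refine (Finset.sum_le_card_nsmul _ _ _ fun i _ => hrow i).trans_eq ?_
    simp
  have hR : ((A + D - A).rank : ℝ) ≤ (n / L : ℕ) + 1 := by
    rw [add_sub_cancel_left]
    exact_mod_cast rank_blockLower_le n L m
  rw [Fintype.card_fin] at h2
  refine (abs_sub_le _ _ _).trans (add_le_add (h1.trans ?_) (h2.trans ?_))
  · gcongr
  · gcongr

theorem tendsto_trace_add_const_sub (x : LowerIndex → ℂ) (m : ℂ) {s : ℝ} (hs : 0 < s) :
    Tendsto (fun n : ℕ => (gramResolvent (lowerTriangular x n) (n * s)).trace.re -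
      (gramResolvent (lowerTriangular (fun p => x p + m) n) (n * s)).trace.re) atTop (𝓝 0) := by
  have hsq : Tendsto (fun n : ℕ => 1 / √(n : ℝ)) atTop (𝓝 0) := by
    simp_rw [one_div]
    exact tendsto_inv_atTop_zero.comp
      (Real.tendsto_sqrt_atTop.comp tendsto_natCast_atTop_atTop)
  have hlim : Tendsto (fun n : ℕ => 2 / s * (4 * (1 / √(n : ℝ)) + 1 / (n : ℝ)) +
      2 * √(‖m‖ ^ 2 / s ^ 3 * (1 / √(n : ℝ)))) atTop
      (𝓝 (2 / s * (4 * 0 + 0) + 2 * √(‖m‖ ^ 2 / s ^ 3 * 0))) :=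
    (((hsq.const_mul 4).add tendsto_one_div_atTop_nhds_zero_nat).const_mul _).add
      (((Real.continuous_sqrt.tendsto _).comp (hsq.const_mul _)).const_mul _)
  simp only [mul_zero, add_zero, Real.sqrt_zero] at hlim
  refine squeeze_zero_norm' ?_ hlim
  filter_upwards [eventually_gt_atTop 0] with n hn
  have hn' : (0 : ℝ) < n := by exact_mod_cast hn
  have hL : 0 < n.sqrt := Nat.sqrt_pos.2 hn
  refine (abs_trace_add_const_sub_le x m hL (show 0 < n * s by positivity)).trans ?_
  have hr : 0 < √(n : ℝ) := Real.sqrt_pos.2 hn'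
  have hrr : √(n : ℝ) * √n = n := Real.mul_self_sqrt hn'.le
  have hLr : (n.sqrt : ℝ) ≤ √n := Real.nat_sqrt_le_real_sqrt
  have hdiv : ((n / n.sqrt : ℕ) : ℝ) ≤ 4 * √n := by
    have h1 : n / n.sqrt ≤ 4 * n.sqrt := by
      refine Nat.div_le_of_le_mul ?_
      have := Nat.lt_succ_sqrt n
      nlinarith
    calc ((n / n.sqrt : ℕ) : ℝ) ≤ (4 * n.sqrt : ℕ) := by exact_mod_cast h1
      _ ≤ 4 * √n := by push_cast; gcongr
  refine add_le_add ?_ ?_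
  · calc 2 * (((n / n.sqrt : ℕ) : ℝ) + 1) / (n * s) ≤ 2 * (4 * √n + 1) / (n * s) := by gcongr
      _ = 2 / s * (4 * (1 / √(n : ℝ)) + 1 / (n : ℝ)) := by
        generalize √(n : ℝ) = r at hr hrr ⊢
        rw [← hrr]
        field_simp
  · rw [← Real.sqrt_mul (by positivity)]
    refine mul_le_mul_of_nonneg_left (Real.sqrt_le_sqrt ?_) two_pos.le
    calc n * (n.sqrt * ‖m‖ ^ 2) * (n / (n * s) ^ 3) ≤ n * (√n * ‖m‖ ^ 2) * (n / (n * s) ^ 3) := by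
          gcongr
      _ = ‖m‖ ^ 2 / s ^ 3 * (1 / √(n : ℝ)) := by
        generalize √(n : ℝ) = r at hr hrr ⊢
        rw [← hrr]
        field_simp

variable {Ω : Type*} [MeasurableSpace Ω] {P : Measure Ω} [IsProbabilityMeasure P]
  {X : LowerIndex → Ω → ℂ}

theorem ae_tendsto_trace (hX : IsIIDVarianceOne P X) {w : ℝ} (hw : 0 < w) :
    ∀ᵐ ω ∂P, Tendsto (fun n : ℕ => (gramResolvent (lowerTriangular (fun p => X p ω) n)
      (n * (1 / (w * Real.exp w)))).trace.re) atTop (𝓝 (Real.exp w - 1)) := by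
  set p₀ : LowerIndex := ⟨(0, 0), le_rfl⟩
  set m := ∫ ω, X p₀ ω ∂P
  have hmean : ∀ p, ∫ ω, X p ω ∂P = m := fun p => (hX.identDistrib p p₀).integral_eq
  set Z : LowerIndex → Ω → ℂ := fun p ω => X p ω - m
  have hZm : ∀ p, Measurable (Z p) := fun p => (hX.measurable p).sub_const m
  have hZi : iIndepFun Z P := hX.indep.comp (fun _ z => z - m) fun _ => measurable_id.sub_const m
  have hZl : ∀ p, P.map (Z p) = P.map (Z p₀) := fun p =>
    ((hX.identDistrib p p₀).comp (measurable_id.sub_const m)).map_eq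
  have hX1 : Integrable (X p₀) P := (hX.memLp_two p₀).integrable one_le_two
  have hZ2 : MemLp (Z p₀) 2 P := (hX.memLp_two p₀).sub (memLp_const m)
  have hν : IsCenteredUnitLaw (P.map (Z p₀)) :=
    { isProbabilityMeasure := Measure.isProbabilityMeasure_map (hZm p₀).aemeasurable
      integrable_id := (integrable_map_measure (by fun_prop) (hZm p₀).aemeasurable).2
        (hX1.sub (integrable_const m))
      integral_id := by
        rw [integral_map (hZm p₀).aemeasurable (by fun_prop),
          integral_sub hX1 (integrable_const m)]
        simp [m]
      integrable_sq := (integrable_map_measure (by fun_prop) (hZm p₀).aemeasurable).2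
        ((memLp_two_iff_integrable_sq_norm hZ2.1).1 hZ2)
      integral_sq := by
        rw [integral_map (hZm p₀).aemeasurable (by fun_prop)]
        exact hX.variance_eq_one p₀ }
  filter_upwards [ae_tendsto_trace_of_centered hν hZm hZi hZl hw] with ω hω
  have h := hω.sub (tendsto_trace_add_const_sub (fun p => Z p ω) m
    (show 0 < 1 / (w * Real.exp w) by positivity))
  simpa [Z] using h

end Mean

/-! ### Abel's identity and the expansion of the exponential -/

section Abel

/-- The coefficients `(1 - k) ^ (k - 1)` of Abel's expansion, with value `1` at `k = 0`. -/
noncomputable def abelCoeff (k : ℕ) : ℝ := if k = 0 then 1 else (1 - (k : ℝ)) ^ (k - 1)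

theorem abelCoeff_succ (j : ℕ) : abelCoeff (j + 1) = (-1) ^ j * (j : ℝ) ^ j := by
  simp only [abelCoeff, Nat.succ_ne_zero, if_false, Nat.add_sub_cancel]
  rw [← mul_pow]; push_cast; ring_nf

theorem abelCoeff_mul_pow {m k : ℕ} (hm : 0 < m) (hk : k ≤ m) :
    abelCoeff k * ((k : ℝ) - 1) ^ (m - k) = -((-1) ^ k * ((k : ℝ) - 1) ^ (m - 1)) := by
  rcases k with _ | j
  · obtain ⟨m, rfl⟩ : ∃ l, m = l + 1 := ⟨m - 1, by omega⟩
    simp [abelCoeff, pow_succ]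
  · rw [abelCoeff_succ]
    have : m - 1 = j + (m - (j + 1)) := by omega
    rw [this, pow_add]
    push_cast
    ring

theorem abel_at_neg_one {m : ℕ} (hm : 0 < m) :
    ∑ k ∈ Finset.range (m + 1), (m.choose k : ℝ) * abelCoeff k * (-1 + (k : ℝ)) ^ (m - k) = 0 := by
  have h0 := congrFun (fwdDiff_iter_pow_eq_zero_of_lt (R := ℝ) (Nat.sub_lt hm one_pos)) (-1)
  rw [fwdDiff_iter_eq_sum_shift, Pi.zero_apply] at h0
  rw [← mul_zero (-(-1 : ℝ) ^ m), ← h0, Finset.mul_sum]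
  refine Finset.sum_congr rfl fun k hk => ?_
  have hk' : k ≤ m := Nat.lt_succ_iff.1 (Finset.mem_range.1 hk)
  have e1 : (-1 + (k : ℝ)) = k - 1 := by ring
  have e2 : (-1 : ℝ) ^ m * (-1) ^ (m - k) = (-1) ^ k := by
    rw [← pow_add, show m + (m - k) = k + 2 * (m - k) by omega, pow_add, pow_mul]
    simp
  rw [mul_assoc, e1, abelCoeff_mul_pow hm hk', ← e2]
  simp only [nsmul_eq_mul, mul_one, zsmul_eq_mul, Int.cast_mul, Int.cast_pow, Int.cast_neg,
    Int.cast_one, Int.cast_natCast, e1]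
  ring

/-- Abel's binomial identity, by induction on `m`: both sides have the same derivative, and at
`y = -1` the left side is an `m`-th finite difference of a polynomial of degree `m - 1`. -/
theorem abel_identity (m : ℕ) (y : ℝ) :
    ∑ k ∈ Finset.range (m + 1), (m.choose k : ℝ) * abelCoeff k * (y + (k : ℝ)) ^ (m - k) =
      (1 + y) ^ m := by
  induction m generalizing y with
  | zero => simp [abelCoeff]
  | succ m ih =>
    set F : ℝ → ℝ := fun y => ∑ k ∈ Finset.range (m + 1 + 1),
      ((m + 1).choose k : ℝ) * abelCoeff k * (y + (k : ℝ)) ^ (m + 1 - k) - (1 + y) ^ (m + 1) with hF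
    have hd : ∀ z, HasDerivAt F 0 z := by
      intro z
      have h1 : HasDerivAt (fun y : ℝ => ∑ k ∈ Finset.range (m + 1 + 1),
          ((m + 1).choose k : ℝ) * abelCoeff k * (y + (k : ℝ)) ^ (m + 1 - k))
          (∑ k ∈ Finset.range (m + 1 + 1), ((m + 1).choose k : ℝ) * abelCoeff k *
            (((m + 1 - k : ℕ) : ℝ) * (z + (k : ℝ)) ^ (m + 1 - k - 1) * 1)) z :=
        HasDerivAt.fun_sum fun k _ => (((hasDerivAt_id z).add_const (k : ℝ)).pow _).const_mul _
      have h2 : HasDerivAt (fun y : ℝ => (1 + y) ^ (m + 1))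
          (((m + 1 : ℕ) : ℝ) * (1 + z) ^ (m + 1 - 1) * 1) z :=
        ((hasDerivAt_id z).const_add 1).pow _
      convert! h1.sub h2 using 1
      rw [Finset.sum_range_succ]
      simp only [Nat.sub_self, Nat.cast_zero, zero_mul, mul_zero, add_zero, mul_one]
      rw [Nat.add_sub_cancel, ← ih z, Finset.mul_sum, eq_comm, sub_eq_zero]
      refine Finset.sum_congr rfl fun k hk => ?_
      have hk' : k ≤ m := Nat.lt_succ_iff.1 (Finset.mem_range.1 hk)
      have e1 : m + 1 - k - 1 = m - k := by omega
      have e2 : (((m + 1).choose k * (m + 1 - k) : ℕ) : ℝ) = (m.choose k * (m + 1) : ℕ) := by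
        rw [Nat.choose_mul_succ_eq]
      rw [e1]
      rw [Nat.cast_mul, Nat.cast_mul] at e2
      linear_combination abelCoeff k * (z + k) ^ (m - k) * e2
    have hconst := is_const_of_deriv_eq_zero (fun z => (hd z).differentiableAt)
      (fun z => (hd z).deriv) y (-1)
    have h0 : F (-1) = 0 := by
      simp only [hF]
      rw [abel_at_neg_one (Nat.succ_pos m)]
      simp
    rw [h0] at hconst
    exact sub_eq_zero.1 hconst

open Asymptotics in
/-- The expansion of `e ^ w` in powers of `t = w e ^ w`, that is, Lagrange inversion for the Lambert
function. -/
theorem exp_sub_abel_isBigO (N : ℕ) :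
    (fun w : ℝ => Real.exp w - ∑ k ∈ Finset.range N, abelCoeff k / (k.factorial : ℝ) *
      (w * Real.exp w) ^ k) =O[𝓝 0] fun w => w ^ N := by
  have hexp : ∀ n : ℕ, (fun w : ℝ => Real.exp w - ∑ i ∈ Finset.range n,
      w ^ i / (i.factorial : ℝ)) =O[𝓝 0] fun w => w ^ n := Real.exp_sub_sum_range_isBigO_pow
  -- the remainder of the Taylor expansion of `e ^ (k w)` in the `k`-th term
  have hterm : ∀ k ∈ Finset.range N, (fun w : ℝ => abelCoeff k / (k.factorial : ℝ) *
      (w ^ k * (Real.exp (k * w) - ∑ i ∈ Finset.range (N - k), (k * w) ^ i / (i.factorial : ℝ))))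
      =O[𝓝 0] fun w => w ^ N := by
    intro k hk
    have hk' : k < N := Finset.mem_range.1 hk
    have ht : Tendsto (fun w : ℝ => (k : ℝ) * w) (𝓝 0) (𝓝 0) := by
      have : Continuous fun w : ℝ => (k : ℝ) * w := by fun_prop
      simpa using this.tendsto 0
    have h1 := (hexp (N - k)).comp_tendsto ht
    have h2 : ((fun w : ℝ => w ^ (N - k)) ∘ fun w : ℝ => (k : ℝ) * w) =O[𝓝 0]
        fun w => w ^ (N - k) := by
      simp only [Function.comp_def, mul_pow]
      exact isBigO_const_mul_self _ _ _
    have h3 := (isBigO_refl (fun w : ℝ => w ^ k) (𝓝 0)).mul (h1.trans h2)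
    have h4 : (fun w : ℝ => w ^ k * w ^ (N - k)) = fun w => w ^ N := by
      ext w; rw [← pow_add]; congr 1; omega
    rw [h4] at h3
    exact h3.const_mul_left _
  have hsum := IsBigO.fun_sum hterm
  refine ((hexp N).sub hsum).congr_left fun w => ?_
  have habel : ∑ m ∈ Finset.range N, w ^ m / (m.factorial : ℝ) =
      ∑ k ∈ Finset.range N, ∑ i ∈ Finset.range (N - k),
        abelCoeff k / (k.factorial : ℝ) * (w ^ k * ((k * w) ^ i / (i.factorial : ℝ))) := by
    rw [← Finset.sum_range_diag_flip N fun k i =>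
      abelCoeff k / (k.factorial : ℝ) * (w ^ k * ((k * w) ^ i / (i.factorial : ℝ)))]
    refine Finset.sum_congr rfl fun m _ => ?_
    have h := abel_identity m 0
    simp only [zero_add, add_zero, one_pow] at h
    rw [← mul_one (w ^ m), ← h, Finset.mul_sum, Finset.sum_div]
    refine Finset.sum_congr rfl fun k hk => ?_
    have hk' : k ≤ m := Nat.lt_succ_iff.1 (Finset.mem_range.1 hk)
    rw [Nat.cast_choose ℝ hk', mul_pow]
    have e : w ^ m = w ^ k * w ^ (m - k) := by rw [← pow_add]; congr 1; omega
    rw [e]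
    have f1 : (m.factorial : ℝ) ≠ 0 := by positivity
    field_simp
  have hsplit : ∑ k ∈ Finset.range N, abelCoeff k / (k.factorial : ℝ) *
      (w ^ k * (Real.exp (k * w) - ∑ i ∈ Finset.range (N - k), (k * w) ^ i / (i.factorial : ℝ))) =
      ∑ k ∈ Finset.range N, abelCoeff k / (k.factorial : ℝ) * (w * Real.exp w) ^ k -
      ∑ k ∈ Finset.range N, ∑ i ∈ Finset.range (N - k),
        abelCoeff k / (k.factorial : ℝ) * (w ^ k * ((k * w) ^ i / (i.factorial : ℝ))) := by
    rw [← Finset.sum_sub_distrib]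
    refine Finset.sum_congr rfl fun k _ => ?_
    rw [mul_sub, mul_sub, mul_pow, ← Real.exp_nat_mul, Finset.mul_sum, Finset.mul_sum]
  rw [hsplit, habel]
  ring

end Abel

/-! ### Moments from the Stieltjes transform -/

section Moments

open scoped NNReal

/-- The Stieltjes transform, at `-x`, of a measure on the half-line. -/
noncomputable def stieltjes (μ : Measure ℝ≥0) (x : ℝ) : ℝ := ∫ l, 1 / (x + (l : ℝ)) ∂μ

theorem integrable_one_div_add (μ : Measure ℝ≥0) [IsFiniteMeasure μ] {x : ℝ} (hx : 0 < x) :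
    Integrable (fun l : ℝ≥0 => 1 / (x + (l : ℝ))) μ := by
  refine integrable_of_abs_le (C := 1 / x) (by fun_prop) fun l => ?_
  have := l.2
  rw [abs_of_nonneg (by positivity)]
  exact one_div_le_one_div_of_le hx (le_add_of_nonneg_right l.2)

/-- The sequence of moments `k ^ k / (k + 1)!`. -/
noncomputable def limitMoment (k : ℕ) : ℝ := (k : ℝ) ^ k / ((k + 1).factorial : ℝ)

open Asymptotics in
/-- The asymptotic expansion at `t = 0+` of the generating function of the moments. -/
theorem integral_one_div_one_add_sub_isBigO {μ : Measure ℝ≥0} [IsProbabilityMeasure μ]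
    (hμ : ∀ w : ℝ, 0 < w → stieltjes μ (1 / (w * Real.exp w)) = Real.exp w - 1) (N : ℕ) :
    (fun w : ℝ => ∫ l : ℝ≥0, 1 / (1 + w * Real.exp w * l) ∂μ -
      ∑ j ∈ Finset.range N, (-1) ^ j * limitMoment j * (w * Real.exp w) ^ j) =O[𝓝[>] 0]
      fun w => w ^ N := by
  have h := (exp_sub_abel_isBigO (N + 1)).mono (nhdsWithin_le_nhds (s := Set.Ioi 0))
  have hinv : (fun w : ℝ => (w * Real.exp w)⁻¹) =O[𝓝[>] 0] fun w => w⁻¹ := by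
    refine IsBigO.of_bound 1 ?_
    filter_upwards [self_mem_nhdsWithin] with w hw
    have hw0 : (0 : ℝ) < w := hw
    rw [one_mul, norm_inv, norm_inv, Real.norm_of_nonneg (by positivity),
      Real.norm_of_nonneg hw0.le]
    exact inv_anti₀ hw0 (le_mul_of_one_le_right hw0.le (Real.one_le_exp hw0.le))
  refine (hinv.mul h).congr' ?_ ?_
  · filter_upwards [self_mem_nhdsWithin] with w hw
    have hw0 : (0 : ℝ) < w := hw
    set t := w * Real.exp w with ht
    have ht0 : 0 < t := by positivity
    have h1 : Real.exp w - 1 = t * ∫ l : ℝ≥0, 1 / (1 + t * l) ∂μ := by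
      rw [← hμ w hw0, stieltjes, ← integral_const_mul]
      refine integral_congr_ae (ae_of_all _ fun l => ?_)
      have := l.2
      have h4 : 0 < 1 + t * (l : ℝ) := by positivity
      simp only
      rw [← ht]
      field_simp
    rw [Finset.sum_range_succ']
    have h2 : ∀ j ∈ Finset.range N, abelCoeff (j + 1) / ((j + 1).factorial : ℝ) * t ^ (j + 1) =
        t * ((-1) ^ j * limitMoment j * t ^ j) := fun j _ => by
      rw [abelCoeff_succ, limitMoment, pow_succ]; ring
    rw [Finset.sum_congr rfl h2, ← Finset.mul_sum]
    have h3 : abelCoeff 0 / ((0 : ℕ).factorial : ℝ) * t ^ 0 = 1 := by simp [abelCoeff]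
    rw [h3, ← sub_sub, sub_right_comm, h1, ← mul_sub, inv_mul_cancel_left₀ ht0.ne']
  · filter_upwards [self_mem_nhdsWithin] with w hw
    have hw0 : w ≠ 0 := ne_of_gt hw
    rw [pow_succ]; field_simp

theorem geometric_expansion {t l : ℝ} (h : 1 + t * l ≠ 0) (k : ℕ) :
    (-t) ^ k * (l ^ k / (1 + t * l)) =
      1 / (1 + t * l) - ∑ j ∈ Finset.range k, (-t) ^ j * l ^ j := by
  have hg : (∑ j ∈ Finset.range k, (-t * l) ^ j) * (1 + t * l) = 1 - (-t * l) ^ k := by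
    have := geom_sum_mul_neg (-t * l) k
    rwa [show 1 - -t * l = 1 + t * l by ring] at this
  simp_rw [← mul_pow]
  rw [eq_sub_iff_add_eq, ← mul_div_assoc, ← mul_pow, div_add' _ _ _ h, hg]
  ring_nf

/-- Recovery of moments: the moment of order `k` is the monotone limit of the integrals of
`l ^ k / (1 + t l)` as `t` decreases to `0`, and these are determined by the expansion of the
Stieltjes transform and the moments of lower order. -/
theorem moments_of_stieltjes {μ : Measure ℝ≥0} [IsProbabilityMeasure μ]
    (hμ : ∀ w : ℝ, 0 < w → stieltjes μ (1 / (w * Real.exp w)) = Real.exp w - 1) (k : ℕ) :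
    Integrable (fun l : ℝ≥0 => (l : ℝ) ^ k) μ ∧ ∫ l : ℝ≥0, (l : ℝ) ^ k ∂μ = limitMoment k := by
  induction k using Nat.strong_induction_on with
  | _ k ih =>
  set τ : ℝ → ℝ := fun w => w * Real.exp w with hτ
  have hτ0 : ∀ w > 0, 0 < τ w := fun w hw => by positivity
  have hden : ∀ w > 0, ∀ l : ℝ≥0, 0 < 1 + τ w * (l : ℝ) := fun w hw l => by
    have := hτ0 w hw
    have := l.2
    positivity
  have hI0 : ∀ w > 0, Integrable (fun l : ℝ≥0 => 1 / (1 + τ w * (l : ℝ))) μ := fun w hw => by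
    refine integrable_of_abs_le (C := 1) (by fun_prop) fun l => ?_
    rw [abs_of_pos (one_div_pos.2 (hden w hw l)), div_le_one (hden w hw l)]
    exact le_add_of_nonneg_right (mul_nonneg (hτ0 w hw).le l.2)
  have hIsum : ∀ w : ℝ, Integrable (fun l : ℝ≥0 =>
      ∑ j ∈ Finset.range k, (-τ w) ^ j * (l : ℝ) ^ j) μ := fun w =>
    integrable_finsetSum _ fun j hj => ((ih j (Finset.mem_range.1 hj)).1).const_mul _
  have hI1 : ∀ w > 0, Integrable (fun l : ℝ≥0 => (l : ℝ) ^ k / (1 + τ w * l)) μ := fun w hw => by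
    have h1 := ((hI0 w hw).sub (hIsum w)).const_mul ((-τ w) ^ k)⁻¹
    refine h1.congr (ae_of_all _ fun l => ?_)
    simp only [Pi.sub_apply]
    rw [← geometric_expansion (hden w hw l).ne', inv_mul_cancel_left₀]
    exact pow_ne_zero _ (neg_ne_zero.2 (hτ0 w hw).ne')
  have hval : ∀ w > 0, (-τ w) ^ k * ∫ l : ℝ≥0, (l : ℝ) ^ k / (1 + τ w * l) ∂μ =
      ∫ l : ℝ≥0, 1 / (1 + τ w * l) ∂μ -
        ∑ j ∈ Finset.range k, (-1) ^ j * limitMoment j * τ w ^ j := fun w hw => by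
    rw [← integral_const_mul]
    simp_rw [geometric_expansion (hden w hw _).ne']
    rw [integral_sub (hI0 w hw) (hIsum w), integral_finsetSum _ fun j hj =>
      ((ih j (Finset.mem_range.1 hj)).1).const_mul _]
    congr 1
    refine Finset.sum_congr rfl fun j hj => ?_
    rw [integral_const_mul, (ih j (Finset.mem_range.1 hj)).2, neg_pow]
    ring
  have hlim : Tendsto (fun w => ∫ l : ℝ≥0, (l : ℝ) ^ k / (1 + τ w * l) ∂μ) (𝓝[>] 0)
      (𝓝 (limitMoment k)) := by
    have hO := integral_one_div_one_add_sub_isBigO hμ (k + 1)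
    have hinv : (fun w : ℝ => ((-τ w) ^ k)⁻¹) =O[𝓝[>] 0] fun w => (w ^ k)⁻¹ := by
      refine Asymptotics.IsBigO.of_bound 1 ?_
      filter_upwards [self_mem_nhdsWithin] with w hw
      have hw0 : (0 : ℝ) < w := hw
      rw [one_mul, norm_inv, norm_inv, norm_pow, norm_neg, ← norm_pow,
        Real.norm_of_nonneg (pow_nonneg (hτ0 w hw0).le k), Real.norm_of_nonneg (by positivity)]
      refine inv_anti₀ (by positivity) (pow_le_pow_left₀ hw0.le ?_ k)
      exact le_mul_of_one_le_right hw0.le (Real.one_le_exp hw0.le)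
    have h2 := hinv.mul hO
    have h3 : (fun w : ℝ => ∫ l : ℝ≥0, (l : ℝ) ^ k / (1 + τ w * l) ∂μ - limitMoment k)
        =O[𝓝[>] 0] fun w => w := by
      refine h2.congr' ?_ ?_
      · filter_upwards [self_mem_nhdsWithin] with w hw
        have hw0 : (0 : ℝ) < w := hw
        have hne : (-τ w) ^ k ≠ 0 := pow_ne_zero _ (neg_ne_zero.2 (hτ0 w hw0).ne')
        have e := hval w hw0
        rw [Finset.sum_range_succ, ← sub_sub]
        change ((-τ w) ^ k)⁻¹ * (∫ l : ℝ≥0, 1 / (1 + τ w * l) ∂μ -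
          ∑ j ∈ Finset.range k, (-1) ^ j * limitMoment j * τ w ^ j -
            (-1) ^ k * limitMoment k * τ w ^ k) = _
        rw [← e, mul_right_comm, ← neg_pow, ← mul_sub, inv_mul_cancel_left₀ hne]
      · filter_upwards [self_mem_nhdsWithin] with w hw
        have hw0 : w ≠ 0 := ne_of_gt hw
        rw [pow_succ]; field_simp
    have h4 := h3.trans_tendsto (tendsto_nhdsWithin_of_tendsto_nhds tendsto_id)
    simpa using h4.add_const (limitMoment k)
  -- monotone convergence along `w = 1 / (i + 1)`
  set v : ℕ → ℝ := fun i => 1 / ((i : ℝ) + 1)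
  have hv0 : ∀ i, 0 < v i := fun i => by positivity
  have hvt : Tendsto v atTop (𝓝[>] 0) :=
    tendsto_nhdsWithin_iff.2 ⟨tendsto_one_div_add_atTop_nhds_zero_nat,
      Eventually.of_forall fun i => hv0 i⟩
  have hmono : ∀ l : ℝ≥0, Monotone fun i => ENNReal.ofReal ((l : ℝ) ^ k / (1 + τ (v i) * l)) := by
    intro l i j hij
    have hle : v j ≤ v i := by
      have : (i : ℝ) ≤ j := by exact_mod_cast hij
      exact one_div_le_one_div_of_le (by positivity) (by linarith)
    have hτle : τ (v j) ≤ τ (v i) :=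
      mul_le_mul hle (Real.exp_le_exp.2 hle) (Real.exp_pos _).le (hv0 i).le
    refine ENNReal.ofReal_le_ofReal (div_le_div_of_nonneg_left (by positivity)
      (hden _ (hv0 j) l) ?_)
    have := l.2
    gcongr
  have hpt : ∀ l : ℝ≥0, Tendsto (fun i => ENNReal.ofReal ((l : ℝ) ^ k / (1 + τ (v i) * l))) atTop
      (𝓝 (ENNReal.ofReal ((l : ℝ) ^ k))) := by
    intro l
    refine (ENNReal.continuous_ofReal.tendsto _).comp ?_
    have hc : ContinuousAt (fun w : ℝ => (l : ℝ) ^ k / (1 + τ w * l)) 0 := by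
      refine ContinuousAt.div (by fun_prop) (by fun_prop) ?_
      simp [hτ]
    have := hc.tendsto.comp (tendsto_nhds_of_tendsto_nhdsWithin hvt)
    simpa [hτ, Function.comp_def] using this
  have hL := lintegral_tendsto_of_tendsto_of_monotone (μ := μ)
    (f := fun i (l : ℝ≥0) => ENNReal.ofReal ((l : ℝ) ^ k / (1 + τ (v i) * l)))
    (F := fun l : ℝ≥0 => ENNReal.ofReal ((l : ℝ) ^ k))
    (fun i => by fun_prop) (ae_of_all _ hmono) (ae_of_all _ hpt)
  have hL' : Tendsto (fun i => ∫⁻ l : ℝ≥0, ENNReal.ofReal ((l : ℝ) ^ k / (1 + τ (v i) * l)) ∂μ)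
      atTop (𝓝 (ENNReal.ofReal (limitMoment k))) := by
    have e : ∀ i, ∫⁻ l : ℝ≥0, ENNReal.ofReal ((l : ℝ) ^ k / (1 + τ (v i) * l)) ∂μ =
        ENNReal.ofReal (∫ l : ℝ≥0, (l : ℝ) ^ k / (1 + τ (v i) * l) ∂μ) := fun i =>
      (ofReal_integral_eq_lintegral_ofReal (hI1 _ (hv0 i)) (ae_of_all _ fun l => by
        have h1 := hden _ (hv0 i) l
        have h2 := l.2
        simp only [Pi.zero_apply]
        positivity)).symm
    simp_rw [e]
    exact (ENNReal.continuous_ofReal.tendsto _).comp (hlim.comp hvt)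
  have heq := tendsto_nhds_unique hL hL'
  have hnn : 0 ≤ᵐ[μ] fun l : ℝ≥0 => (l : ℝ) ^ k := ae_of_all _ fun l => by positivity
  have hm : AEStronglyMeasurable (fun l : ℝ≥0 => (l : ℝ) ^ k) μ := by fun_prop
  refine ⟨⟨hm, ?_⟩, ?_⟩
  · rw [hasFiniteIntegral_iff_ofReal hnn, heq]
    exact ENNReal.ofReal_lt_top
  · rw [integral_eq_lintegral_of_nonneg_ae hnn hm, heq, ENNReal.toReal_ofReal]
    unfold limitMoment
    positivity

end Moments

/-! ### From Stieltjes transforms to weak convergence -/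

section WeakConvergence

open scoped NNReal BoundedContinuousFunction

theorem stieltjes_anti (μ : Measure ℝ≥0) [IsFiniteMeasure μ] {x y : ℝ} (hx : 0 < x)
    (hxy : x ≤ y) : stieltjes μ y ≤ stieltjes μ x := by
  refine integral_mono (integrable_one_div_add μ (hx.trans_le hxy)) (integrable_one_div_add μ hx)
    fun l => ?_
  have := l.2
  exact one_div_le_one_div_of_le (by positivity) (by simpa using hxy)

theorem exists_eq_one_div_mul_exp {x : ℝ} (hx : 0 < x) :
    ∃ w : ℝ, 0 < w ∧ x = 1 / (w * Real.exp w) := by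
  have hc : ContinuousOn (fun w : ℝ => w * Real.exp w) (Set.Icc 0 (1 / x)) := by fun_prop
  have hx' : 0 < 1 / x := by positivity
  obtain ⟨w, hw, hw1⟩ := intermediate_value_Icc hx'.le hc
    (show 1 / x ∈ Set.Icc _ _ from ⟨by simpa using hx.le,
      le_mul_of_one_le_right hx'.le (Real.one_le_exp hx'.le)⟩)
  have hw1 : w * Real.exp w = 1 / x := hw1
  refine ⟨w, hw.1.lt_of_ne' ?_, by rw [hw1, one_div_one_div]⟩
  rintro rfl
  rw [zero_mul] at hw1
  exact hx'.ne hw1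

/-- Pointwise convergence of Stieltjes transforms at countably many points suffices, by
monotonicity and continuity of the limit. -/
theorem tendsto_stieltjes_of_rat {μ : ℕ → ProbabilityMeasure ℝ≥0}
    (h : ∀ q : ℚ, 0 < q → Tendsto (fun n => stieltjes (μ n) (1 / ((q : ℝ) * Real.exp q))) atTop
      (𝓝 (Real.exp q - 1))) {w : ℝ} (hw : 0 < w) :
    Tendsto (fun n => stieltjes (μ n) (1 / (w * Real.exp w))) atTop (𝓝 (Real.exp w - 1)) := by
  have hmono : ∀ n, ∀ u v : ℝ, 0 < u → u ≤ v →
      stieltjes (μ n) (1 / (u * Real.exp u)) ≤ stieltjes (μ n) (1 / (v * Real.exp v)) := by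
    intro n u v hu huv
    have hv := hu.trans_le huv
    refine stieltjes_anti _ (by positivity) (one_div_le_one_div_of_le (by positivity) ?_)
    gcongr
  have hcont : ContinuousAt (fun v : ℝ => Real.exp v - 1) w := by fun_prop
  refine tendsto_order.2 ⟨fun a ha => ?_, fun b hb => ?_⟩
  · obtain ⟨l, hl, hl'⟩ := exists_Ioc_subset_of_mem_nhds (hcont.eventually (lt_mem_nhds ha)) ⟨0, hw⟩
    obtain ⟨q, hq, hqw⟩ := exists_rat_btwn (max_lt hl hw)
    have hq0 : (0 : ℝ) < q := (le_max_right _ _).trans_lt hq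
    filter_upwards [(h q (by exact_mod_cast hq0)).eventually
      (lt_mem_nhds (hl' ⟨(le_max_left _ _).trans_lt hq, hqw.le⟩))] with n hn
    exact hn.trans_le (hmono n _ _ hq0 hqw.le)
  · obtain ⟨l, hl, hl'⟩ := exists_Ico_subset_of_mem_nhds (hcont.eventually (gt_mem_nhds hb))
      ⟨w + 1, lt_add_one w⟩
    obtain ⟨q, hq, hqw⟩ := exists_rat_btwn hl
    have hq0 : (0 : ℝ) < q := hw.trans hq
    filter_upwards [(h q (by exact_mod_cast hq0)).eventually
      (gt_mem_nhds (hl' ⟨hq.le, hqw⟩))] with n hn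
    exact (hmono n _ _ hw hq.le).trans_lt hn

/-- The mass beyond `r` is controlled by the Stieltjes transform at `r`. -/
theorem measureReal_compl_closedBall_le (μ : Measure ℝ≥0) [IsProbabilityMeasure μ] {r : ℝ}
    (hr : 0 < r) :
    μ.real (Metric.closedBall 0 r)ᶜ ≤ 2 * (1 - r * stieltjes μ r) := by
  have hi := integrable_one_div_add μ hr
  have h1 : ∫ l : ℝ≥0, (1 - r * (1 / (r + (l : ℝ)))) ∂μ = 1 - r * stieltjes μ r := by
    rw [integral_sub (integrable_const _) (hi.const_mul r), integral_const_mul]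
    simp [stieltjes]
  have h2 := mul_meas_ge_le_integral_of_nonneg (μ := μ) (ε := 1 / 2)
    (f := fun l : ℝ≥0 => 1 - r * (1 / (r + (l : ℝ))))
    (ae_of_all _ fun l => by
      have := l.2
      have h : r * (1 / (r + (l : ℝ))) ≤ 1 := by
        rw [mul_one_div, div_le_one (by positivity)]; simp
      simpa using h) ((integrable_const _).sub (hi.const_mul r))
  rw [h1] at h2
  have h3 : μ.real (Metric.closedBall 0 r)ᶜ ≤
      μ.real {l : ℝ≥0 | 1 / 2 ≤ 1 - r * (1 / (r + (l : ℝ)))} := by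
    refine measureReal_mono fun l hl => ?_
    have := l.2
    have hl : r < l := by simpa [NNReal.dist_eq] using hl
    have : r * (1 / (r + (l : ℝ))) ≤ 1 / 2 := by
      rw [mul_one_div, div_le_div_iff₀ (by positivity) (by norm_num)]; linarith
    simp only [Set.mem_ofPred_eq]
    linarith
  linarith

theorem isTightMeasureSet_of_tendsto_stieltjes {μ : ℕ → ProbabilityMeasure ℝ≥0}
    (h : ∀ w : ℝ, 0 < w → Tendsto (fun n => stieltjes (μ n) (1 / (w * Real.exp w))) atTop
      (𝓝 (Real.exp w - 1))) :
    IsTightMeasureSet {(μ n : Measure ℝ≥0) | n} := by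
  rw [isTightMeasureSet_iff_exists_isCompact_measure_compl_le]
  intro ε hε
  obtain ⟨δ, hδ0, hδ⟩ : ∃ δ : ℝ, 0 < δ ∧ ENNReal.ofReal δ ≤ ε := by
    rcases eq_or_ne ε ⊤ with rfl | hε'
    · exact ⟨1, one_pos, le_top⟩
    · exact ⟨ε.toReal, ENNReal.toReal_pos hε.ne' hε', ENNReal.ofReal_toReal hε' |>.le⟩
  set w := δ / 4
  have hw : 0 < w := by positivity
  set r := 1 / (w * Real.exp w) with hr
  have hr0 : 0 < r := by positivity
  -- `r (e ^ w - 1) ≥ e ^ (-w) ≥ 1 - w`, so that the limit mass beyond `r` is at most `2 w`.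
  have hlim : 1 - 2 * w < r * (Real.exp w - 1) := by
    have h1 : w * (r * Real.exp w) = 1 := by rw [hr]; field_simp
    have h2 : r * w ≤ r * (Real.exp w - 1) := by
      gcongr; linarith [Real.add_one_le_exp w]
    have h3 : r * w = Real.exp (-w) := by rw [hr, Real.exp_neg]; field_simp
    linarith [Real.add_one_le_exp (-w)]
  obtain ⟨N, hN⟩ := eventually_atTop.1 (((h w hw).const_mul r).eventually (lt_mem_nhds hlim))
  choose K hK hKμ using fun n => (isTightMeasureSet_iff_exists_isCompact_measure_compl_le.1
    (isTightMeasureSet_singleton (μ := (μ n : Measure ℝ≥0)))) ε hε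
  refine ⟨Metric.closedBall 0 r ∪ ⋃ n ∈ Finset.range N, K n,
    (isCompact_closedBall 0 r).union ((Finset.range N).isCompact_biUnion fun n _ => hK n), ?_⟩
  rintro _ ⟨n, rfl⟩
  rcases lt_or_ge n N with hn | hn
  · refine (measure_mono (Set.compl_subset_compl.2 ?_)).trans (hKμ n _ rfl)
    exact (Set.subset_biUnion_of_mem (u := K) (Finset.mem_coe.2 (Finset.mem_range.2 hn))).trans
      Set.subset_union_right
  · refine (measure_mono (Set.compl_subset_compl.2 Set.subset_union_left)).trans (le_trans ?_ hδ)
    rw [← ofReal_measureReal]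
    refine ENNReal.ofReal_le_ofReal ((measureReal_compl_closedBall_le _ hr0).trans ?_)
    have := hN n hn
    have hw4 : w = δ / 4 := rfl
    linarith

/-- The Cauchy kernel `l ↦ 1 / (x + l)` as a bounded continuous function on `ℝ≥0`. -/
noncomputable def cauchyKernel (x : {x : ℝ // 0 < x}) : ℝ≥0 →ᵇ ℝ :=
  BoundedContinuousFunction.ofNormedAddCommGroup (fun l : ℝ≥0 => 1 / ((x : ℝ) + (l : ℝ)))
    (by
      have hx := x.2
      exact continuous_const.div (by fun_prop) fun l => by have := l.2; positivity)
    (1 / (x : ℝ)) fun l => by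
      have hx := x.2
      have := l.2
      rw [Real.norm_of_nonneg (by positivity)]
      exact one_div_le_one_div_of_le hx (le_add_of_nonneg_right l.2)

theorem cauchyKernel_apply (x : {x : ℝ // 0 < x}) (l : ℝ≥0) :
    cauchyKernel x l = 1 / ((x : ℝ) + (l : ℝ)) := rfl

theorem continuous_cauchyKernel : Continuous cauchyKernel := by
  refine continuous_iff_continuousAt.2 fun x => ?_
  refine tendsto_iff_dist_tendsto_zero.2 (squeeze_zero (fun _ => dist_nonneg)
    (g := fun y : {x : ℝ // 0 < x} => |(y : ℝ) - x| * (1 / ((y : ℝ) * x))) (fun y => ?_) ?_)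
  · have hx := x.2
    have hy := y.2
    refine (BoundedContinuousFunction.dist_le (by positivity)).2 fun l => ?_
    have hl := l.2
    rw [cauchyKernel_apply, cauchyKernel_apply, Real.dist_eq,
      show 1 / ((y : ℝ) + l) - 1 / (x + l) = (x - y) * (1 / ((y + l) * (x + l))) by
        field_simp; ring, abs_mul, abs_sub_comm]
    gcongr
    rw [abs_of_nonneg (by positivity)]
    gcongr <;> exact le_add_of_nonneg_right hl
  · have hx := x.2
    have : Tendsto (fun y : {x : ℝ // 0 < x} => |(y : ℝ) - x| * (1 / ((y : ℝ) * x))) (𝓝 x)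
        (𝓝 (|(x : ℝ) - x| * (1 / ((x : ℝ) * x)))) := by
      refine ContinuousAt.mul (by fun_prop) ?_
      refine ContinuousAt.div continuousAt_const (by fun_prop) (by positivity)
    simpa using this

/-- The closed linear span of the constants and the Cauchy kernels. -/
noncomputable def cauchySpan : Submodule ℝ (ℝ≥0 →ᵇ ℝ) :=
  (Submodule.span ℝ (insert 1 (Set.range cauchyKernel))).topologicalClosure

theorem cauchyKernel_mem_cauchySpan (x : {x : ℝ // 0 < x}) : cauchyKernel x ∈ cauchySpan :=
  Submodule.le_topologicalClosure _ (Submodule.subset_span (Or.inr ⟨x, rfl⟩))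

theorem one_mem_cauchySpan : (1 : ℝ≥0 →ᵇ ℝ) ∈ cauchySpan :=
  Submodule.le_topologicalClosure _ (Submodule.subset_span (Or.inl rfl))

theorem cauchyKernel_mul_mem_cauchySpan_of_ne {x y : {x : ℝ // 0 < x}} (h : x ≠ y) :
    cauchyKernel x * cauchyKernel y ∈ cauchySpan := by
  have h' : (y : ℝ) - x ≠ 0 := fun h0 => h (Subtype.ext (sub_eq_zero.1 h0).symm)
  have : cauchyKernel x * cauchyKernel y =
      ((y : ℝ) - x)⁻¹ • (cauchyKernel x - cauchyKernel y) := by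
    ext l
    have hx := x.2
    have hy := y.2
    have hl := l.2
    have h1 : (x : ℝ) + l ≠ 0 := by positivity
    have h2 : (y : ℝ) + l ≠ 0 := by positivity
    simp only [BoundedContinuousFunction.coe_mul, Pi.mul_apply, BoundedContinuousFunction.coe_smul,
      BoundedContinuousFunction.coe_sub, Pi.sub_apply, cauchyKernel_apply, smul_eq_mul]
    field_simp
    ring
  rw [this]
  exact cauchySpan.smul_mem _ (cauchySpan.sub_mem (cauchyKernel_mem_cauchySpan x)
    (cauchyKernel_mem_cauchySpan y))

/-- Products of Cauchy kernels at distinct points are combinations of the two kernels; the square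
of a kernel is a limit of such products. -/
theorem cauchyKernel_mul_mem_cauchySpan (x y : {x : ℝ // 0 < x}) :
    cauchyKernel x * cauchyKernel y ∈ cauchySpan := by
  rcases ne_or_eq x y with h | rfl
  · exact cauchyKernel_mul_mem_cauchySpan_of_ne h
  · have hy : Tendsto (fun n : ℕ => (⟨(x : ℝ) + 1 / ((n : ℝ) + 1),
        add_pos x.2 (by positivity)⟩ : {x : ℝ // 0 < x})) atTop (𝓝 x) := by
      rw [tendsto_subtype_rng]
      simpa using (tendsto_one_div_add_atTop_nhds_zero_nat (𝕜 := ℝ)).const_add (x : ℝ)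
    refine (Submodule.isClosed_topologicalClosure _).mem_of_tendsto
      (((continuous_cauchyKernel.tendsto x).comp hy).const_mul (cauchyKernel x))
      (Eventually.of_forall fun n => cauchyKernel_mul_mem_cauchySpan_of_ne fun h => ?_)
    have h1 : (x : ℝ) = x + 1 / ((n : ℝ) + 1) := congrArg Subtype.val h
    have h2 : (0 : ℝ) < 1 / ((n : ℝ) + 1) := by positivity
    linarith

theorem mul_mem_cauchySpan {f g : ℝ≥0 →ᵇ ℝ} (hf : f ∈ cauchySpan) (hg : g ∈ cauchySpan) :
    f * g ∈ cauchySpan := by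
  have hspan : ∀ a ∈ Submodule.span ℝ (insert 1 (Set.range cauchyKernel)),
      ∀ b ∈ Submodule.span ℝ (insert 1 (Set.range cauchyKernel)), a * b ∈ cauchySpan := by
    intro a ha b hb
    induction ha, hb using Submodule.span_induction₂ with
    | mem_mem a b ha hb =>
      rcases ha with rfl | ⟨x, rfl⟩
      · rw [one_mul]
        exact Submodule.le_topologicalClosure _ (Submodule.subset_span hb)
      · rcases hb with rfl | ⟨y, rfl⟩
        · rw [mul_one]; exact cauchyKernel_mem_cauchySpan x
        · exact cauchyKernel_mul_mem_cauchySpan x y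
    | zero_left b hb => rw [zero_mul]; exact cauchySpan.zero_mem
    | zero_right a ha => rw [mul_zero]; exact cauchySpan.zero_mem
    | add_left a b c _ _ _ h1 h2 => rw [add_mul]; exact cauchySpan.add_mem h1 h2
    | add_right a b c _ _ _ h1 h2 => rw [mul_add]; exact cauchySpan.add_mem h1 h2
    | smul_left r a b _ _ h => rw [smul_mul_assoc]; exact cauchySpan.smul_mem r h
    | smul_right r a b _ _ h => rw [mul_smul_comm]; exact cauchySpan.smul_mem r h
  have h := map_mem_closure₂ (u := (cauchySpan : Set (ℝ≥0 →ᵇ ℝ))) continuous_mul hf hg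
    (fun a ha b hb => hspan a ha b hb)
  have hcl : IsClosed (cauchySpan : Set (ℝ≥0 →ᵇ ℝ)) := Submodule.isClosed_topologicalClosure _
  rwa [hcl.closure_eq] at h

/-- The closed linear span of the constants and the Cauchy kernels is a star subalgebra. -/
noncomputable def cauchyAlgebra : StarSubalgebra ℝ (ℝ≥0 →ᵇ ℝ) where
  carrier := cauchySpan
  mul_mem' := mul_mem_cauchySpan
  one_mem' := one_mem_cauchySpan
  add_mem' := cauchySpan.add_mem
  zero_mem' := cauchySpan.zero_mem
  algebraMap_mem' r := by
    rw [Algebra.algebraMap_eq_smul_one]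
    exact cauchySpan.smul_mem r one_mem_cauchySpan
  star_mem' {f} hf := by
    rwa [show star f = f from by ext l; simp]

theorem separatesPoints_cauchyAlgebra :
    (cauchyAlgebra.map (BoundedContinuousFunction.toContinuousMapStarₐ ℝ)).SeparatesPoints := by
  intro l m hlm
  refine ⟨_, ⟨_, ⟨cauchyKernel ⟨1, one_pos⟩, cauchyKernel_mem_cauchySpan _, rfl⟩, rfl⟩, ?_⟩
  have hl := l.2
  have hm := m.2
  change 1 / ((1 : ℝ) + l) ≠ 1 / ((1 : ℝ) + m)
  intro h
  apply hlm
  rw [one_div, one_div, inv_inj] at h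
  exact NNReal.coe_injective (by linarith)

/-- Uniform limits of functions whose integrals converge have convergent integrals. -/
theorem tendsto_integral_of_mem_cauchySpan {μ : ℕ → ProbabilityMeasure ℝ≥0}
    {μ₀ : ProbabilityMeasure ℝ≥0}
    (h : ∀ x : ℝ, 0 < x → Tendsto (fun n => stieltjes (μ n) x) atTop (𝓝 (stieltjes μ₀ x)))
    {f : ℝ≥0 →ᵇ ℝ} (hf : f ∈ cauchySpan) :
    Tendsto (fun n => ∫ l, f l ∂(μ n : Measure ℝ≥0)) atTop (𝓝 (∫ l, f l ∂(μ₀ : Measure ℝ≥0))) := by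
  have hint : ∀ (ν : ProbabilityMeasure ℝ≥0) (g : ℝ≥0 →ᵇ ℝ), Integrable g (ν : Measure ℝ≥0) :=
    fun ν g => g.integrable _
  have hspan : ∀ g ∈ Submodule.span ℝ (insert 1 (Set.range cauchyKernel)),
      Tendsto (fun n => ∫ l, g l ∂(μ n : Measure ℝ≥0)) atTop
        (𝓝 (∫ l, g l ∂(μ₀ : Measure ℝ≥0))) := by
    intro g hg
    induction hg using Submodule.span_induction with
    | mem g hg =>
      rcases hg with rfl | ⟨x, rfl⟩
      · simp
      · exact h x x.2
    | zero => simp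
    | add f g _ _ h1 h2 =>
      simp only [BoundedContinuousFunction.coe_add, Pi.add_apply]
      simp_rw [integral_add (hint _ f) (hint _ g)]
      exact h1.add h2
    | smul r f _ h1 =>
      simp only [BoundedContinuousFunction.coe_smul]
      simp_rw [integral_smul]
      exact h1.const_smul r
  rw [Metric.tendsto_atTop]
  intro ε hε
  obtain ⟨g, hg, hfg⟩ := Metric.mem_closure_iff.1 hf (ε / 3) (by positivity)
  obtain ⟨N, hN⟩ := Metric.tendsto_atTop.1 (hspan g hg) (ε / 3) (by positivity)
  have hbound : ∀ ν : ProbabilityMeasure ℝ≥0,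
      dist (∫ l, f l ∂(ν : Measure ℝ≥0)) (∫ l, g l ∂(ν : Measure ℝ≥0)) < ε / 3 := by
    intro ν
    rw [dist_eq_norm, ← integral_sub (hint ν f) (hint ν g)]
    refine lt_of_le_of_lt ?_ hfg
    rw [dist_eq_norm]
    simpa using (f - g).norm_integral_le_norm (ν : Measure ℝ≥0)
  refine ⟨N, fun n hn => ?_⟩
  have h1 := hbound (μ n)
  have h2 := hbound μ₀
  rw [dist_comm] at h2
  linarith [hN n hn, dist_triangle4 (∫ l, f l ∂(μ n : Measure ℝ≥0))
    (∫ l, g l ∂(μ n : Measure ℝ≥0)) (∫ l, g l ∂(μ₀ : Measure ℝ≥0)) (∫ l, f l ∂(μ₀ : Measure ℝ≥0))]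

theorem tendsto_of_tendsto_stieltjes {μ : ℕ → ProbabilityMeasure ℝ≥0}
    {μ₀ : ProbabilityMeasure ℝ≥0}
    (h : ∀ w : ℝ, 0 < w → Tendsto (fun n => stieltjes (μ n) (1 / (w * Real.exp w))) atTop
      (𝓝 (Real.exp w - 1)))
    (h₀ : ∀ w : ℝ, 0 < w → stieltjes μ₀ (1 / (w * Real.exp w)) = Real.exp w - 1) :
    Tendsto μ atTop (𝓝 μ₀) := by
  refine ProbabilityMeasure.tendsto_of_tight_of_separatesPoints ℝ
    (isTightMeasureSet_of_tendsto_stieltjes h) separatesPoints_cauchyAlgebra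
    fun g hg => tendsto_integral_of_mem_cauchySpan (fun x hx => ?_) hg
  obtain ⟨w, hw, rfl⟩ := exists_eq_one_div_mul_exp hx
  rw [h₀ w hw]
  exact h w hw

/-- A limit law exists, by Prokhorov's theorem, as soon as one sequence of probability measures
has the right limiting Stieltjes transform. -/
theorem exists_stieltjes_eq {μ : ℕ → ProbabilityMeasure ℝ≥0}
    (h : ∀ w : ℝ, 0 < w → Tendsto (fun n => stieltjes (μ n) (1 / (w * Real.exp w))) atTop
      (𝓝 (Real.exp w - 1))) :
    ∃ μ₀ : ProbabilityMeasure ℝ≥0,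
      ∀ w : ℝ, 0 < w → stieltjes μ₀ (1 / (w * Real.exp w)) = Real.exp w - 1 := by
  have h_compact : IsCompact (closure {μ n | n}) :=
    isCompact_closure_of_isTightMeasureSet (by
      simpa using isTightMeasureSet_of_tendsto_stieltjes h)
  obtain ⟨μ₀, -, hμ₀⟩ := h_compact.ultrafilter_le_nhds ((Ultrafilter.of atTop).map μ)
    (.trans (by simp) (monotone_principal subset_closure))
  have hμ₀ : Tendsto μ (Ultrafilter.of atTop : Ultrafilter ℕ) (𝓝 μ₀) := hμ₀
  refine ⟨μ₀, fun w hw => tendsto_nhds_unique ?_ ((h w hw).mono_left (Ultrafilter.of_le atTop))⟩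
  exact (ProbabilityMeasure.tendsto_iff_forall_integral_tendsto.1 hμ₀)
    (cauchyKernel ⟨1 / (w * Real.exp w), by positivity⟩)

end WeakConvergence

/-! ### Empirical spectral distributions and the limit theorem -/

section Spectral

open scoped NNReal

theorem triangularESD_toMeasure (a : LowerIndex → ℂ) (n : ℕ) [NeZero n] :
    (triangularESD a n : Measure ℝ) = (n : ℝ≥0∞)⁻¹ •
      ∑ i : Fin n, Measure.dirac ((scaledGram_isHermitian a n).eigenvalues i) := rfl

open scoped ComplexOrder in
theorem eigenvalues_scaledGram_nonneg (a : LowerIndex → ℂ) (n : ℕ) (i : Fin n) :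
    0 ≤ (scaledGram_isHermitian a n).eigenvalues i := by
  refine Matrix.PosSemidef.eigenvalues_nonneg ?_ i
  refine (Matrix.posSemidef_self_mul_conjTranspose (lowerTriangular a n)).smul ?_
  simp

theorem integral_triangularESD (a : LowerIndex → ℂ) (n : ℕ) [NeZero n] (f : ℝ → ℝ) :
    ∫ l, f l ∂(triangularESD a n : Measure ℝ) =
      (n : ℝ)⁻¹ * ∑ i : Fin n, f ((scaledGram_isHermitian a n).eigenvalues i) := by
  rw [triangularESD_toMeasure, integral_smul_measure, integral_finsetSum_measure]
  · simp
  · intro i _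
    exact integrable_dirac (by simp)

/-- The trace of the resolvent in terms of the spectrum. -/
theorem trace_gramResolvent_lowerTriangular (a : LowerIndex → ℂ) (n : ℕ) [NeZero n] {x : ℝ}
    (hx : 0 < x) :
    (gramResolvent (lowerTriangular a n) (n * x)).trace.re =
      (n : ℝ)⁻¹ * ∑ i : Fin n, 1 / (x + (scaledGram_isHermitian a n).eigenvalues i) := by
  have hn : (n : ℂ) ≠ 0 := Nat.cast_ne_zero.2 (NeZero.ne n)
  set hS := scaledGram_isHermitian a n
  set U : Matrix (Fin n) (Fin n) ℂ := (hS.eigenvectorUnitary : Matrix (Fin n) (Fin n) ℂ)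
  have hUU : U * Uᴴ = 1 := Unitary.coe_mul_star_self hS.eigenvectorUnitary
  have hUU' : Uᴴ * U = 1 := Unitary.coe_star_mul_self hS.eigenvectorUnitary
  have hgram : lowerTriangular a n * (lowerTriangular a n)ᴴ =
      (n : ℂ) • (U * Matrix.diagonal (fun i => (hS.eigenvalues i : ℂ)) * Uᴴ) := by
    have h := hS.spectral_theorem
    rw [Unitary.conjStarAlgAut_apply] at h
    have h' : U * Matrix.diagonal (fun i => (hS.eigenvalues i : ℂ)) * Uᴴ = scaledGram a n := h.symm
    rw [h', scaledGram, smul_smul, mul_one_div_cancel hn, one_smul]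
  set D : Matrix (Fin n) (Fin n) ℂ :=
    Matrix.diagonal fun i => 1 / ((x : ℂ) + (hS.eigenvalues i : ℂ)) with hD
  have hres : gramResolvent (lowerTriangular a n) (n * x) = (n : ℂ)⁻¹ • (U * D * Uᴴ) := by
    apply gramResolvent_eq_of_mul_eq_one
    have h1 : ((n * x : ℝ) : ℂ) • (1 : Matrix (Fin n) (Fin n) ℂ) =
        (n : ℂ) • (U * Matrix.diagonal (fun _ => (x : ℂ)) * Uᴴ) := by
      rw [← Matrix.smul_one_eq_diagonal, Matrix.mul_smul, Matrix.smul_mul, mul_one, hUU,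
        smul_smul]
      push_cast; rfl
    rw [hgram, h1, ← smul_add, smul_mul_smul_comm, mul_inv_cancel₀ hn, one_smul, ← Matrix.add_mul,
      ← Matrix.mul_add, Matrix.diagonal_add]
    calc U * Matrix.diagonal (fun i => (hS.eigenvalues i : ℂ) + x) * Uᴴ * (U * D * Uᴴ)
        = U * (Matrix.diagonal (fun i => (hS.eigenvalues i : ℂ) + x) * (Uᴴ * U) * D) * Uᴴ := by
          simp only [Matrix.mul_assoc]
      _ = 1 := by
          rw [hUU', mul_one, hD, Matrix.diagonal_mul_diagonal]
          have : (fun i => ((hS.eigenvalues i : ℂ) + x) * (1 / ((x : ℂ) + hS.eigenvalues i))) =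
              fun _ => 1 := by
            funext i
            have h0 : x + hS.eigenvalues i ≠ 0 :=
              (add_pos_of_pos_of_nonneg hx (eigenvalues_scaledGram_nonneg a n i)).ne'
            rw [add_comm (hS.eigenvalues i : ℂ), mul_one_div_cancel]
            exact_mod_cast h0
          rw [this, Matrix.diagonal_one, mul_one, hUU]
  rw [hres, Matrix.trace_smul, Matrix.trace_mul_cycle, hUU', one_mul, hD, Matrix.trace_diagonal]
  have : (n : ℂ)⁻¹ • ∑ i, 1 / ((x : ℂ) + (hS.eigenvalues i : ℂ)) =
      (((n : ℝ)⁻¹ * ∑ i, 1 / (x + hS.eigenvalues i) : ℝ) : ℂ) := by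
    push_cast; rfl
  rw [this, Complex.ofReal_re]

/-- The empirical spectral distribution as a law on `ℝ≥0`. Negative parts are cut off, which loses
nothing because the eigenvalues are nonnegative. -/
noncomputable def triangularESDNNReal (a : LowerIndex → ℂ) (n : ℕ) [NeZero n] :
    ProbabilityMeasure ℝ≥0 :=
  (triangularESD a n).map (f := Real.toNNReal) measurable_real_toNNReal.aemeasurable

theorem map_coe_triangularESDNNReal (a : LowerIndex → ℂ) (n : ℕ) [NeZero n] :
    (triangularESDNNReal a n).map (f := ((↑) : ℝ≥0 → ℝ)) measurable_coe_nnreal_real.aemeasurable =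
      triangularESD a n := by
  apply Subtype.ext
  change Measure.map _ (Measure.map _ (triangularESD a n : Measure ℝ)) = _
  rw [Measure.map_map measurable_coe_nnreal_real measurable_real_toNNReal]
  refine (Measure.map_congr (g := id) ?_).trans Measure.map_id
  rw [triangularESD_toMeasure]
  refine Measure.ae_smul_measure ?_ _
  have hset : MeasurableSet {l : ℝ | ((Real.toNNReal l : ℝ≥0) : ℝ) = l} :=
    measurableSet_eq_fun (by fun_prop) measurable_id
  change ∀ᵐ l ∂_, ((Real.toNNReal l : ℝ≥0) : ℝ) = l
  rw [ae_iff, Measure.finsetSum_apply]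
  refine Finset.sum_eq_zero fun i _ => ?_
  have hcompl : MeasurableSet {l : ℝ | ¬ ((Real.toNNReal l : ℝ≥0) : ℝ) = l} := hset.compl
  rw [Measure.dirac_apply' _ hcompl]
  simpa using eigenvalues_scaledGram_nonneg a n i

theorem stieltjes_triangularESDNNReal (a : LowerIndex → ℂ) (n : ℕ) [NeZero n] {x : ℝ}
    (hx : 0 < x) :
    stieltjes (triangularESDNNReal a n) x =
      (gramResolvent (lowerTriangular a n) (n * x)).trace.re := by
  have h : stieltjes (triangularESDNNReal a n) x =
      ∫ l, 1 / (x + (Real.toNNReal l : ℝ)) ∂(triangularESD a n : Measure ℝ) :=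
    integral_map measurable_real_toNNReal.aemeasurable
      (by fun_prop : Measurable fun l : ℝ≥0 => 1 / (x + (l : ℝ))).aestronglyMeasurable
  rw [h, integral_triangularESD, trace_gramResolvent_lowerTriangular a n hx]
  simp_rw [Real.coe_toNNReal _ (eigenvalues_scaledGram_nonneg a n _)]

end Spectral

section Limit

open scoped NNReal

/-- Almost surely, the Stieltjes transforms of the empirical spectral distributions converge at
every point of the positive half-line. -/
theorem ae_tendsto_stieltjes {Ω : Type*} [MeasurableSpace Ω] {P : Measure Ω}
    [IsProbabilityMeasure P] {X : LowerIndex → Ω → ℂ} (hX : IsIIDVarianceOne P X) :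
    ∀ᵐ ω ∂P, ∀ w : ℝ, 0 < w →
      Tendsto (fun n : ℕ => stieltjes (triangularESDNNReal (fun p => X p ω) (n + 1))
        (1 / (w * Real.exp w))) atTop (𝓝 (Real.exp w - 1)) := by
  have h : ∀ᵐ ω ∂P, ∀ q : ℚ, 0 < q →
      Tendsto (fun n : ℕ => (gramResolvent (lowerTriangular (fun p => X p ω) n)
        (n * (1 / ((q : ℝ) * Real.exp q)))).trace.re) atTop (𝓝 (Real.exp q - 1)) := by
    rw [ae_all_iff]
    intro q
    by_cases hq : 0 < q
    · filter_upwards [ae_tendsto_trace hX (w := (q : ℝ)) (by exact_mod_cast hq)] with ω hω _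
      exact hω
    · exact ae_of_all _ fun _ h => absurd h hq
  filter_upwards [h] with ω hω w hw
  refine tendsto_stieltjes_of_rat (fun q hq => ?_) hw
  have hq' : (0 : ℝ) < q := by exact_mod_cast hq
  refine ((hω q hq).comp (tendsto_add_atTop_nat 1)).congr fun n => ?_
  rw [stieltjes_triangularESDNNReal _ _ (by positivity)]
  rfl

/-- An array as in the theorem exists: independent standard real Gaussian entries. -/
theorem exists_isIIDVarianceOne :
    ∃ (Ω : Type) (_ : MeasurableSpace Ω) (P : Measure Ω) (X : LowerIndex → Ω → ℂ),
      IsProbabilityMeasure P ∧ IsIIDVarianceOne P X := by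
  obtain ⟨Ω, _, P, X, hm, hlaw, hind, hP⟩ := exists_iid LowerIndex (gaussianReal 0 1)
  have hLp : ∀ p, MemLp (X p) 2 P := fun p =>
    (memLp_map_measure_iff aestronglyMeasurable_id (hm p).aemeasurable).1
      ((hlaw p).map_eq ▸ memLp_id_gaussianReal 2)
  have hint : ∀ f : ℝ → ℝ, Measurable f → ∀ p, ∫ ω, f (X p ω) ∂P = ∫ t, f t ∂gaussianReal 0 1 :=
    fun f hf p => by
      rw [← (hlaw p).map_eq, integral_map (hm p).aemeasurable hf.aestronglyMeasurable]
  refine ⟨Ω, _, P, fun p ω => (X p ω : ℂ), hP, ⟨fun p => by fun_prop,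
    hind.comp (fun _ => ((↑) : ℝ → ℂ)) fun _ => Complex.measurable_ofReal, fun p q => ?_,
    fun p => (hLp p).ofReal, fun p => ?_⟩⟩
  · have h : IdentDistrib (X p) (X q) P P :=
      ⟨(hm p).aemeasurable, (hm q).aemeasurable, (hlaw p).map_eq.trans (hlaw q).map_eq.symm⟩
    exact h.comp Complex.measurable_ofReal
  · have h0 : ∫ ω, X p ω ∂P = 0 := (hint _ measurable_id p).trans integral_id_gaussianReal
    have h1 : ∫ ω, (X p ω : ℂ) ∂P = 0 := by
      rw [integral_complex_ofReal, h0, Complex.ofReal_zero]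
    have hvar : ∫ t : ℝ, t ^ 2 ∂gaussianReal 0 1 = 1 := by
      have h := variance_id_gaussianReal (μ := 0) (v := 1)
      rw [variance_of_integral_eq_zero measurable_id.aemeasurable integral_id_gaussianReal] at h
      simpa using h
    simp_rw [h1, sub_zero, Complex.norm_real, Real.norm_eq_abs, sq_abs]
    rw [hint (fun t => t ^ 2) (by fun_prop) p, hvar]

theorem theorem1p1 :
    ∃ μ₀ : ProbabilityMeasure ℝ,
      (∀ k : ℕ, Integrable (fun x : ℝ => x ^ k) (μ₀ : Measure ℝ) ∧
        ∫ x : ℝ, x ^ k ∂(μ₀ : Measure ℝ) = (k : ℝ) ^ k / ((k + 1).factorial : ℝ)) ∧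
      ∀ (Ω : Type*) [MeasurableSpace Ω] (P : Measure Ω) [IsProbabilityMeasure P]
        (X : LowerIndex → Ω → ℂ), IsIIDVarianceOne P X →
        ∀ᵐ ω ∂P, Tendsto (fun n : ℕ => triangularESD (fun p => X p ω) (n + 1))
          atTop (𝓝 μ₀) := by
  obtain ⟨μ, hμ⟩ : ∃ μ : ProbabilityMeasure ℝ≥0,
      ∀ w : ℝ, 0 < w → stieltjes μ (1 / (w * Real.exp w)) = Real.exp w - 1 := by
    obtain ⟨Ω, _, P, X, _, hX⟩ := exists_isIIDVarianceOne
    obtain ⟨ω, hω⟩ := (ae_tendsto_stieltjes hX).exists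
    exact exists_stieltjes_eq hω
  refine ⟨μ.map (f := ((↑) : ℝ≥0 → ℝ)) measurable_coe_nnreal_real.aemeasurable, fun k => ?_,
    fun Ω _ P _ X hX => ?_⟩
  · have hmeas : ∀ ν : Measure ℝ, AEStronglyMeasurable (fun x : ℝ => x ^ k) ν := fun ν => by
      fun_prop
    obtain ⟨h1, h2⟩ := moments_of_stieltjes hμ k
    exact ⟨(integrable_map_measure (hmeas _) measurable_coe_nnreal_real.aemeasurable).2 h1,
      (integral_map measurable_coe_nnreal_real.aemeasurable (hmeas _)).trans h2⟩
  · filter_upwards [ae_tendsto_stieltjes hX] with ω hω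
    have h := ProbabilityMeasure.tendsto_map_of_tendsto_of_continuous _ _
      (tendsto_of_tendsto_stieltjes hω hμ) NNReal.continuous_coe
    simpa only [map_coe_triangularESDNNReal] using h

end Limit
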